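/- Throughout, for $r_0>0$ write $\Pi=\{x\in\mathbb R^2: r_0+x_2>0\}$, where $x=(x_1,x_2)=(z,r-r_0)$ are shifted cylindrical coordinates, and $\Sigma(\xi|\rho)$ for the open disk of center $\xi\in\mathbb R^2$ and radius $\rho$. **Axisymmetric Euler flow without swirl.** Let $G=(G_1,G_2)$ be the kernel $$G_1(x,y)=\frac1{2\pi}\int_0^\pi\frac{(r_0+y_2)\,[(r_0+y_2)-(r_0+x_2)\cos\theta]}{\{|x-y|^2+2(r_0+x_2)(r_0+y_2)(1-\cos\theta)\}^{3/2}}\,d\theta,$$ $$G_2(x,y)=\frac1{2\pi}\int_0^\pi\frac{(r_0+y_2)(x_1-y_1)\cos\theta}{\{|x-y|^2+2(r_0+x_2)(r_0+y_2)(1-\cos\theta)\}^{3/2}}\,d\theta .$$ The evolution of a bounded initial (scalar) vorticity $\omega(\cdot,0)$ with compact support in $\Pi$ is the solution $\omega(x,t)$, $t\ge0$, with continuous invertible flow $\phi_t:\Pi\to\Pi$, $\phi_{-t}:=\phi_t^{-1}$, of $$u(x,t)=\int_\Pi G(x,y)\,\omega(y,t)\,dy,\qquad \frac{d}{dt}\phi_t(x)=u(\phi_t(x),t),\quad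 \phi_0(x)=x,\qquad \omega(x,t)=\frac{r_0+x_2}{r_0+\phi_{-t,2}(x)}\,\omega(\phi_{-t}(x),0)\quad(x\in\Pi),$$ where $\omega$ is extended by $0$ outside $\Pi$ and satisfies $\frac{d}{dt}\int_\Pi\omega f\,dx=\int_\Pi\omega\,(u\cdot\nabla f+\partial_t f)\,dx$ for all bounded smooth functions $f=f(x,t)$. **Point vortices.** Let $a_1,\dots,a_N\in\mathbb R$, $z_1,\dots,z_N\in\mathbb R^2$, and let $z_i(t)$, $t\ge 0$, be a global solution of $$\dot z_i(t)=\sum_{j\ne i}a_jK(z_i(t)-z_j(t)),\quad z_i(0)=z_i,\qquad K(x)=-\frac1{2\pi}\nabla^\perp\log|x|,\quad \nabla^\perp=(\partial_2,-\partial_1),$$ with $$R_m:=\inf_{t\ge0}\min_{i\ne j}|z_i(t)-z_j(t)|>0$$ ($R_m=+\infty$ if $N\le 1$). **Theorem.** Let $\alpha>1$, $M>0$ and, for $\varepsilon>0$ small, let $r_0=|\log\varepsilon|^\alpha$ and $\omega_\varepsilon(x,0)=\sum_{i=1}^N\omega_{i,\varepsilon}(x,0)$, where each $\omega_{i,\varepsilon}(\cdot,0)$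 is a non-negative or non-positive function such that $$\operatorname{supp}\omega_{i,\varepsilon}(\cdot,0)\subseteq\Sigma(z_i|\varepsilon),\qquad \int\omega_{i,\varepsilon}(x,0)\,dx=a_i,\qquad |\omega_{i,\varepsilon}(x,0)|\le M\varepsilon^{-2}.$$ Consider the evolution of $\omega_\varepsilon(\cdot,0)$, with flow $\phi_t$, and put, for $x\in\Pi$, $$\omega_{i,\varepsilon}(x,t):=\frac{r_0+x_2}{r_0+\phi_{-t,2}(x)}\,\omega_{i,\varepsilon}(\phi_{-t}(x),0)$$ (and $0$ for $x\notin\Pi$), so that $\omega_\varepsilon(x,t)=\sum_{i=1}^N\omega_{i,\varepsilon}(x,t)$; let $\Lambda_{i,\varepsilon}(t):=\operatorname{supp}\omega_{i,\varepsilon}(\cdot,t)$. For $\beta>0$ let $$T_{\varepsilon,\beta}:=\min_i\,\sup\Big\{t>0:\ |x-z_i(s)|\le|\log\varepsilon|^{-\beta}\ \ \forall x\in\Lambda_{i,\varepsilon}(s)\ \ \forall s\in[0,t]\Big\}\in[-\infty,+\infty].$$ Then for each $\beta\in\big(0,\frac{\alpha-1}4\big)$ there exist $\varepsilon_0>0$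 and $\zeta>0$ such that $$T_{\varepsilon,\beta}\ \ge\ \zeta\log|\log\varepsilon|\qquad\forall\,\varepsilon\in(0,\varepsilon_0).$$ -/

import Mathlib

open Set MeasureTheory
open scoped ContDiff

noncomputable section

namespace VortexRings

/-- The plane `ℝ²` with its Euclidean norm. In the shifted cylindrical coordinates
`x = (x₁, x₂) = (z, r - r₀)`, the coordinate `x₁ = z` is `x 0` and `x₂ = r - r₀` is `x 1`. -/
abbrev Plane : Type := EuclideanSpace ℝ (Fin 2)

/-- The open half-plane `{r > 0}` in the shifted coordinates: `{x : r₀ + x₂ > 0}`. -/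
def halfPlane (r₀ : ℝ) : Set Plane := {x | 0 < r₀ + x 1}

/-! ### The point vortex system -/

/-- `K(x) = -(1/2π) ∇^⊥ log |x|` with `∇^⊥ = (∂₂, -∂₁)`, that is
`K(x) = (1/2π) (-x₂, x₁) / |x|²` for `x ≠ 0`. -/
def kerK (x : Plane) : Plane :=
  !₂[-(1 / (2 * Real.pi)) * (x 1 / ‖x‖ ^ 2), (1 / (2 * Real.pi)) * (x 0 / ‖x‖ ^ 2)]

/-- `z i t`, `t ≥ 0`, solves globally in time the point vortex system with intensities `a` and
initial positions `z₀`. -/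
structure IsPointVortexMotion {N : ℕ} (a : Fin N → ℝ) (z₀ : Fin N → Plane)
    (z : Fin N → ℝ → Plane) : Prop where
  init : ∀ i, z i 0 = z₀ i
  deriv : ∀ i, ∀ t : ℝ, 0 ≤ t →
    HasDerivWithinAt (z i) (∑ j with j ≠ i, a j • kerK (z i t - z j t)) (Ici 0) t

/-- `R_m = inf_{t ≥ 0} min_{i ≠ j} |z_i(t) - z_j(t)|`, with value in `[0, ∞]`
(it is `∞` if there is no pair `i ≠ j`). -/
def minSeparation {N : ℕ} (z : Fin N → ℝ → Plane) : ENNReal :=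
  ⨅ (t : ℝ) (_ : 0 ≤ t) (i : Fin N) (j : Fin N) (_ : i ≠ j), edist (z i t) (z j t)

/-! ### The initial vorticity -/

/-- The `N` components `w i` of the initial vorticity, for a given value of `ε`: each one is of
definite sign, supported in the open disk of center `z₀ i` and radius `ε`, has integral `a i`, and
is bounded by `M ε⁻²`. -/
structure IsConcentratedData {N : ℕ} (M ε : ℝ) (a : Fin N → ℝ) (z₀ : Fin N → Plane)
    (w : Fin N → Plane → ℝ) : Prop where
  measurable : ∀ i, Measurable (w i)
  sign : ∀ i, (∀ x, 0 ≤ w i x) ∨ (∀ x, w i x ≤ 0)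
  support : ∀ i, tsupport (w i) ⊆ Metric.ball (z₀ i) ε
  mass : ∀ i, ∫ x, w i x = a i
  bound : ∀ i x, |w i x| ≤ M / ε ^ 2

/-! ### Axisymmetric Euler flow without swirl -/

/-- The Biot-Savart kernel `G(x, y)` of axisymmetric flows without swirl, in the coordinates
`x = (z, r - r₀)`, `y = (z', r' - r₀)`. -/
def kerG (r₀ : ℝ) (x y : Plane) : Plane :=
  !₂[(1 / (2 * Real.pi)) * ∫ θ in (0 : ℝ)..Real.pi,
        (r₀ + y 1) * ((r₀ + y 1) - (r₀ + x 1) * Real.cos θ) /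
          (‖x - y‖ ^ 2 + 2 * (r₀ + x 1) * (r₀ + y 1) * (1 - Real.cos θ)) ^ (3 / 2 : ℝ),
     (1 / (2 * Real.pi)) * ∫ θ in (0 : ℝ)..Real.pi,
        (r₀ + y 1) * (x 0 - y 0) * Real.cos θ /
          (‖x - y‖ ^ 2 + 2 * (r₀ + x 1) * (r₀ + y 1) * (1 - Real.cos θ)) ^ (3 / 2 : ℝ)]

/-- The velocity field `u(x) = ∫ G(x, y) w(y) dy` generated by the (scalar) vorticity `w`. -/
def velocity (r₀ : ℝ) (w : Plane → ℝ) (x : Plane) : Plane :=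
  ∫ y in halfPlane r₀, w y • kerG r₀ x y

/-- The evolution of an initial profile `w₀` for which `w / r` is constant along trajectories:
`w(x, t) = (r₀ + x₂) / (r₀ + φ_{-t,2}(x)) * w₀(φ_{-t}(x))` in the half-plane, and `0` outside it.
Here `ψ t` stands for `φ_{-t}`, the inverse of the flow map `φ t`. -/
def transported (r₀ : ℝ) (ψ : ℝ → Plane → Plane) (w₀ : Plane → ℝ) (t : ℝ) : Plane → ℝ :=
  (halfPlane r₀).indicator fun x => (r₀ + x 1) / (r₀ + ψ t x 1) * w₀ (ψ t x)

/-- `φ t`, with inverse maps `ψ t = φ_{-t}`, is the flow (for times `t ≥ 0`) of the axisymmetric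
Euler solution without swirl with initial vorticity `w₀`. The vorticity at time `t` is
`transported r₀ ψ w₀ t`, i.e. vorticity over distance from the axis is constant along
trajectories; the trajectories follow the velocity that this vorticity generates by the
Biot-Savart law; and the vorticity solves the vorticity equation in weak form. -/
structure IsEulerFlow (r₀ : ℝ) (w₀ : Plane → ℝ) (φ ψ : ℝ → Plane → Plane) : Prop where
  mapsTo : ∀ t : ℝ, 0 ≤ t → MapsTo (φ t) (halfPlane r₀) (halfPlane r₀)
  mapsTo_inv : ∀ t : ℝ, 0 ≤ t → MapsTo (ψ t) (halfPlane r₀) (halfPlane r₀)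
  left_inv : ∀ t : ℝ, 0 ≤ t → ∀ x ∈ halfPlane r₀, ψ t (φ t x) = x
  right_inv : ∀ t : ℝ, 0 ≤ t → ∀ x ∈ halfPlane r₀, φ t (ψ t x) = x
  continuous : ContinuousOn (fun p : ℝ × Plane => φ p.1 p.2) (Ici 0 ×ˢ halfPlane r₀)
  continuous_inv : ContinuousOn (fun p : ℝ × Plane => ψ p.1 p.2) (Ici 0 ×ˢ halfPlane r₀)
  init : ∀ x ∈ halfPlane r₀, φ 0 x = x
  /-- `d/dt φ_t(x) = u(φ_t(x), t)` -/
  trajectory : ∀ x ∈ halfPlane r₀, ∀ t : ℝ, 0 ≤ t →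
    HasDerivWithinAt (fun s => φ s x)
      (velocity r₀ (transported r₀ ψ w₀ t) (φ t x)) (Ici 0) t
  /-- `d/dt ω_t[f] = ω_t[u_z ∂_z f + u_r ∂_r f + ∂_t f]` for bounded smooth `f = f(t, x)`, where
  `ω_t[f] = ∫ ω(x, t) f(t, x) dx` -/
  weak : ∀ f : ℝ × Plane → ℝ, ContDiff ℝ ∞ f → (∃ C : ℝ, ∀ p, |f p| ≤ C) →
    ∀ t : ℝ, 0 ≤ t →
      HasDerivWithinAt
        (fun s => ∫ x in halfPlane r₀, transported r₀ ψ w₀ s x * f (s, x))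
        (∫ x in halfPlane r₀, transported r₀ ψ w₀ t x *
          fderiv ℝ f (t, x) ((1 : ℝ), velocity r₀ (transported r₀ ψ w₀ t) x))
        (Ici 0) t

/-! ### The exit time -/

/-- `T = min_i sup {t > 0 : |x - z_i(s)| ≤ ρ for all x ∈ Λ_i(s), s ∈ [0, t]}`, an extended real
number, where `Λ_i(s)` is the support of the `i`-th component of the vorticity at time `s`,
i.e. of the evolution of the `i`-th component `w i` of the initial vorticity. -/
def exitTime {N : ℕ} (r₀ : ℝ) (ψ : ℝ → Plane → Plane) (w : Fin N → Plane → ℝ)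
    (z : Fin N → ℝ → Plane) (ρ : ℝ) : EReal :=
  ⨅ i : Fin N, sSup ((fun t : ℝ => (t : EReal)) ''
    {t : ℝ | 0 < t ∧ ∀ s ∈ Icc 0 t, ∀ x ∈ tsupport (transported r₀ ψ (w i) s),
      ‖x - z i s‖ ≤ ρ})

end VortexRings

end

noncomputable section

namespace VortexRings

open Filter Topology

/-! ### The planar kernel -/

/-! Write L = |log ε|, r₀ = L^α and γ = α - 1. Far from the axis the kernel G differs from the
planar kernel K by O(r₀⁻¹ log(r₀/|x - y|)) (`norm_kerG_sub_kerK_le`). Integrated against a density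
of size ε⁻² and bounded mass, this gives an error δ of order L/r₀ = L^(-γ) in the velocity
(`axisymmetricError_le`). As long as each component stays in a small disk about its point vortex, it
is therefore moved by three fields: the planar field it generates itself, the Lipschitz field of the
other vortices, and a drift made of δ and of the first moments.

Everything is measured by the absolute moments about the point vortices z_i(t). For the second
moment the self-interaction cancels, because K is odd and K(v) ⊥ v. A Grönwall argument then keeps
the second moments below (δ e^{cT})² (`IsConfinedFlow.secondMoment_le`), so the first moments are
O(δ e^{cT}).

For higher moments the self-interaction no longer vanishes. Symmetrization controls it at a scale l,
provided that lower moments are small compared with powers of l (`IsLocalized.abs_momentRate_le`,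
`IsConfinedFlow.moment_le`). This is used twice. A fixed order 2k+2 is controlled at scale l₁ from
the first moments. Then the order 2n+2 with n ~ L is controlled at scale l₂ from the moment of order
2k+2. The intermediate stage is needed because the factor n ~ L in the condition cannot in general
be absorbed by the first moment, which is only a power L^(-γ) with γ possibly small. A large fixed
number of factors l₁/l₂ does absorb it.

A moment of order about L makes the mass outside a disk of radius l₃/2 smaller than a power of ε.
This beats the density bound ε⁻², so the radial velocity at distance at least l₃ is at most linear
in the distance (`IsLocalized.inner_relativeVelocity_le`). Trajectories thus stay within l₃ e^{ΛT}
of their vortex. For T = ζ log L and small ζ all the exponentials are small powers of L, and this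
radius is strictly less than L^(-β). The confinement that was assumed is improved, and a continuity
argument closes the loop (`IsVortexSetting.norm_trajectory_sub_le`). -/

lemma inner_plane (v p : Plane) : inner ℝ v p = v 0 * p 0 + v 1 * p 1 := by
  simp [PiLp.inner_apply, Fin.sum_univ_two, mul_comm]

lemma norm_sq_plane (p : Plane) : ‖p‖ ^ 2 = p 0 ^ 2 + p 1 ^ 2 := by
  simp [EuclideanSpace.norm_sq_eq, Fin.sum_univ_two]

lemma abs_apply_le_norm (p : Plane) (i : Fin 2) : |p i| ≤ ‖p‖ := by
  simpa using PiLp.norm_apply_le p i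

lemma norm_plane_le (p : Plane) : ‖p‖ ≤ |p 0| + |p 1| := by
  apply abs_le_of_sq_le_sq' _ (by positivity) |>.2
  rw [norm_sq_plane]
  nlinarith [abs_nonneg (p 0), abs_nonneg (p 1), sq_abs (p 0), sq_abs (p 1)]

@[simp] lemma kerK_apply_zero (p : Plane) :
    kerK p 0 = -(1 / (2 * Real.pi)) * (p 1 / ‖p‖ ^ 2) := by simp [kerK]

@[simp] lemma kerK_apply_one (p : Plane) :
    kerK p 1 = (1 / (2 * Real.pi)) * (p 0 / ‖p‖ ^ 2) := by simp [kerK]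

lemma kerK_zero : kerK 0 = 0 := by
  ext i; fin_cases i <;> simp

lemma kerK_neg (p : Plane) : kerK (-p) = -kerK p := by
  ext i; fin_cases i <;> simp <;> ring

lemma inner_kerK_self (p : Plane) : inner ℝ p (kerK p) = 0 := by
  rw [inner_plane, kerK_apply_zero, kerK_apply_one]; ring

lemma norm_kerK (p : Plane) : ‖kerK p‖ = (2 * Real.pi)⁻¹ * ‖p‖⁻¹ := by
  rcases eq_or_ne p 0 with rfl | hp
  · simp [kerK_zero]
  have hp' : 0 < ‖p‖ := norm_pos_iff.mpr hp
  have hpi := Real.pi_pos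
  rw [← sq_eq_sq₀ (norm_nonneg _) (by positivity), norm_sq_plane, kerK_apply_zero, kerK_apply_one]
  have h := norm_sq_plane p
  field_simp
  rw [h]; ring

lemma norm_kerK_le (p : Plane) : ‖kerK p‖ ≤ ‖p‖⁻¹ := by
  rw [norm_kerK]
  apply mul_le_of_le_one_left (by positivity)
  apply inv_le_one_of_one_le₀
  linarith [Real.pi_gt_three]

/-- Up to the factor 1/2π, K is the inversion p ↦ p/|p|² followed by a rotation, so the difference
is exactly (2π)⁻¹ |p - q| / (|p||q|). -/
lemma norm_kerK_sub_le {p q : Plane} (hp : p ≠ 0) (hq : q ≠ 0) :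
    ‖kerK p - kerK q‖ ≤ ‖p - q‖ / (‖p‖ * ‖q‖) := by
  have hp' : 0 < ‖p‖ := norm_pos_iff.mpr hp
  have hq' : 0 < ‖q‖ := norm_pos_iff.mpr hq
  have hpi := Real.pi_gt_three
  have key : ‖kerK p - kerK q‖ = (2 * Real.pi)⁻¹ * (‖p - q‖ / (‖p‖ * ‖q‖)) := by
    rw [← sq_eq_sq₀ (norm_nonneg _) (by positivity), norm_sq_plane, mul_pow, div_pow, mul_pow,
      norm_sq_plane (p - q)]
    simp only [PiLp.sub_apply, kerK_apply_zero, kerK_apply_one]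
    have h := norm_sq_plane p
    have h' := norm_sq_plane q
    have e1 : 0 < p 0 ^ 2 + p 1 ^ 2 := by rw [← h]; positivity
    have e2 : 0 < q 0 ^ 2 + q 1 ^ 2 := by rw [← h']; positivity
    rw [h, h']
    field_simp
    ring
  rw [key]
  apply mul_le_of_le_one_left (by positivity)
  apply inv_le_one_of_one_le₀
  linarith

/-- K(v) is orthogonal to v. Replacing x by y in the inner product gains a factor |y|, which is
small when the source at y is near the center. -/
lemma inner_kerK_sub (x y : Plane) : inner ℝ x (kerK (x - y)) = inner ℝ y (kerK (x - y)) := by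
  rw [← sub_eq_zero, ← inner_sub_left, inner_kerK_self]

lemma abs_inner_kerK_sub_le (x y : Plane) :
    |inner ℝ x (kerK (x - y))| ≤ ‖y‖ * ‖x - y‖⁻¹ := by
  rw [inner_kerK_sub]
  exact (abs_real_inner_le_norm _ _).trans (by gcongr; exact norm_kerK_le _)

lemma measurable_kerK : Measurable kerK := by
  unfold kerK
  apply (WithLp.measurable_toLp 2 (Fin 2 → ℝ)).comp
  rw [measurable_pi_iff]
  intro i
  have h : ∀ j : Fin 2, Measurable fun x : Plane => x j := fun j => by fun_prop
  have h0 := h 0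
  have h1 := h 1
  fin_cases i <;> simp <;> fun_prop

/-! ### The potential of a bounded density -/

lemma integrableOn_inv_norm (s : ℝ) :
    Integrable ((Metric.ball (0 : Plane) s).indicator fun y => ‖y‖⁻¹) := by
  have : ((Metric.ball (0 : Plane) s).indicator fun y => ‖y‖⁻¹)
      = fun y : Plane => (Iio s).indicator (fun r : ℝ => r⁻¹) ‖y‖ := by
    ext y; simp [indicator]
  rw [this, integrable_fun_norm_addHaar]
  simp only [finrank_euclideanSpace, Fintype.card_fin]
  have : IntegrableOn (fun _ : ℝ => (1 : ℝ)) (Ioo 0 s) := by simp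
  have h2 : IntegrableOn (fun y : ℝ => (Ioo 0 s).indicator (fun _ => (1 : ℝ)) y) (Ioi 0) :=
    (this.integrable_indicator measurableSet_Ioo).integrableOn
  refine h2.congr_fun (fun y hy => ?_) measurableSet_Ioi
  have hy : 0 < y := hy
  by_cases h : y < s <;> simp [indicator, h, hy, hy.ne']

lemma integral_inv_norm {s : ℝ} (hs : 0 ≤ s) :
    ∫ y, (Metric.ball (0 : Plane) s).indicator (fun y => ‖y‖⁻¹) y = 2 * Real.pi * s := by
  have : ((Metric.ball (0 : Plane) s).indicator fun y => ‖y‖⁻¹)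
      = fun y : Plane => (Iio s).indicator (fun r : ℝ => r⁻¹) ‖y‖ := by
    ext y; simp [indicator]
  rw [this, integral_fun_norm_addHaar]
  have e : ∫ y in Ioi (0 : ℝ), y ^ (Module.finrank ℝ Plane - 1) •
      (Iio s).indicator (fun r : ℝ => r⁻¹) y = s := by
    have : ∫ y in Ioi (0 : ℝ), y ^ (Module.finrank ℝ Plane - 1) •
      (Iio s).indicator (fun r : ℝ => r⁻¹) y =
      ∫ y in Ioi (0 : ℝ), (Ioo 0 s).indicator (fun _ => (1 : ℝ)) y := by
      refine setIntegral_congr_fun measurableSet_Ioi (fun y hy => ?_)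
      have hy : 0 < y := hy
      by_cases h : y < s <;> simp [indicator, h, hy, hy.ne']
    rw [this, setIntegral_indicator measurableSet_Ioo]
    have : Ioi (0 : ℝ) ∩ Ioo 0 s = Ioo 0 s := by ext; simp
    rw [this]; simp [hs]
  rw [e]
  have hv : volume.real (Metric.ball (0 : Plane) 1) = Real.pi := by
    rw [Measure.real, EuclideanSpace.volume_ball]
    simp [Real.pi_nonneg]
    norm_num [Real.Gamma_two, Real.sq_sqrt Real.pi_nonneg, Real.pi_nonneg]
  rw [hv]; simp [mul_assoc]

/-- Split at distance s from x: inside, the density is at most B and the kernel has integral 2πs;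
outside, the kernel is at most 1/s. The free parameter s is used at three scales: 1 for
integrability, ε for the axisymmetric error, and ε³ for the tail of the vorticity. -/
lemma integrable_mul_inv_norm_sub {f : Plane → ℝ} {B : ℝ} (hf : Integrable f)
    (hB : ∀ y, |f y| ≤ B) (x : Plane) {s : ℝ} (hs : 0 < s) :
    Integrable (fun y => |f y| * ‖x - y‖⁻¹) ∧
      ∫ y, |f y| * ‖x - y‖⁻¹ ≤ 2 * Real.pi * B * s + (∫ y, |f y|) / s := by
  have hi := (integrableOn_inv_norm s).comp_sub_left x
  have hb : ∀ y, |f y| * ‖x - y‖⁻¹ ≤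
      B * (Metric.ball (0 : Plane) s).indicator (fun y => ‖y‖⁻¹) (x - y) + |f y| / s := by
    intro y
    have hB0 : 0 ≤ B := (abs_nonneg _).trans (hB y)
    by_cases h : ‖x - y‖ < s
    · have : x - y ∈ Metric.ball (0 : Plane) s := by simpa using h
      rw [indicator_of_mem this]
      have := mul_le_mul_of_nonneg_right (hB y) (inv_nonneg.mpr (norm_nonneg (x - y)))
      have : 0 ≤ |f y| / s := by positivity
      linarith
    · have h' : x - y ∉ Metric.ball (0 : Plane) s := by simpa using h
      rw [indicator_of_notMem h', mul_zero, zero_add, div_eq_mul_inv]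
      push Not at h
      gcongr
  have hint : Integrable fun y => B * (Metric.ball (0 : Plane) s).indicator (fun y => ‖y‖⁻¹) (x - y)
      + |f y| / s := (hi.const_mul B).add (hf.abs.div_const s)
  have hI : Integrable (fun y => |f y| * ‖x - y‖⁻¹) := by
    refine hint.mono' ?_ (Filter.Eventually.of_forall fun y => ?_)
    · exact hf.abs.aestronglyMeasurable.mul
        ((measurable_const.sub measurable_id).norm.inv).aestronglyMeasurable
    · rw [Real.norm_of_nonneg (by positivity)]; exact hb y
  refine ⟨hI, (integral_mono hI hint hb).trans_eq ?_⟩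
  rw [integral_add (hi.const_mul B) (hf.abs.div_const s), integral_const_mul, integral_div,
    integral_sub_left_eq_self (fun y => (Metric.ball (0 : Plane) s).indicator (fun y => ‖y‖⁻¹) y),
    integral_inv_norm hs.le]
  ring

/-! ### Comparison of the axisymmetric kernel with the planar one -/

section KernelIntegrals

variable {d q : ℝ}

lemma kerDenom_pos (hd : 0 < d) (hq : 0 < q) (θ : ℝ) : 0 < d ^ 2 + 2 * q * (1 - Real.cos θ) := by
  have := Real.cos_le_one θ
  have : 0 ≤ 2 * q * (1 - Real.cos θ) := mul_nonneg (by positivity) (by linarith)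
  positivity

lemma continuous_kerDenom_rpow (hd : 0 < d) (hq : 0 < q) :
    Continuous fun θ : ℝ => (d ^ 2 + 2 * q * (1 - Real.cos θ)) ^ (3 / 2 : ℝ) := by
  apply Continuous.rpow_const (by fun_prop)
  intro θ
  exact Or.inl (kerDenom_pos hd hq θ).ne'

lemma continuous_div_kerDenom (hd : 0 < d) (hq : 0 < q) {g : ℝ → ℝ} (hg : Continuous g) :
    Continuous fun θ : ℝ => g θ / (d ^ 2 + 2 * q * (1 - Real.cos θ)) ^ (3 / 2 : ℝ) :=
  hg.div (continuous_kerDenom_rpow hd hq)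
    fun θ => (Real.rpow_pos_of_pos (kerDenom_pos hd hq θ) _).ne'

lemma one_sub_cos_eq (θ : ℝ) : 1 - Real.cos θ = 2 * Real.sin (θ / 2) ^ 2 := by
  have := Real.cos_sq' (θ / 2)
  have h2 := Real.cos_two_mul (θ / 2)
  rw [show 2 * (θ / 2) = θ by ring] at h2
  linarith

lemma rpow_three_halves {D : ℝ} (hD : 0 < D) : D ^ (3 / 2 : ℝ) = D * Real.sqrt D := by
  rw [Real.sqrt_eq_rpow, ← Real.rpow_one_add' hD.le (by norm_num)]
  norm_num

/-- The explicit part of the angular integral. -/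
lemma integral_cos_half (hd : 0 < d) (hq : 0 < q) :
    ∫ θ in (0 : ℝ)..Real.pi,
      Real.cos (θ / 2) / (d ^ 2 + 2 * q * (1 - Real.cos θ)) ^ (3 / 2 : ℝ)
      = 2 / (d ^ 2 * Real.sqrt (d ^ 2 + 4 * q)) := by
  have hD : ∀ θ : ℝ, 0 < d ^ 2 + 4 * q * Real.sin (θ / 2) ^ 2 := fun θ => by positivity
  -- With u = sin(θ/2) the integral is that of 2(d² + 4qu²)^(-3/2), which has an algebraic
  -- primitive. This is why cos(θ/2) is the reference numerator.
  have key : ∀ θ ∈ uIcc 0 Real.pi, HasDerivAt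
      (fun θ : ℝ => 2 * Real.sin (θ / 2) /
        (d ^ 2 * Real.sqrt (d ^ 2 + 4 * q * Real.sin (θ / 2) ^ 2)))
      (Real.cos (θ / 2) / (d ^ 2 + 2 * q * (1 - Real.cos θ)) ^ (3 / 2 : ℝ)) θ := by
    intro θ _
    have hs : HasDerivAt (fun θ : ℝ => Real.sin (θ / 2)) (Real.cos (θ / 2) * (1 / 2)) θ :=
      ((hasDerivAt_id θ).div_const 2).sin
    have hin : HasDerivAt (fun θ : ℝ => d ^ 2 + 4 * q * Real.sin (θ / 2) ^ 2)
        (4 * q * (2 * Real.sin (θ / 2) * (Real.cos (θ / 2) * (1 / 2)))) θ := by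
      have := ((hs.pow 2).const_mul (4 * q)).const_add (d ^ 2)
      simpa using this
    have hsq := hin.sqrt (hD θ).ne'
    have hq' : 0 < Real.sqrt (d ^ 2 + 4 * q * Real.sin (θ / 2) ^ 2) := Real.sqrt_pos.mpr (hD θ)
    have := (hs.const_mul 2).div (hsq.const_mul (d ^ 2)) (by positivity)
    refine this.congr_deriv ?_
    rw [one_sub_cos_eq, show 2 * q * (2 * Real.sin (θ / 2) ^ 2) = 4 * q * Real.sin (θ / 2) ^ 2 by
      ring, rpow_three_halves (hD θ)]
    have e := Real.sq_sqrt (hD θ).le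
    set S := Real.sqrt (d ^ 2 + 4 * q * Real.sin (θ / 2) ^ 2)
    rw [← e]
    field_simp
    rw [e]; ring
  rw [intervalIntegral.integral_eq_sub_of_hasDerivAt key
    ((continuous_div_kerDenom hd hq (by fun_prop)).intervalIntegrable _ _)]
  simp

/-- Jordan's inequality sin(θ/2) ≥ θ/π bounds the denominator D below by d² + (bθ)² with b = 2√q/π,
hence √D ≥ (d + bθ)/2. Together with 2q(1 - cos θ) ≤ D the integrand is at most 1/(q(d + bθ)), whose
integral is the logarithm. -/
lemma integral_one_sub_cos_le (hd : 0 < d) (hq : 0 < q) :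
    ∫ θ in (0 : ℝ)..Real.pi,
      (1 - Real.cos θ) / (d ^ 2 + 2 * q * (1 - Real.cos θ)) ^ (3 / 2 : ℝ)
      ≤ Real.pi / (2 * q * Real.sqrt q) * Real.log (1 + 2 * Real.sqrt q / d) := by
  have hsq : 0 < Real.sqrt q := Real.sqrt_pos.mpr hq
  have hpi := Real.pi_pos
  set b := 2 * Real.sqrt q / Real.pi with hb
  have hb0 : 0 < b := by positivity
  have hder : ∀ θ ∈ uIcc 0 Real.pi, HasDerivAt (fun θ : ℝ => 1 / (q * b) * Real.log (d + b * θ))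
      (1 / (q * (d + b * θ))) θ := by
    intro θ hθ
    rw [uIcc_of_le hpi.le] at hθ
    have h0 : 0 < d + b * θ := by have := hθ.1; positivity
    have := ((((hasDerivAt_id θ).const_mul b).const_add d).log h0.ne').const_mul (1 / (q * b))
    refine this.congr_deriv ?_
    simp only [id_eq]
    field_simp
  have hcont : IntervalIntegrable (fun θ : ℝ => 1 / (q * (d + b * θ))) volume 0 Real.pi := by
    apply ContinuousOn.intervalIntegrable
    apply ContinuousOn.div (by fun_prop) (by fun_prop)
    intro θ hθ
    rw [uIcc_of_le hpi.le] at hθ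
    have h0 : 0 < d + b * θ := by have := hθ.1; positivity
    positivity
  have hI := intervalIntegral.integral_eq_sub_of_hasDerivAt hder hcont
  have hle : ∫ θ in (0 : ℝ)..Real.pi,
      (1 - Real.cos θ) / (d ^ 2 + 2 * q * (1 - Real.cos θ)) ^ (3 / 2 : ℝ)
      ≤ ∫ θ in (0 : ℝ)..Real.pi, 1 / (q * (d + b * θ)) := by
    apply intervalIntegral.integral_mono_on hpi.le
      ((continuous_div_kerDenom hd hq (by fun_prop)).intervalIntegrable _ _) hcont
    intro θ hθ
    have h0 : 0 < d + b * θ := by have := hθ.1; positivity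
    have hD := kerDenom_pos hd hq θ
    rw [rpow_three_halves hD]
    set D := d ^ 2 + 2 * q * (1 - Real.cos θ) with hDdef
    have hS := Real.sqrt_pos.mpr hD
    have hsin : (2 / Real.pi * (θ / 2)) ≤ Real.sin (θ / 2) :=
      Real.mul_le_sin (by linarith [hθ.1]) (by linarith [hθ.2])
    have h1 : (d + b * θ) / 2 ≤ Real.sqrt D := by
      apply Real.le_sqrt_of_sq_le
      rw [hDdef, one_sub_cos_eq]
      have e1 : (2 / Real.pi * (θ / 2)) ^ 2 ≤ Real.sin (θ / 2) ^ 2 := by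
        have := hθ.1
        gcongr
      have e2 : (b * θ) ^ 2 = 4 * q * (2 / Real.pi * (θ / 2)) ^ 2 := by
        rw [hb]; field_simp; rw [Real.sq_sqrt hq.le]; ring
      nlinarith [sq_nonneg (d - b * θ), mul_le_mul_of_nonneg_left e1 hq.le, sq_nonneg (b * θ),
        sq_nonneg d]
    have h2 : 2 * q * (1 - Real.cos θ) ≤ D := by rw [hDdef]; nlinarith [sq_nonneg d]
    have h3 : 0 ≤ 1 - Real.cos θ := by linarith [Real.cos_le_one θ]
    rw [div_le_div_iff₀ (by positivity) (by positivity), one_mul]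
    calc (1 - Real.cos θ) * (q * (d + b * θ))
        = (2 * q * (1 - Real.cos θ)) * ((d + b * θ) / 2) := by ring
      _ ≤ D * Real.sqrt D := by gcongr
  refine hle.trans_eq ?_
  rw [hI]
  have e : d + b * Real.pi = d * (1 + 2 * Real.sqrt q / d) := by
    rw [hb]; field_simp
  rw [e, Real.log_mul hd.ne' (by positivity)]
  simp only [mul_zero, add_zero]
  rw [hb]; field_simp; ring

/-- Serves for both angular integrals: on [0, π] the numerators 1 and cos θ each differ from
cos(θ/2) by at most 1 - cos θ, which vanishes at the singular angle and costs only a logarithm. -/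
lemma abs_integral_sub_le (hd : 0 < d) (hq : 0 < q) {g : ℝ → ℝ} (hg : Continuous g)
    (h : ∀ θ ∈ Icc 0 Real.pi, |g θ - Real.cos (θ / 2)| ≤ 1 - Real.cos θ) :
    |(∫ θ in (0 : ℝ)..Real.pi, g θ / (d ^ 2 + 2 * q * (1 - Real.cos θ)) ^ (3 / 2 : ℝ))
      - 2 / (d ^ 2 * Real.sqrt (d ^ 2 + 4 * q))| ≤
    ∫ θ in (0 : ℝ)..Real.pi,
      (1 - Real.cos θ) / (d ^ 2 + 2 * q * (1 - Real.cos θ)) ^ (3 / 2 : ℝ) := by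
  rw [← integral_cos_half hd hq, ← intervalIntegral.integral_sub
    ((continuous_div_kerDenom hd hq hg).intervalIntegrable _ _)
    ((continuous_div_kerDenom hd hq (by fun_prop)).intervalIntegrable _ _), ← Real.norm_eq_abs]
  refine (intervalIntegral.norm_integral_le_integral_norm Real.pi_pos.le).trans ?_
  apply intervalIntegral.integral_mono_on Real.pi_pos.le
  · apply Continuous.intervalIntegrable
    exact ((continuous_div_kerDenom hd hq hg).sub
      (continuous_div_kerDenom hd hq (by fun_prop))).norm
  · exact (continuous_div_kerDenom hd hq (by fun_prop)).intervalIntegrable _ _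
  intro θ hθ
  have hD := Real.rpow_pos_of_pos (kerDenom_pos hd hq θ) (3 / 2)
  rw [← sub_div, norm_div, Real.norm_of_nonneg hD.le, Real.norm_eq_abs]
  gcongr
  exact h θ hθ

end KernelIntegrals

lemma one_sub_cos_half_le {θ : ℝ} (hθ : θ ∈ Icc 0 Real.pi) :
    |1 - Real.cos (θ / 2)| ≤ 1 - Real.cos θ := by
  have h1 := Real.cos_le_one (θ / 2)
  have h2 : Real.cos θ ≤ Real.cos (θ / 2) :=
    Real.cos_le_cos_of_nonneg_of_le_pi (by linarith [hθ.1]) hθ.2 (by linarith [hθ.1])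
  rw [abs_of_nonneg (by linarith)]; linarith

lemma cos_sub_cos_half_le {θ : ℝ} (hθ : θ ∈ Icc 0 Real.pi) :
    |Real.cos θ - Real.cos (θ / 2)| ≤ 1 - Real.cos θ := by
  have h1 := Real.cos_le_one (θ / 2)
  have h2 : Real.cos θ ≤ Real.cos (θ / 2) :=
    Real.cos_le_cos_of_nonneg_of_le_pi (by linarith [hθ.1]) hθ.2 (by linarith [hθ.1])
  rw [abs_le]; constructor <;> linarith

/-- With Q = √(a² + (r + r')²) the difference is (2r' - Q)/(d²Q). Here |2r' - Q| ≤ 2d, since Q lies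
between r + r' and r + r' + d, and Q ≥ r₀. -/
lemma abs_mul_explicit_sub_le {r₀ r r' d a : ℝ} (hd0 : 0 < d) (hr₀ : 0 < r₀) (hr : r₀ / 2 ≤ r)
    (hr' : r₀ / 2 ≤ r') (hρ : |r' - r| ≤ d) (ha : |a| ≤ d) (hd2 : d ^ 2 = a ^ 2 + (r - r') ^ 2) :
    |r' * (2 / (d ^ 2 * Real.sqrt (d ^ 2 + 4 * (r * r')))) - 1 / d ^ 2| ≤ 2 / (d * r₀) := by
  have hQ : d ^ 2 + 4 * (r * r') = a ^ 2 + (r + r') ^ 2 := by rw [hd2]; ring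
  rw [hQ]
  set Q := Real.sqrt (a ^ 2 + (r + r') ^ 2)
  have hQ3 : r + r' ≤ Q := Real.le_sqrt_of_sq_le (by linarith [sq_nonneg a])
  have hQ0 : 0 < Q := by linarith
  have hQ4 : Q ≤ (r + r') + d := by
    apply Real.sqrt_le_iff.mpr ⟨by linarith, _⟩
    have h1 : a ^ 2 ≤ d ^ 2 := sq_le_sq' (by linarith [abs_le.mp ha]) (abs_le.mp ha).2
    have h2 : 0 ≤ (r + r') * d := mul_nonneg (by linarith) hd0.le
    linarith [show (r + r' + d) ^ 2 = (r + r') ^ 2 + 2 * ((r + r') * d) + d ^ 2 by ring]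
  have h5 : |2 * r' - Q| ≤ 2 * d := by
    rw [abs_le] at hρ ⊢; constructor <;> linarith
  have : r' * (2 / (d ^ 2 * Q)) - 1 / d ^ 2 = (2 * r' - Q) / (d ^ 2 * Q) := by
    field_simp
  rw [this, abs_div, abs_of_pos (show 0 < d ^ 2 * Q by positivity),
    div_le_div_iff₀ (by positivity) (by positivity)]
  calc |2 * r' - Q| * (d * r₀) ≤ (2 * d) * (d * Q) := by gcongr; linarith
    _ = 2 * (d ^ 2 * Q) := by ring

/-- Away from the axis, the axisymmetric kernel is the planar one up to a logarithmic term. -/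
lemma norm_kerG_sub_kerK_le {r₀ : ℝ} (hr₀ : 0 < r₀) {x y : Plane} (hxy : x ≠ y)
    (hx : ‖x‖ ≤ r₀ / 2) (hy : ‖y‖ ≤ r₀ / 2) :
    ‖kerG r₀ x y - kerK (x - y)‖ ≤ 20 / r₀ * (1 + Real.log (1 + 4 * r₀ / ‖x - y‖)) := by
  have hx1 := abs_le.mp ((abs_apply_le_norm x 1).trans hx)
  have hy1 := abs_le.mp ((abs_apply_le_norm y 1).trans hy)
  set r := r₀ + x 1 with hr
  set r' := r₀ + y 1 with hr'
  set d := ‖x - y‖ with hd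
  have hd0 : 0 < d := norm_pos_iff.mpr (sub_ne_zero.mpr hxy)
  have hr1 : r₀ / 2 ≤ r := by linarith
  have hr2 : r ≤ 2 * r₀ := by linarith
  have hr1' : r₀ / 2 ≤ r' := by linarith
  have hr2' : r' ≤ 2 * r₀ := by linarith
  have hr0 : 0 < r := by linarith
  have hr0' : 0 < r' := by linarith
  have hdr : d ≤ r₀ := (norm_sub_le x y).trans (by linarith)
  set q := r * r' with hqdef
  have hq : 0 < q := by positivity
  have hpi := Real.pi_gt_three
  have hpi' := Real.pi_lt_four
  have hd2 : d ^ 2 = (x 0 - y 0) ^ 2 + (r - r') ^ 2 := by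
    rw [hd, norm_sq_plane]; simp only [PiLp.sub_apply]; rw [hr, hr']; ring
  have hz : |x 0 - y 0| ≤ d := by simpa using abs_apply_le_norm (x - y) 0
  have hρ : |r' - r| ≤ d := by
    have := abs_apply_le_norm (x - y) 1
    rw [abs_sub_comm]; simpa [hr, hr'] using this
  set S := ∫ θ in (0 : ℝ)..Real.pi,
      (1 - Real.cos θ) / (d ^ 2 + 2 * q * (1 - Real.cos θ)) ^ (3 / 2 : ℝ) with hS
  set E := 2 / (d ^ 2 * Real.sqrt (d ^ 2 + 4 * q)) with hE
  set l := Real.log (1 + 4 * r₀ / d) with hl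
  have hl0 : 0 ≤ l := Real.log_nonneg (by linarith [show 0 ≤ 4 * r₀ / d by positivity])
  have hsq1 : r₀ / 2 ≤ Real.sqrt q := Real.le_sqrt_of_sq_le (by nlinarith)
  have hsq2 : Real.sqrt q ≤ 2 * r₀ := Real.sqrt_le_iff.mpr ⟨by positivity, by nlinarith⟩
  have hS0 : 0 ≤ S := by
    apply intervalIntegral.integral_nonneg Real.pi_pos.le
    intro θ _
    exact div_nonneg (by linarith [Real.cos_le_one θ])
      (Real.rpow_nonneg (kerDenom_pos hd0 hq θ).le _)
  have hSl : q * S ≤ Real.pi / r₀ * l := by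
    have h := integral_one_sub_cos_le hd0 hq
    rw [← hS] at h
    have hsq0 : 0 < Real.sqrt q := by linarith
    have h1 : Real.log (1 + 2 * Real.sqrt q / d) ≤ l := by
      apply Real.log_le_log (by positivity)
      have : 2 * Real.sqrt q / d ≤ 4 * r₀ / d := by gcongr ?_ / d; linarith
      linarith
    calc q * S ≤ q * (Real.pi / (2 * q * Real.sqrt q) * l) := by
          gcongr; exact h.trans (by gcongr)
      _ = Real.pi / (2 * Real.sqrt q) * l := by field_simp
      _ ≤ Real.pi / r₀ * l := by gcongr; linarith
  have hE1 : |r' * E - 1 / d ^ 2| ≤ 2 / (d * r₀) := by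
    rw [hE, hqdef]
    exact abs_mul_explicit_sub_le hd0 hr₀ hr1 hr1' hρ hz hd2
  have hdS : d * (r' * S) ≤ 2 * (q * S) := by
    have : d ≤ 2 * r := by linarith
    calc d * (r' * S) ≤ (2 * r) * (r' * S) := by gcongr
      _ = _ := by rw [hqdef]; ring
  -- The number a is a coordinate of the displacement, up to sign. Its bound |a| ≤ d cancels one
  -- factor 1/d in the error of the explicit part and, through `hdS`, turns r'S into qS.
  have hEd : ∀ I a : ℝ, |I - E| ≤ S → |a| ≤ d →
      |r' * a * I - a / d ^ 2| ≤ 2 / r₀ + 2 * (Real.pi / r₀ * l) := by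
    intro I a hI ha
    have : r' * a * I - a / d ^ 2 = a * (r' * E - 1 / d ^ 2) + a * (r' * (I - E)) := by ring
    rw [this]
    refine (abs_add_le _ _).trans ?_
    rw [abs_mul, abs_mul a, abs_mul r', abs_of_pos hr0']
    have h1 : |a| * |r' * E - 1 / d ^ 2| ≤ d * (2 / (d * r₀)) := by gcongr
    have h2 : d * (2 / (d * r₀)) = 2 / r₀ := by field_simp
    have h3 : |a| * (r' * |I - E|) ≤ d * (r' * S) := by gcongr
    linarith
  have hbound : 2 / r₀ + 3 * (Real.pi / r₀ * l) ≤ 12 / r₀ * (1 + l) := by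
    have e : 2 / r₀ + 3 * (Real.pi / r₀ * l) = (2 + 3 * Real.pi * l) / r₀ := by field_simp
    have e' : 12 / r₀ * (1 + l) = (12 * (1 + l)) / r₀ := by field_simp
    rw [e, e']; gcongr; nlinarith
  have hP0 : 0 ≤ Real.pi / r₀ * l := by positivity
  set J₁ := ∫ θ in (0 : ℝ)..Real.pi,
      (1 : ℝ) / (d ^ 2 + 2 * q * (1 - Real.cos θ)) ^ (3 / 2 : ℝ) with hJ₁
  set J₂ := ∫ θ in (0 : ℝ)..Real.pi,
      Real.cos θ / (d ^ 2 + 2 * q * (1 - Real.cos θ)) ^ (3 / 2 : ℝ) with hJ₂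
  have hJ₁E : |J₁ - E| ≤ S :=
    abs_integral_sub_le hd0 hq (g := fun _ => 1) (by fun_prop) fun θ hθ => one_sub_cos_half_le hθ
  have hJ₂E : |J₂ - E| ≤ S :=
    abs_integral_sub_le hd0 hq (by fun_prop) fun θ hθ => cos_sub_cos_half_le hθ
  have hint : ∀ g : ℝ → ℝ, Continuous g → IntervalIntegrable
      (fun θ : ℝ => g θ / (d ^ 2 + 2 * q * (1 - Real.cos θ)) ^ (3 / 2 : ℝ)) volume 0 Real.pi :=
    fun g hg => (continuous_div_kerDenom hd0 hq hg).intervalIntegrable _ _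
  -- Uses r'(r' - r cos θ) = r'(r' - r) + q(1 - cos θ): the first term carries the planar kernel,
  -- the second is already of the size of the error.
  have hG0 : kerG r₀ x y 0 = (1 / (2 * Real.pi)) * (r' * (r' - r) * J₁ + q * S) := by
    simp only [kerG, PiLp.toLp_apply, Matrix.cons_val_zero]
    congr 1
    rw [hJ₁, hS, ← intervalIntegral.integral_const_mul, ← intervalIntegral.integral_const_mul,
      ← intervalIntegral.integral_add ((hint (fun _ => 1) (by fun_prop)).const_mul _)
        ((hint (fun θ => 1 - Real.cos θ) (by fun_prop)).const_mul _)]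
    apply intervalIntegral.integral_congr
    intro θ _
    simp only
    rw [← hr, ← hr', ← hd, show 2 * r * r' = 2 * q by rw [hqdef]; ring]
    rw [mul_div_assoc', mul_div_assoc', ← add_div]
    congr 1
    rw [hqdef]; ring
  have hG1 : kerG r₀ x y 1 = (1 / (2 * Real.pi)) * (r' * (x 0 - y 0) * J₂) := by
    simp only [kerG, PiLp.toLp_apply, Matrix.cons_val_one, Matrix.cons_val_fin_one]
    congr 1
    rw [hJ₂, ← intervalIntegral.integral_const_mul]
    apply intervalIntegral.integral_congr
    intro θ _
    simp only
    rw [← hr, ← hr', ← hd, show 2 * r * r' = 2 * q by rw [hqdef]; ring, mul_div_assoc']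
  have hpinv : 1 / (2 * Real.pi) ≤ 1 / 6 := by gcongr; linarith
  have hpinv0 : 0 ≤ 1 / (2 * Real.pi) := by positivity
  refine (norm_plane_le _).trans ?_
  simp only [PiLp.sub_apply, kerK_apply_zero, kerK_apply_one, hG0, hG1]
  rw [← hd]
  have e0 : 1 / (2 * Real.pi) * (r' * (r' - r) * J₁ + q * S) -
      -(1 / (2 * Real.pi)) * ((x 1 - y 1) / d ^ 2) =
      1 / (2 * Real.pi) * ((r' * (r' - r) * J₁ - (r' - r) / d ^ 2) + q * S) := by
    rw [show x 1 - y 1 = -(r' - r) by rw [hr, hr']; ring]; ring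
  rw [e0, ← mul_sub, abs_mul, abs_mul, abs_of_nonneg hpinv0]
  have b0 : |(r' * (r' - r) * J₁ - (r' - r) / d ^ 2) + q * S| ≤ 12 / r₀ * (1 + l) := by
    refine (abs_add_le _ _).trans ?_
    have := hEd J₁ (r' - r) hJ₁E hρ
    rw [abs_of_nonneg (show 0 ≤ q * S by positivity)]
    linarith
  have b1 : |r' * (x 0 - y 0) * J₂ - (x 0 - y 0) / d ^ 2| ≤ 12 / r₀ * (1 + l) := by
    have := hEd J₂ (x 0 - y 0) hJ₂E hz
    linarith
  calc _ ≤ 1 / 6 * (12 / r₀ * (1 + l)) + 1 / 6 * (12 / r₀ * (1 + l)) := by gcongr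
    _ = 4 / r₀ * (1 + l) := by ring
    _ ≤ 20 / r₀ * (1 + l) := by gcongr; norm_num

lemma measurable_kerG_prod (r₀ : ℝ) :
    Measurable fun p : Plane × Plane => kerG r₀ p.1 p.2 := by
  have hc : ∀ j : Fin 2, Measurable fun p : (Plane × Plane) × ℝ => p.1.1 j := fun j => by fun_prop
  have hc' : ∀ j : Fin 2, Measurable fun p : (Plane × Plane) × ℝ => p.1.2 j := fun j => by fun_prop
  have h0 := hc 0
  have h1 := hc 1
  have h0' := hc' 0
  have h1' := hc' 1
  have key : ∀ g : (Plane × Plane) × ℝ → ℝ, Measurable g →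
      Measurable fun y : Plane × Plane => ∫ θ in (0 : ℝ)..Real.pi, g (y, θ) := by
    intro g hg
    simp only [intervalIntegral.integral_of_le Real.pi_pos.le]
    exact (StronglyMeasurable.integral_prod_right' (f := g) hg.stronglyMeasurable).measurable
  unfold kerG
  apply (WithLp.measurable_toLp 2 (Fin 2 → ℝ)).comp
  rw [measurable_pi_iff]
  intro i
  fin_cases i
  · simp only [Fin.zero_eta, Matrix.cons_val_zero]
    apply Measurable.const_mul
    exact key (fun p => (r₀ + p.1.2 1) * ((r₀ + p.1.2 1) - (r₀ + p.1.1 1) * Real.cos p.2) /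
      (‖p.1.1 - p.1.2‖ ^ 2 + 2 * (r₀ + p.1.1 1) * (r₀ + p.1.2 1) * (1 - Real.cos p.2))
        ^ (3 / 2 : ℝ)) (by fun_prop)
  · simp only [Fin.mk_one, Matrix.cons_val_one]
    apply Measurable.const_mul
    exact key (fun p => (r₀ + p.1.2 1) * (p.1.1 0 - p.1.2 0) * Real.cos p.2 /
      (‖p.1.1 - p.1.2‖ ^ 2 + 2 * (r₀ + p.1.1 1) * (r₀ + p.1.2 1) * (1 - Real.cos p.2))
        ^ (3 / 2 : ℝ)) (by fun_prop)

lemma measurable_kerG (r₀ : ℝ) (x : Plane) : Measurable (kerG r₀ x) :=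
  (measurable_kerG_prod r₀).comp measurable_prodMk_left

/-! ### The velocity generated by localized densities -/

/-- The planar velocity generated by the density `w`. -/
def planarVelocity (w : Plane → ℝ) (x : Plane) : Plane := ∫ y, w y • kerK (x - y)

lemma ae_ne_plane (x : Plane) : ∀ᵐ y : Plane, y ≠ x := by
  rw [ae_iff]; simp

lemma integrable_smul_kerK {w : Plane → ℝ} {B : ℝ} (hw : Integrable w) (hB : ∀ y, |w y| ≤ B)
    (x : Plane) : Integrable fun y => w y • kerK (x - y) := by
  refine (integrable_mul_inv_norm_sub hw hB x one_pos).1.mono'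
    (hw.aestronglyMeasurable.smul
      (measurable_kerK.comp (measurable_const.sub measurable_id)).aestronglyMeasurable)
    (Filter.Eventually.of_forall fun y => ?_)
  rw [norm_smul, Real.norm_eq_abs]
  gcongr
  exact norm_kerK_le _

/-- The error made by replacing the axisymmetric kernel with the planar one, for `N` densities with
bound `B` and mass at most `A`, with `s` the scale of concentration. -/
def axisymmetricError (N : ℕ) (r₀ A B s : ℝ) : ℝ :=
  N * (20 / r₀ * (A * (1 + Real.log (1 + 4 * r₀ / s)) + s * (2 * Real.pi * B * s + A / s)))

/-- From 1 + 4r/d ≤ (1 + 4r/s)(1 + s/d) and log(1 + t) ≤ t. The logarithmic singularity is traded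
for s/d, whose integral against a density is already estimated. -/
lemma log_one_add_div_le {r d s : ℝ} (hr : 0 < r) (hd : 0 < d) (hs : 0 < s) :
    Real.log (1 + 4 * r / d) ≤ Real.log (1 + 4 * r / s) + s * d⁻¹ := by
  have h : 1 + 4 * r / d ≤ (1 + 4 * r / s) * (1 + s / d) := by
    have e : (1 + 4 * r / s) * (1 + s / d) = 1 + 4 * r / d + (4 * r / s + s / d) := by
      field_simp; ring
    rw [e]
    have : 0 ≤ 4 * r / s + s / d := by positivity
    linarith
  calc Real.log (1 + 4 * r / d) ≤ Real.log ((1 + 4 * r / s) * (1 + s / d)) :=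
        Real.log_le_log (by positivity) h
    _ = Real.log (1 + 4 * r / s) + Real.log (1 + s / d) :=
        Real.log_mul (by positivity) (by positivity)
    _ ≤ _ := by
        have := Real.log_le_sub_one_of_pos (show 0 < 1 + s / d by positivity)
        rw [← div_eq_mul_inv]; linarith

lemma norm_integral_kerG_sub_le {r₀ A B s : ℝ} (hr₀ : 0 < r₀) (hs : 0 < s) {w : Plane → ℝ}
    (hw : Integrable w) (hB : ∀ y, |w y| ≤ B) (hA : ∫ y, |w y| ≤ A)
    (hsupp : ∀ y, w y ≠ 0 → ‖y‖ ≤ r₀ / 2) {x : Plane} (hx : ‖x‖ ≤ r₀ / 2) :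
    Integrable (fun y => w y • kerG r₀ x y) ∧
    ‖(∫ y, w y • kerG r₀ x y) - planarVelocity w x‖ ≤
      20 / r₀ * (A * (1 + Real.log (1 + 4 * r₀ / s)) + s * (2 * Real.pi * B * s + A / s)) := by
  obtain ⟨hi, hle⟩ := integrable_mul_inv_norm_sub hw hB x hs
  set l := 1 + Real.log (1 + 4 * r₀ / s) with hl
  have hl0 : 0 ≤ l := by
    have : 0 ≤ Real.log (1 + 4 * r₀ / s) :=
      Real.log_nonneg (by linarith [show 0 ≤ 4 * r₀ / s by positivity])
    linarith
  have hK := integrable_smul_kerK hw hB x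
  have hmeas : AEStronglyMeasurable (fun y => w y • kerG r₀ x y) :=
    hw.aestronglyMeasurable.smul (measurable_kerG r₀ x).aestronglyMeasurable
  have hb : ∀ᵐ y, ‖w y • kerG r₀ x y - w y • kerK (x - y)‖ ≤
      20 / r₀ * (|w y| * l + s * (|w y| * ‖x - y‖⁻¹)) := by
    filter_upwards [ae_ne_plane x] with y hy
    by_cases h0 : w y = 0
    · simp [h0]
    rw [← smul_sub, norm_smul, Real.norm_eq_abs]
    have hd : 0 < ‖x - y‖ := norm_pos_iff.mpr (sub_ne_zero.mpr hy.symm)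
    have h1 := norm_kerG_sub_kerK_le hr₀ hy.symm hx (hsupp y h0)
    have h2 := log_one_add_div_le hr₀ hd hs
    calc |w y| * ‖kerG r₀ x y - kerK (x - y)‖
        ≤ |w y| * (20 / r₀ * (l + s * ‖x - y‖⁻¹)) := by
          gcongr
          refine h1.trans ?_
          rw [hl, add_assoc]
          gcongr
      _ = _ := by ring
  have hbi : Integrable fun y => 20 / r₀ * (|w y| * l + s * (|w y| * ‖x - y‖⁻¹)) :=
    ((hw.abs.mul_const l).add (hi.const_mul s)).const_mul _
  have hdiff : Integrable fun y => w y • kerG r₀ x y - w y • kerK (x - y) :=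
    hbi.mono' (hmeas.sub hK.aestronglyMeasurable) hb
  have hG : Integrable (fun y => w y • kerG r₀ x y) := by
    have := hdiff.add hK
    refine this.congr (Filter.Eventually.of_forall fun y => ?_)
    simp
  refine ⟨hG, ?_⟩
  rw [planarVelocity, ← integral_sub hG hK]
  refine (norm_integral_le_of_norm_le hbi hb).trans ?_
  rw [integral_const_mul, integral_add (hw.abs.mul_const l) (hi.const_mul s), integral_mul_const,
    integral_const_mul]
  gcongr
  exact hle.trans (by gcongr)

/-- `N` bounded densities localized near well separated centers, away from the axis. -/
structure IsLocalized {N : ℕ} (r₀ ρ R A B : ℝ) (a : Fin N → ℝ) (c : Fin N → Plane)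
    (w : Fin N → Plane → ℝ) : Prop where
  measurable : ∀ i, Measurable (w i)
  bound : ∀ i x, |w i x| ≤ B
  support : ∀ i x, w i x ≠ 0 → ‖x - c i‖ ≤ ρ
  mass : ∀ i, ∫ x, w i x = a i
  abs_mass : ∀ i, ∫ x, |w i x| ≤ A
  separated : ∀ i j, i ≠ j → R ≤ ‖c i - c j‖
  pos : 0 < R
  radius_nonneg : 0 ≤ ρ
  radius_le : ρ ≤ R / 8
  far : ∀ i, ‖c i‖ + ρ ≤ r₀ / 2
  axis : 0 < r₀

/-- The absolute moment of order `k` of the density `w` with respect to the center `c`. -/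
def absMoment (k : ℕ) (w : Plane → ℝ) (c : Plane) : ℝ := ∫ x, |w x| * ‖x - c‖ ^ k

lemma integrable_mul_of_support {w h : Plane → ℝ} {c : Plane} {ρ B C : ℝ} (hw : Measurable w)
    (hB : ∀ x, |w x| ≤ B) (hs : ∀ x, w x ≠ 0 → ‖x - c‖ ≤ ρ) (hh : Measurable h)
    (hC : ∀ x, ‖x - c‖ ≤ ρ → |h x| ≤ C) : Integrable fun x => w x * h x := by
  have hi : Integrable ((Metric.closedBall c ρ).indicator fun _ => B * C) :=
    (integrable_indicator_iff measurableSet_closedBall).mpr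
      (integrableOn_const measure_closedBall_lt_top.ne)
  refine hi.mono' (hw.mul hh).aestronglyMeasurable (Filter.Eventually.of_forall fun x => ?_)
  by_cases h0 : w x = 0
  · rw [h0, zero_mul, norm_zero]
    by_cases hx : ‖x - c‖ ≤ ρ
    · rw [indicator_of_mem (by simpa [dist_eq_norm] using hx)]
      exact mul_nonneg ((abs_nonneg _).trans (hB x)) ((abs_nonneg _).trans (hC x hx))
    · rw [indicator_of_notMem (by simpa [dist_eq_norm] using hx)]
  · have hx := hs x h0
    rw [indicator_of_mem (by simpa [dist_eq_norm] using hx), norm_mul]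
    exact mul_le_mul (hB x) (hC x hx) (abs_nonneg _) ((abs_nonneg _).trans (hB x))

lemma abs_le_of_norm_sub_le {h : Plane → ℝ} (hh : Continuous h) (c : Plane) (ρ : ℝ) :
    ∃ C, ∀ x, ‖x - c‖ ≤ ρ → |h x| ≤ C := by
  obtain ⟨C, hC⟩ := (isCompact_closedBall c ρ).exists_bound_of_continuousOn hh.continuousOn
  exact ⟨C, fun x hx => hC x (by simpa [dist_eq_norm] using hx)⟩

namespace IsLocalized

variable {N : ℕ} {r₀ ρ R A B : ℝ} {a : Fin N → ℝ} {c : Fin N → Plane} {w : Fin N → Plane → ℝ}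

lemma integrable_mul (H : IsLocalized r₀ ρ R A B a c w) (i : Fin N) {h : Plane → ℝ}
    (hh : Continuous h) : Integrable fun x => w i x * h x := by
  obtain ⟨C, hC⟩ := abs_le_of_norm_sub_le hh (c i) ρ
  exact integrable_mul_of_support (H.measurable i) (H.bound i) (H.support i) hh.measurable hC

lemma integrable_abs_mul (H : IsLocalized r₀ ρ R A B a c w) (i : Fin N) {h : Plane → ℝ}
    (hh : Continuous h) : Integrable fun x => |w i x| * h x := by
  obtain ⟨C, hC⟩ := abs_le_of_norm_sub_le hh (c i) ρ
  exact integrable_mul_of_support (H.measurable i).abs (fun x => by simpa using H.bound i x)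
    (fun x hx => H.support i x (by simpa using hx)) hh.measurable hC

lemma integrable (H : IsLocalized r₀ ρ R A B a c w) (i : Fin N) : Integrable (w i) := by
  simpa using H.integrable_mul i (h := fun _ => 1) continuous_const

lemma norm_le (H : IsLocalized r₀ ρ R A B a c w) (i : Fin N) {x : Plane} (hx : ‖x - c i‖ ≤ ρ) :
    ‖x‖ ≤ r₀ / 2 := by
  have := H.far i
  calc ‖x‖ = ‖(x - c i) + c i‖ := by simp
    _ ≤ ‖x - c i‖ + ‖c i‖ := norm_add_le _ _
    _ ≤ _ := by linarith

lemma mem_halfPlane (H : IsLocalized r₀ ρ R A B a c w) (i : Fin N) {x : Plane}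
    (hx : ‖x - c i‖ ≤ ρ) : x ∈ halfPlane r₀ := by
  have h1 := abs_le.mp ((abs_apply_le_norm x 1).trans (H.norm_le i hx))
  have := H.axis
  change 0 < r₀ + x 1
  linarith

/-- Points near distinct centers are at distance at least R/2, because ρ ≤ R/8, so K is Lipschitz
there. Displacing x costs |x - c i|, and spreading the source costs its first moment. -/
lemma norm_planarVelocity_sub_le (H : IsLocalized r₀ ρ R A B a c w) {i j : Fin N} (hij : i ≠ j)
    {x : Plane} (hx : ‖x - c i‖ ≤ ρ) :
    ‖planarVelocity (w j) x - a j • kerK (c i - c j)‖ ≤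
      2 / R ^ 2 * (A * ‖x - c i‖ + absMoment 1 (w j) (c j)) := by
  have hR := H.pos
  have hsep := H.separated i j hij
  have hρ := H.radius_le
  have hK := integrable_smul_kerK (H.integrable j) (H.bound j) x
  rw [← H.mass j, ← integral_smul_const, planarVelocity,
    ← integral_sub hK ((H.integrable j).smul_const _)]
  have hi1 := H.integrable_abs_mul j (h := fun _ => ‖x - c i‖) continuous_const
  have hi2 := H.integrable_abs_mul j (h := fun y => ‖y - c j‖ ^ 1) (by fun_prop)
  have hi3 : Integrable fun y => 2 / R ^ 2 * (|w j y| * ‖x - c i‖ + |w j y| * ‖y - c j‖ ^ 1) :=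
    (hi1.add hi2).const_mul _
  refine (norm_integral_le_of_norm_le hi3 (Filter.Eventually.of_forall fun y => ?_)).trans ?_
  · by_cases h0 : w j y = 0
    · simp [h0]
    have hy := H.support j y h0
    have e : x - y - (c i - c j) = (x - c i) - (y - c j) := by abel
    have h1 : ‖x - y - (c i - c j)‖ ≤ ‖x - c i‖ + ‖y - c j‖ := by rw [e]; exact norm_sub_le _ _
    have h2 : R / 2 ≤ ‖x - y‖ := by
      have : ‖c i - c j‖ ≤ ‖x - y‖ + ‖x - y - (c i - c j)‖ := by
        have := norm_sub_le (x - y) (x - y - (c i - c j))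
        simpa using this
      linarith
    have p1 : x - y ≠ 0 := norm_pos_iff.mp (by linarith)
    have p2 : c i - c j ≠ 0 := norm_pos_iff.mp (by linarith)
    rw [← smul_sub, norm_smul, Real.norm_eq_abs]
    calc |w j y| * ‖kerK (x - y) - kerK (c i - c j)‖
        ≤ |w j y| * ((‖x - c i‖ + ‖y - c j‖) / (R / 2 * R)) := by
          gcongr
          refine (norm_kerK_sub_le p1 p2).trans ?_
          gcongr
      _ = _ := by field_simp
  · rw [integral_const_mul, integral_add hi1 hi2, integral_mul_const]
    gcongr
    · exact H.abs_mass j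
    · exact le_rfl

/-- Near the `i`-th center, the velocity is the point vortex velocity plus the planar velocity
generated by the `i`-th density, up to a small error. -/
lemma norm_velocity_sub_le (H : IsLocalized r₀ ρ R A B a c w) {s : ℝ} (hs : 0 < s) (i : Fin N)
    {x : Plane} (hx : ‖x - c i‖ ≤ ρ) :
    ‖velocity r₀ (fun y => ∑ j, w j y) x - (∑ j with j ≠ i, a j • kerK (c i - c j))
      - planarVelocity (w i) x‖ ≤
      2 / R ^ 2 * (N * A * ‖x - c i‖ + ∑ j, absMoment 1 (w j) (c j))
        + axisymmetricError N r₀ A B s := by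
  have hR := H.pos
  have hA : 0 ≤ A := le_trans (integral_nonneg fun x => abs_nonneg _) (H.abs_mass i)
  have hG := fun j => norm_integral_kerG_sub_le H.axis hs (H.integrable j) (H.bound j)
    (H.abs_mass j) (fun y hy => H.norm_le j (H.support j y hy)) (H.norm_le i hx)
  have hv : velocity r₀ (fun y => ∑ j, w j y) x = ∑ j, ∫ y, w j y • kerG r₀ x y := by
    rw [velocity, setIntegral_eq_integral_of_forall_compl_eq_zero, ← integral_finsetSum]
    · simp only [Finset.sum_smul]
    · exact fun j _ => (hG j).1
    · intro y hy
      rw [Finset.sum_eq_zero, zero_smul]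
      intro j _
      by_contra h
      exact hy (H.mem_halfPlane j (H.support j y h))
  have hm : ∀ j, 0 ≤ absMoment 1 (w j) (c j) := fun j =>
    integral_nonneg fun x => by positivity
  have hsplit : planarVelocity (w i) x + ∑ j with j ≠ i, planarVelocity (w j) x
      = ∑ j, planarVelocity (w j) x := by
    rw [← Finset.add_sum_erase _ _ (Finset.mem_univ i)]
    congr 2
    ext j; simp
  have e : velocity r₀ (fun y => ∑ j, w j y) x - (∑ j with j ≠ i, a j • kerK (c i - c j))
      - planarVelocity (w i) x =
      (∑ j with j ≠ i, (planarVelocity (w j) x - a j • kerK (c i - c j))) +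
      ∑ j, ((∫ y, w j y • kerG r₀ x y) - planarVelocity (w j) x) := by
    rw [hv, Finset.sum_sub_distrib, Finset.sum_sub_distrib, ← hsplit]
    abel
  rw [e]
  refine (norm_add_le _ _).trans (add_le_add ?_ ?_)
  · calc _ ≤ ∑ j with j ≠ i, 2 / R ^ 2 * (A * ‖x - c i‖ + absMoment 1 (w j) (c j)) := by
          refine (norm_sum_le _ _).trans (Finset.sum_le_sum fun j hj => ?_)
          exact H.norm_planarVelocity_sub_le (Finset.mem_filter.mp hj).2.symm hx
      _ ≤ ∑ j, 2 / R ^ 2 * (A * ‖x - c i‖ + absMoment 1 (w j) (c j)) := by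
          apply Finset.sum_le_sum_of_subset_of_nonneg (Finset.filter_subset _ _)
          intro j _ _
          have := hm j
          positivity
      _ = _ := by
          rw [← Finset.mul_sum, Finset.sum_add_distrib]; simp [mul_assoc]
  · refine (norm_sum_le _ _).trans ?_
    refine (Finset.sum_le_sum fun j _ => (hG j).2).trans_eq ?_
    simp [axisymmetricError]

end IsLocalized

/-! ### The self-interaction and the moments -/

/-- The larger number dominates both factors, which avoids the constants of Young's inequality. With
b = l a fixed scale, lower moments are absorbed into a higher one plus a power of l. -/
lemma pow_mul_pow_le_add {a b : ℝ} (ha : 0 ≤ a) (hb : 0 ≤ b) (i j : ℕ) :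
    a ^ i * b ^ j ≤ a ^ (i + j) + b ^ (i + j) := by
  rcases le_total a b with h | h
  · calc a ^ i * b ^ j ≤ b ^ i * b ^ j := by gcongr
      _ = b ^ (i + j) := (pow_add _ _ _).symm
      _ ≤ _ := le_add_of_nonneg_left (by positivity)
  · calc a ^ i * b ^ j ≤ a ^ i * a ^ j := by gcongr
      _ = a ^ (i + j) := (pow_add _ _ _).symm
      _ ≤ _ := le_add_of_nonneg_right (by positivity)

lemma pow_le_div_pow {a l : ℝ} (ha : 0 ≤ a) (hl : 0 < l) (i j : ℕ) :
    a ^ i ≤ (a ^ (i + j) + l ^ (i + j)) / l ^ j := by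
  rw [le_div_iff₀ (by positivity)]
  exact pow_mul_pow_le_add ha hl.le i j

lemma pow_sub_pow_le_mul {a b : ℝ} (hb : 0 ≤ b) (hab : b ≤ a) (m : ℕ) :
    a ^ m - b ^ m ≤ m * a ^ (m - 1) * (a - b) := by
  have ha : 0 ≤ a := hb.trans hab
  induction m with
  | zero => simp
  | succ k ih =>
    have h2 : a ^ k * b ≤ a ^ k * a := by gcongr
    have e : a ^ (k + 1) - b ^ (k + 1) = a ^ k * (a - b) + b * (a ^ k - b ^ k) := by ring
    rw [e]
    have h3 : b * (a ^ k - b ^ k) ≤ a * (k * a ^ (k - 1) * (a - b)) := by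
      have : 0 ≤ a ^ k - b ^ k := sub_nonneg.mpr (by gcongr)
      gcongr
    have h4 : a * (k * a ^ (k - 1) * (a - b)) = k * a ^ k * (a - b) := by
      rcases k with _ | k
      · simp
      · simp only [Nat.add_sub_cancel]; ring
    rw [h4] at h3
    push_cast
    linarith

/-- Here a = |x|, b = |y| and D = |x - y|. If b ≤ a/2 then D ≥ a/2 and only the factor b remains,
without m. If b > a/2, then (a^m - b^m)/D ≤ m a^(m-1), and a ≤ 2b allows p - 1 factors a to be
exchanged for 2b. So the large factor m comes with b^p, and a moment of order p of one's choice can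
pay for it. -/
lemma pow_sub_pow_mul_inv_le {a b D l : ℝ} (hb : 0 ≤ b) (hab : b ≤ a) (hD : a - b ≤ D)
    (hl : 0 < l) {m p : ℕ} (hp : 1 ≤ p) (hpm : p ≤ m) :
    (a ^ m - b ^ m) * (b * D⁻¹) ≤
      (a ^ (m + 2) + l ^ (m + 2)) * (2 * b / l ^ 3 + m * 2 ^ p * b ^ p / l ^ (p + 2)) := by
  have ha : 0 ≤ a := hb.trans hab
  have hD0 : 0 ≤ D := by linarith
  have h0 : 0 ≤ a ^ m - b ^ m := sub_nonneg.mpr (by gcongr)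
  have e1 : (a ^ (m + 2) + l ^ (m + 2)) * (2 * b / l ^ 3 + m * 2 ^ p * b ^ p / l ^ (p + 2)) =
      2 * b * ((a ^ (m + 2) + l ^ (m + 2)) / l ^ 3) +
      m * 2 ^ p * b ^ p * ((a ^ (m + 2) + l ^ (m + 2)) / l ^ (p + 2)) := by ring
  rw [e1]
  have p1 : a ^ (m - 1) ≤ (a ^ (m + 2) + l ^ (m + 2)) / l ^ 3 := by
    have := pow_le_div_pow ha hl (m - 1) 3
    rwa [show m - 1 + 3 = m + 2 by omega] at this
  have p2 : a ^ (m - p) ≤ (a ^ (m + 2) + l ^ (m + 2)) / l ^ (p + 2) := by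
    have := pow_le_div_pow ha hl (m - p) (p + 2)
    rwa [show m - p + (p + 2) = m + 2 by omega] at this
  rcases hD0.eq_or_lt with h | hDpos
  · rw [← h]; simp only [inv_zero, mul_zero]; positivity
  rcases le_or_gt b (a / 2) with h | h
  · have hDa : a / 2 ≤ D := by linarith
    have : (a ^ m - b ^ m) * (b * D⁻¹) ≤ 2 * b * a ^ (m - 1) := by
      rw [← div_eq_mul_inv, mul_div_assoc', div_le_iff₀ hDpos]
      have e : a ^ m = a ^ (m - 1) * a := by rw [← pow_succ]; congr 1; omega
      calc (a ^ m - b ^ m) * b ≤ a ^ m * b := by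
            gcongr; linarith [show 0 ≤ b ^ m by positivity]
        _ = 2 * b * a ^ (m - 1) * (a / 2) := by rw [e]; ring
        _ ≤ _ := by gcongr
    have : 2 * b * a ^ (m - 1) ≤ 2 * b * ((a ^ (m + 2) + l ^ (m + 2)) / l ^ 3) := by gcongr
    have : 0 ≤ m * 2 ^ p * b ^ p * ((a ^ (m + 2) + l ^ (m + 2)) / l ^ (p + 2)) := by positivity
    linarith
  · have h1 : (a ^ m - b ^ m) * (b * D⁻¹) ≤ m * a ^ (m - 1) * b := by
      rw [← div_eq_mul_inv, mul_div_assoc', div_le_iff₀ hDpos]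
      calc (a ^ m - b ^ m) * b ≤ (m * a ^ (m - 1) * D) * b := by
            gcongr
            exact (pow_sub_pow_le_mul hb hab m).trans (by gcongr)
        _ = _ := by ring
    have h2 : a ^ (m - 1) * b ≤ 2 ^ p * b ^ p * a ^ (m - p) := by
      have e : a ^ (m - 1) = a ^ (m - p) * a ^ (p - 1) := by rw [← pow_add]; congr 1; omega
      have e' : b ^ p = b ^ (p - 1) * b := by rw [← pow_succ]; congr 1; omega
      calc a ^ (m - 1) * b = a ^ (m - p) * a ^ (p - 1) * b := by rw [e]
        _ ≤ a ^ (m - p) * (2 * b) ^ (p - 1) * b := by gcongr; linarith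
        _ = 2 ^ (p - 1) * b ^ p * a ^ (m - p) := by rw [e', mul_pow]; ring
        _ ≤ _ := by gcongr <;> norm_num
    have h3 : m * a ^ (m - 1) * b ≤
        m * 2 ^ p * b ^ p * ((a ^ (m + 2) + l ^ (m + 2)) / l ^ (p + 2)) := by
      calc m * a ^ (m - 1) * b = m * (a ^ (m - 1) * b) := by ring
        _ ≤ m * (2 ^ p * b ^ p * a ^ (m - p)) := by gcongr
        _ = m * 2 ^ p * b ^ p * a ^ (m - p) := by ring
        _ ≤ _ := by gcongr
    have : 0 ≤ 2 * b * ((a ^ (m + 2) + l ^ (m + 2)) / l ^ 3) := by positivity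
    linarith

/-- The weight that bounds the symmetrized self-interaction. -/
def selfWeight (m p : ℕ) (l b : ℝ) : ℝ := 2 * b / l ^ 3 + m * 2 ^ p * b ^ p / l ^ (p + 2)

lemma selfWeight_nonneg (m p : ℕ) {l b : ℝ} (hl : 0 < l) (hb : 0 ≤ b) :
    0 ≤ selfWeight m p l b := by unfold selfWeight; positivity

lemma abs_symm_kernel_le_of_le {x y : Plane} {l : ℝ} (hl : 0 < l) {m p : ℕ} (hp : 1 ≤ p)
    (hpm : p ≤ m) (h : ‖y‖ ≤ ‖x‖) :
    |(‖x‖ ^ m - ‖y‖ ^ m) * inner ℝ x (kerK (x - y))| ≤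
      (‖x‖ ^ (m + 2) + l ^ (m + 2)) * selfWeight m p l ‖y‖ := by
  have h0 : 0 ≤ ‖x‖ ^ m - ‖y‖ ^ m := sub_nonneg.mpr (by gcongr)
  rw [abs_mul, abs_of_nonneg h0]
  refine (mul_le_mul_of_nonneg_left (abs_inner_kerK_sub_le x y) h0).trans ?_
  exact pow_sub_pow_mul_inv_le (norm_nonneg y) h (norm_sub_norm_le x y) hl hp hpm

lemma abs_symm_kernel_le (x y : Plane) {l : ℝ} (hl : 0 < l) {m p : ℕ} (hp : 1 ≤ p)
    (hpm : p ≤ m) :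
    |(‖x‖ ^ m - ‖y‖ ^ m) * inner ℝ x (kerK (x - y))| ≤
      (‖x‖ ^ (m + 2) + l ^ (m + 2)) * selfWeight m p l ‖y‖ +
      (‖y‖ ^ (m + 2) + l ^ (m + 2)) * selfWeight m p l ‖x‖ := by
  have n1 := selfWeight_nonneg m p hl (norm_nonneg x)
  have n2 := selfWeight_nonneg m p hl (norm_nonneg y)
  have n3 : 0 ≤ (‖x‖ ^ (m + 2) + l ^ (m + 2)) * selfWeight m p l ‖y‖ := by positivity
  have n4 : 0 ≤ (‖y‖ ^ (m + 2) + l ^ (m + 2)) * selfWeight m p l ‖x‖ := by positivity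
  rcases le_total ‖y‖ ‖x‖ with h | h
  · linarith [abs_symm_kernel_le_of_le hl hp hpm h]
  · have := abs_symm_kernel_le_of_le hl hp hpm h
    rw [inner_kerK_sub, ← neg_sub x y, kerK_neg, inner_neg_right, mul_neg, ← neg_mul,
      neg_sub] at this
    linarith

section SelfInteraction

variable {f : Plane → ℝ} {c : Plane} {ρ B : ℝ}

lemma integrable_of_support (hf : Measurable f) (hB : ∀ x, |f x| ≤ B)
    (hs : ∀ x, f x ≠ 0 → ‖x - c‖ ≤ ρ) : Integrable f := by
  simpa using integrable_mul_of_support (h := fun _ => 1) (C := 1) hf hB hs measurable_const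
    (by simp)

lemma integrable_mul_continuous (hf : Measurable f) (hB : ∀ x, |f x| ≤ B)
    (hs : ∀ x, f x ≠ 0 → ‖x - c‖ ≤ ρ) {h : Plane → ℝ} (hh : Continuous h) :
    Integrable fun x => f x * h x := by
  obtain ⟨C, hC⟩ := abs_le_of_norm_sub_le hh c ρ
  exact integrable_mul_of_support hf hB hs hh.measurable hC

/-- The integrand of the self-interaction. -/
def selfIntegrand (m : ℕ) (f : Plane → ℝ) (c : Plane) (z : Plane × Plane) : ℝ :=
  f z.1 * f z.2 * (‖z.1 - c‖ ^ m * inner ℝ (z.1 - c) (kerK (z.1 - z.2)))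

/-- Absolute integrability on the product justifies Fubini and the exchange of variables below. The
integral of |f y|/|x - y| in y is bounded uniformly in x. -/
lemma integrable_selfIntegrand (hf : Measurable f) (hB : ∀ x, |f x| ≤ B)
    (hs : ∀ x, f x ≠ 0 → ‖x - c‖ ≤ ρ) (m : ℕ) :
    Integrable (selfIntegrand m f c) (volume.prod volume) := by
  have hi := integrable_of_support hf hB hs
  have hmeas : Measurable (selfIntegrand m f c) := by
    unfold selfIntegrand
    have h1 : Measurable fun z : Plane × Plane => kerK (z.1 - z.2) :=
      measurable_kerK.comp (measurable_fst.sub measurable_snd)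
    have h2 : Measurable fun z : Plane × Plane => f z.1 := hf.comp measurable_fst
    have h3 : Measurable fun z : Plane × Plane => f z.2 := hf.comp measurable_snd
    have h4 : Measurable fun z : Plane × Plane => z.1 - c := measurable_fst.sub_const c
    exact (h2.mul h3).mul ((h4.norm.pow_const m).mul (h4.inner h1))
  have hK := fun x => integrable_smul_kerK hi hB x
  have hR := fun x => integrable_mul_inv_norm_sub hi hB x one_pos
  rw [integrable_prod_iff hmeas.aestronglyMeasurable]
  constructor
  · refine Filter.Eventually.of_forall fun x => ?_
    have := ((hK x).const_inner (x - c)).const_mul (f x * ‖x - c‖ ^ m)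
    refine this.congr (Filter.Eventually.of_forall fun y => ?_)
    simp only [selfIntegrand, inner_smul_right]; ring
  · have hbd := ((integrable_mul_continuous (f := fun x => |f x|) hf.abs
      (fun x => by simpa using hB x) (fun x hx => hs x (by simpa using hx))
      (h := fun x => ‖x - c‖ ^ (m + 1)) (by fun_prop)).mul_const
        (2 * Real.pi * B * 1 + (∫ y, |f y|) / 1))
    refine hbd.mono' hmeas.aestronglyMeasurable.norm.integral_prod_right'
      (Filter.Eventually.of_forall fun x => ?_)
    rw [Real.norm_of_nonneg (integral_nonneg fun y => norm_nonneg _)]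
    calc ∫ y, ‖selfIntegrand m f c (x, y)‖
        ≤ ∫ y, |f x| * ‖x - c‖ ^ (m + 1) * (|f y| * ‖x - y‖⁻¹) := by
          refine integral_mono_of_nonneg (Filter.Eventually.of_forall fun y => norm_nonneg _)
            ((hR x).1.const_mul _) (Filter.Eventually.of_forall fun y => ?_)
          simp only [selfIntegrand, norm_mul, norm_pow, Real.norm_eq_abs, abs_norm]
          have h1 : |inner ℝ (x - c) (kerK (x - y))| ≤ ‖x - c‖ * ‖x - y‖⁻¹ :=
            (abs_real_inner_le_norm _ _).trans (by gcongr; exact norm_kerK_le _)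
          calc |f x| * |f y| * (‖x - c‖ ^ m * |inner ℝ (x - c) (kerK (x - y))|)
              ≤ |f x| * |f y| * (‖x - c‖ ^ m * (‖x - c‖ * ‖x - y‖⁻¹)) := by gcongr
            _ = _ := by ring
      _ = |f x| * ‖x - c‖ ^ (m + 1) * ∫ y, |f y| * ‖x - y‖⁻¹ := integral_const_mul _ _
      _ ≤ _ := by
          gcongr
          exact (hR x).2

lemma integral_selfIntegrand (hf : Measurable f) (hB : ∀ x, |f x| ≤ B)
    (hs : ∀ x, f x ≠ 0 → ‖x - c‖ ≤ ρ) (m : ℕ) :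
    ∫ x, f x * (‖x - c‖ ^ m * inner ℝ (x - c) (planarVelocity f x)) =
      ∫ z, selfIntegrand m f c z ∂(volume.prod volume) := by
  have hi := integrable_of_support hf hB hs
  rw [integral_prod _ (integrable_selfIntegrand hf hB hs m)]
  congr 1
  ext x
  rw [planarVelocity, ← integral_inner (integrable_smul_kerK hi hB x), ← integral_const_mul,
    ← integral_const_mul]
  congr 1
  ext y
  simp only [selfIntegrand, inner_smul_right]; ring

/-- Add the integral to itself with x and y exchanged. Since K is odd and K(x - y) ⊥ x - y, the
inner product changes sign under the exchange, and the difference of the weights appears; it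
vanishes on the diagonal and compensates the singularity. -/
lemma two_mul_integral_selfIntegrand (hf : Measurable f) (hB : ∀ x, |f x| ≤ B)
    (hs : ∀ x, f x ≠ 0 → ‖x - c‖ ≤ ρ) (m : ℕ) :
    2 * ∫ z, selfIntegrand m f c z ∂(volume.prod volume) =
      ∫ z, f z.1 * f z.2 * ((‖z.1 - c‖ ^ m - ‖z.2 - c‖ ^ m) *
        inner ℝ (z.1 - c) (kerK ((z.1 - c) - (z.2 - c)))) ∂(volume.prod volume) := by
  have hI := integrable_selfIntegrand hf hB hs m
  have hsw : ∫ z, selfIntegrand m f c z ∂(volume.prod volume) =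
      ∫ z, selfIntegrand m f c z.swap ∂(volume.prod volume) :=
    (integral_prod_swap _).symm
  have hIs : Integrable (fun z => selfIntegrand m f c z.swap) (volume.prod volume) := hI.swap
  rw [two_mul]
  nth_rewrite 2 [hsw]
  rw [← integral_add hI hIs]
  congr 1
  ext ⟨x, y⟩
  simp only [selfIntegrand, Prod.swap]
  have e1 : (x - c) - (y - c) = x - y := by abel
  have e2 : inner ℝ (y - c) (kerK (y - x)) = -inner ℝ (x - c) (kerK (x - y)) := by
    rw [← neg_sub x y, kerK_neg, inner_neg_right, ← e1, inner_kerK_sub]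
  rw [e1, e2]; ring

/-- For m = 0 the symmetrized weight is 1 - 1: a planar vortex does not change its own moment of
inertia. -/
lemma integral_self_zero (hf : Measurable f) (hB : ∀ x, |f x| ≤ B)
    (hs : ∀ x, f x ≠ 0 → ‖x - c‖ ≤ ρ) :
    ∫ x, f x * (‖x - c‖ ^ 0 * inner ℝ (x - c) (planarVelocity f x)) = 0 := by
  rw [integral_selfIntegrand hf hB hs]
  have := two_mul_integral_selfIntegrand hf hB hs 0
  simp only [pow_zero, sub_self, zero_mul, mul_zero, integral_zero] at this
  linarith

/-- The contribution of the self-interaction to the growth of a moment. -/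
lemma abs_integral_self_le (hf : Measurable f) (hB : ∀ x, |f x| ≤ B)
    (hs : ∀ x, f x ≠ 0 → ‖x - c‖ ≤ ρ) (h0 : ∀ x, 0 ≤ f x) {l : ℝ} (hl : 0 < l) {m p : ℕ}
    (hp : 1 ≤ p) (hpm : p ≤ m) :
    |∫ x, f x * (‖x - c‖ ^ m * inner ℝ (x - c) (planarVelocity f x))| ≤
      (∫ x, f x * (‖x - c‖ ^ (m + 2) + l ^ (m + 2))) *
        ∫ x, f x * selfWeight m p l ‖x - c‖ := by
  have hcont : Continuous fun x => selfWeight m p l ‖x - c‖ := by unfold selfWeight; fun_prop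
  have hi1 := integrable_mul_continuous hf hB hs
    (h := fun x => ‖x - c‖ ^ (m + 2) + l ^ (m + 2)) (by fun_prop)
  have hi2 := integrable_mul_continuous hf hB hs hcont
  have hp12 := hi1.mul_prod hi2
  have hp21 := hi2.mul_prod hi1
  have h2 := two_mul_integral_selfIntegrand hf hB hs m
  rw [← integral_selfIntegrand hf hB hs] at h2
  have hle := norm_integral_le_of_norm_le (hp12.add hp21)
    (f := fun z : Plane × Plane => f z.1 * f z.2 * ((‖z.1 - c‖ ^ m - ‖z.2 - c‖ ^ m) *
        inner ℝ (z.1 - c) (kerK ((z.1 - c) - (z.2 - c)))))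
    (Filter.Eventually.of_forall fun z => ?_)
  · have q1 := integral_prod_mul (μ := volume) (ν := volume)
      (fun x => f x * (‖x - c‖ ^ (m + 2) + l ^ (m + 2))) (fun x => f x * selfWeight m p l ‖x - c‖)
    have q2 := integral_prod_mul (μ := volume) (ν := volume)
      (fun x => f x * selfWeight m p l ‖x - c‖) (fun x => f x * (‖x - c‖ ^ (m + 2) + l ^ (m + 2)))
    rw [← h2, integral_add' hp12 hp21, q1, q2, norm_mul,
      Real.norm_eq_abs, Real.norm_eq_abs, abs_two] at hle
    linarith
  · have h1 := h0 z.1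
    have h2 := h0 z.2
    rw [norm_mul, Real.norm_of_nonneg (mul_nonneg h1 h2), Real.norm_eq_abs]
    refine (mul_le_mul_of_nonneg_left (abs_symm_kernel_le (z.1 - c) (z.2 - c) hl hp hpm)
      (mul_nonneg h1 h2)).trans_eq ?_
    simp only [Pi.add_apply]; ring

end SelfInteraction

/-! ### Rates of change of the moments and of the distance to the center. -/

lemma measurable_velocity (r₀ : ℝ) {w : Plane → ℝ} (hw : Measurable w) :
    Measurable (velocity r₀ w) := by
  have h : Measurable fun p : Plane × Plane => w p.2 • kerG r₀ p.1 p.2 :=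
    (hw.comp measurable_snd).smul (measurable_kerG_prod r₀)
  exact (StronglyMeasurable.integral_prod_right' (ν := volume.restrict (halfPlane r₀))
    h.stronglyMeasurable).measurable

lemma measurable_planarVelocity {w : Plane → ℝ} (hw : Measurable w) :
    Measurable (planarVelocity w) := by
  have h : Measurable fun p : Plane × Plane => w p.2 • kerK (p.1 - p.2) :=
    (hw.comp measurable_snd).smul (measurable_kerK.comp (measurable_fst.sub measurable_snd))
  exact (StronglyMeasurable.integral_prod_right' (ν := volume) h.stronglyMeasurable).measurable

lemma norm_planarVelocity_le {w : Plane → ℝ} {B : ℝ} (hw : Integrable w) (hB : ∀ y, |w y| ≤ B)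
    (x : Plane) : ‖planarVelocity w x‖ ≤ 2 * Real.pi * B * 1 + (∫ y, |w y|) / 1 := by
  obtain ⟨h1, h2⟩ := integrable_mul_inv_norm_sub hw hB x one_pos
  refine (norm_integral_le_of_norm_le h1 (Filter.Eventually.of_forall fun y => ?_)).trans h2
  rw [norm_smul, Real.norm_eq_abs]
  gcongr
  exact norm_kerK_le _

lemma planarVelocity_eq_smul_abs {w : Plane → ℝ} {σ : ℝ} (hσ : ∀ x, w x = σ * |w x|)
    (x : Plane) : planarVelocity w x = σ • planarVelocity (fun y => |w y|) x := by
  rw [planarVelocity, planarVelocity, ← integral_smul]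
  congr 1
  ext1 y
  rw [smul_smul, ← hσ]

lemma absMoment_nonneg (k : ℕ) (w : Plane → ℝ) (c : Plane) : 0 ≤ absMoment k w c :=
  integral_nonneg fun _ => by positivity

namespace IsLocalized

variable {N : ℕ} {r₀ ρ R A B : ℝ} {a : Fin N → ℝ} {c : Fin N → Plane} {w : Fin N → Plane → ℝ}

lemma mass_nonneg (H : IsLocalized r₀ ρ R A B a c w) (i : Fin N) : 0 ≤ A :=
  le_trans (integral_nonneg fun _ => abs_nonneg _) (H.abs_mass i)

lemma bound_nonneg (H : IsLocalized r₀ ρ R A B a c w) (i : Fin N) : 0 ≤ B :=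
  le_trans (abs_nonneg _) (H.bound i 0)

end IsLocalized

/-- The velocity relative to that of the `i`-th point vortex. -/
def relativeVelocity {N : ℕ} (r₀ : ℝ) (a : Fin N → ℝ) (c : Fin N → Plane) (w : Fin N → Plane → ℝ)
    (i : Fin N) (x : Plane) : Plane :=
  velocity r₀ (fun y => ∑ j, w j y) x - ∑ j with j ≠ i, a j • kerK (c i - c j)

/-- A bound for the part of the external velocity that does not vanish at the center. -/
def externalDrift {N : ℕ} (r₀ R A B s : ℝ) (c : Fin N → Plane) (w : Fin N → Plane → ℝ) : ℝ :=
  2 / R ^ 2 * ∑ j, absMoment 1 (w j) (c j) + axisymmetricError N r₀ A B s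

/-- The rate of growth of the moment of order `m + 2` of the `i`-th density. -/
def momentRate {N : ℕ} (m : ℕ) (r₀ : ℝ) (a : Fin N → ℝ) (c : Fin N → Plane)
    (w : Fin N → Plane → ℝ) (i : Fin N) : ℝ :=
  ∫ x, |w i x| * (‖x - c i‖ ^ m * inner ℝ (x - c i) (relativeVelocity r₀ a c w i x))

namespace IsLocalized

variable {N : ℕ} {r₀ ρ R A B : ℝ} {a : Fin N → ℝ} {c : Fin N → Plane} {w : Fin N → Plane → ℝ}

lemma norm_relativeVelocity_sub_le (H : IsLocalized r₀ ρ R A B a c w) {s : ℝ} (hs : 0 < s)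
    (i : Fin N) {x : Plane} (hx : ‖x - c i‖ ≤ ρ) :
    ‖relativeVelocity r₀ a c w i x - planarVelocity (w i) x‖ ≤
      2 / R ^ 2 * N * A * ‖x - c i‖ + externalDrift r₀ R A B s c w := by
  refine (H.norm_velocity_sub_le hs i hx).trans_eq ?_
  rw [externalDrift]; ring

lemma integral_abs_mul_add_le (H : IsLocalized r₀ ρ R A B a c w) (i : Fin N) (k : ℕ) {q : ℝ}
    (hq : 0 ≤ q) :
    ∫ x, |w i x| * (‖x - c i‖ ^ k + q) ≤ absMoment k (w i) (c i) + A * q := by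
  have h1 := H.integrable_abs_mul i (h := fun x => ‖x - c i‖ ^ k) (by fun_prop)
  have h2 := H.integrable_abs_mul i (h := fun _ => q) continuous_const
  simp only [mul_add]
  rw [integral_add h1 h2, integral_mul_const, absMoment]
  exact add_le_add le_rfl (mul_le_mul_of_nonneg_right (H.abs_mass i) hq)

lemma absMoment_le (H : IsLocalized r₀ ρ R A B a c w) (i : Fin N) (k j : ℕ) {l : ℝ}
    (hl : 0 < l) :
    l ^ j * absMoment k (w i) (c i) ≤ absMoment (k + j) (w i) (c i) + A * l ^ (k + j) := by
  refine le_trans ?_ (H.integral_abs_mul_add_le i (k + j) (by positivity))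
  rw [absMoment, ← integral_const_mul]
  apply integral_mono ((H.integrable_abs_mul i (h := fun x => ‖x - c i‖ ^ k)
    (by fun_prop)).const_mul _) (H.integrable_abs_mul i (by fun_prop))
  intro x
  have := pow_mul_pow_le_add (norm_nonneg (x - c i)) hl.le k j
  calc l ^ j * (|w i x| * ‖x - c i‖ ^ k) = |w i x| * (‖x - c i‖ ^ k * l ^ j) := by ring
    _ ≤ _ := mul_le_mul_of_nonneg_left this (abs_nonneg _)

lemma absMoment_one_le (H : IsLocalized r₀ ρ R A B a c w) (i : Fin N) {μ : ℝ} (hμ : 0 < μ)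
    (h : absMoment 2 (w i) (c i) ≤ μ ^ 2) : absMoment 1 (w i) (c i) ≤ (1 + A) * μ := by
  have := H.absMoment_le i 1 1 hμ
  norm_num at this
  have h2 : μ * absMoment 1 (w i) (c i) ≤ μ * ((1 + A) * μ) := by nlinarith
  exact le_of_mul_le_mul_left h2 hμ

/-- Once the self-generated planar field is removed, the relative velocity is at most Lip · |x - c
i| + drift; the two terms feed the moments of order m+2 and m+1. -/
lemma abs_momentRate_sub_le (H : IsLocalized r₀ ρ R A B a c w) {s : ℝ} (hs : 0 < s) (i : Fin N)
    (m : ℕ) :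
    |momentRate m r₀ a c w i -
      ∫ x, |w i x| * (‖x - c i‖ ^ m * inner ℝ (x - c i) (planarVelocity (w i) x))| ≤
      2 / R ^ 2 * N * A * absMoment (m + 2) (w i) (c i) +
        externalDrift r₀ R A B s c w * absMoment (m + 1) (w i) (c i) := by
  have hw := H.measurable i
  have hsum : Measurable fun y => ∑ j, w j y :=
    Finset.measurable_sum _ fun j _ => H.measurable j
  have hmu : Measurable (relativeVelocity r₀ a c w i) :=
    (measurable_velocity r₀ hsum).sub_const _
  have hmp := measurable_planarVelocity hw
  have hR := H.pos
  have hi1 := H.integrable_abs_mul i (h := fun x => ‖x - c i‖ ^ (m + 2)) (by fun_prop)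
  have hi2 := H.integrable_abs_mul i (h := fun x => ‖x - c i‖ ^ (m + 1)) (by fun_prop)
  have hip : Integrable fun x =>
      |w i x| * (‖x - c i‖ ^ m * inner ℝ (x - c i) (planarVelocity (w i) x)) := by
    refine (hi2.mul_const (2 * Real.pi * B * 1 + (∫ y, |w i y|) / 1)).mono' ?_
      (Filter.Eventually.of_forall fun x => ?_)
    · exact (hw.abs.mul (((measurable_id.sub_const _).norm.pow_const m).mul
        ((measurable_id.sub_const _).inner hmp))).aestronglyMeasurable
    · rw [norm_mul, norm_mul, Real.norm_eq_abs, abs_abs, Real.norm_of_nonneg (by positivity),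
        mul_assoc]
      refine mul_le_mul_of_nonneg_left ?_ (abs_nonneg _)
      calc ‖x - c i‖ ^ m * ‖inner ℝ (x - c i) (planarVelocity (w i) x)‖
          ≤ ‖x - c i‖ ^ m * (‖x - c i‖ * (2 * Real.pi * B * 1 + (∫ y, |w i y|) / 1)) := by
            gcongr
            refine (norm_inner_le_norm _ _).trans ?_
            gcongr
            exact norm_planarVelocity_le (H.integrable i) (H.bound i) x
        _ = _ := by ring
  set g := fun x => |w i x| * (‖x - c i‖ ^ m *
    inner ℝ (x - c i) (relativeVelocity r₀ a c w i x - planarVelocity (w i) x)) with hg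
  have hb : ∀ x, ‖g x‖ ≤ 2 / R ^ 2 * N * A * (|w i x| * ‖x - c i‖ ^ (m + 2)) +
      externalDrift r₀ R A B s c w * (|w i x| * ‖x - c i‖ ^ (m + 1)) := by
    intro x
    by_cases h0 : w i x = 0
    · simp [hg, h0]
    have hx := H.norm_relativeVelocity_sub_le hs i (H.support i x h0)
    rw [hg]
    simp only [norm_mul, Real.norm_eq_abs, abs_abs, norm_pow, abs_norm]
    calc |w i x| * (‖x - c i‖ ^ m *
          |inner ℝ (x - c i) (relativeVelocity r₀ a c w i x - planarVelocity (w i) x)|)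
        ≤ |w i x| * (‖x - c i‖ ^ m * (‖x - c i‖ *
          (2 / R ^ 2 * N * A * ‖x - c i‖ + externalDrift r₀ R A B s c w))) := by
          gcongr
          exact (abs_real_inner_le_norm _ _).trans (by gcongr)
      _ = _ := by ring
  have hbi : Integrable fun x => 2 / R ^ 2 * N * A * (|w i x| * ‖x - c i‖ ^ (m + 2)) +
      externalDrift r₀ R A B s c w * (|w i x| * ‖x - c i‖ ^ (m + 1)) :=
    (hi1.const_mul _).add (hi2.const_mul _)
  have hgi : Integrable g := by
    refine hbi.mono' ?_ (Filter.Eventually.of_forall hb)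
    exact (hw.abs.mul (((measurable_id.sub_const _).norm.pow_const m).mul
        ((measurable_id.sub_const _).inner (hmu.sub hmp)))).aestronglyMeasurable
  have e : momentRate m r₀ a c w i = (∫ x, g x) +
      ∫ x, |w i x| * (‖x - c i‖ ^ m * inner ℝ (x - c i) (planarVelocity (w i) x)) := by
    rw [← integral_add hgi hip, momentRate]
    congr 1
    ext1 x
    rw [hg]
    simp only [inner_sub_right]
    ring
  rw [e, add_sub_cancel_right, ← Real.norm_eq_abs]
  refine (norm_integral_le_of_norm_le hbi (Filter.Eventually.of_forall hb)).trans_eq ?_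
  rw [integral_add (hi1.const_mul _) (hi2.const_mul _), integral_const_mul, integral_const_mul,
    absMoment, absMoment]

/-- The definite sign of the component enters here: it reduces the self-interaction to that of a
nonnegative density, so that the weight in the double integral is symmetric. -/
lemma integral_self_eq (i : Fin N) {σ : ℝ} (hσ : ∀ x, w i x = σ * |w i x|) (m : ℕ) :
    ∫ x, |w i x| * (‖x - c i‖ ^ m * inner ℝ (x - c i) (planarVelocity (w i) x)) =
    σ * ∫ x, |w i x| * (‖x - c i‖ ^ m *
      inner ℝ (x - c i) (planarVelocity (fun y => |w i y|) x)) := by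
  rw [← integral_const_mul]
  congr 1
  ext1 x
  rw [planarVelocity_eq_smul_abs hσ, inner_smul_right]
  ring

lemma abs_momentRate_zero_le (H : IsLocalized r₀ ρ R A B a c w) {s : ℝ} (hs : 0 < s) (i : Fin N)
    {σ : ℝ} (hσ : ∀ x, w i x = σ * |w i x|) :
    |momentRate 0 r₀ a c w i| ≤ 2 / R ^ 2 * N * A * absMoment 2 (w i) (c i) +
        externalDrift r₀ R A B s c w * absMoment 1 (w i) (c i) := by
  have h := H.abs_momentRate_sub_le hs i 0
  rw [integral_self_eq i hσ, integral_self_zero (H.measurable i).abs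
    (fun x => by simpa using H.bound i x) (fun x hx => H.support i x (by simpa using hx)),
    mul_zero, sub_zero] at h
  simpa using h

/-- The hypotheses `h1` and `h2` say that the two terms of `selfWeight` have integral at most 1
each, so the self-interaction contributes at most 2 to the rate. The drift, being at most l,
contributes at most 1, by interpolating the moment of order m+1 at scale l. -/
lemma abs_momentRate_le (H : IsLocalized r₀ ρ R A B a c w) {s : ℝ} (hs : 0 < s) (i : Fin N)
    {σ : ℝ} (hσ1 : |σ| ≤ 1) (hσ : ∀ x, w i x = σ * |w i x|) {m p : ℕ} (hp : 1 ≤ p) (hpm : p ≤ m)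
    {l : ℝ} (hl : 0 < l) (hdrift : externalDrift r₀ R A B s c w ≤ l)
    (h1 : 2 * absMoment 1 (w i) (c i) ≤ l ^ 3)
    (h2 : m * 2 ^ p * absMoment p (w i) (c i) ≤ l ^ (p + 2)) :
    |momentRate m r₀ a c w i| ≤
      (2 / R ^ 2 * N * A + 3) * (absMoment (m + 2) (w i) (c i) + A * l ^ (m + 2)) := by
  have hA := H.mass_nonneg i
  have hR := H.pos
  have h := H.abs_momentRate_sub_le hs i m
  set Q := absMoment (m + 2) (w i) (c i) + A * l ^ (m + 2) with hQ
  have hM := absMoment_nonneg (m + 2) (w i) (c i)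
  have hQ0 : 0 ≤ Q := by positivity
  have hMQ : absMoment (m + 2) (w i) (c i) ≤ Q := le_add_of_nonneg_right (by positivity)
  have hself : |∫ x, |w i x| * (‖x - c i‖ ^ m * inner ℝ (x - c i) (planarVelocity (w i) x))|
      ≤ 2 * Q := by
    rw [integral_self_eq i hσ, abs_mul]
    have hs' := abs_integral_self_le (c := c i) (H.measurable i).abs
      (fun x => by simpa using H.bound i x) (fun x hx => H.support i x (by simpa using hx))
      (fun x => abs_nonneg _) hl hp hpm
    have hq1 := H.integral_abs_mul_add_le i (m + 2) (q := l ^ (m + 2)) (by positivity)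
    have hq2 : ∫ x, |w i x| * selfWeight m p l ‖x - c i‖ ≤ 2 := by
      have e : ∀ x, |w i x| * selfWeight m p l ‖x - c i‖ =
          2 / l ^ 3 * (|w i x| * ‖x - c i‖ ^ 1) +
          m * 2 ^ p / l ^ (p + 2) * (|w i x| * ‖x - c i‖ ^ p) := by
        intro x; unfold selfWeight; ring
      simp only [e]
      rw [integral_add ((H.integrable_abs_mul i (h := fun x => ‖x - c i‖ ^ 1)
        (by fun_prop)).const_mul _) ((H.integrable_abs_mul i (h := fun x => ‖x - c i‖ ^ p)
        (by fun_prop)).const_mul _), integral_const_mul, integral_const_mul]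
      have t1 : 2 / l ^ 3 * absMoment 1 (w i) (c i) ≤ 1 := by
        rw [div_mul_eq_mul_div, div_le_one (by positivity)]; exact h1
      have t2 : m * 2 ^ p / l ^ (p + 2) * absMoment p (w i) (c i) ≤ 1 := by
        rw [div_mul_eq_mul_div, div_le_one (by positivity)]; exact h2
      simp only [absMoment] at t1 t2
      linarith
    have hq3 : 0 ≤ ∫ x, |w i x| * selfWeight m p l ‖x - c i‖ :=
      integral_nonneg fun x => mul_nonneg (abs_nonneg _) (selfWeight_nonneg m p hl (norm_nonneg _))
    calc _ ≤ 1 * (Q * 2) := by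
          gcongr
          exact hs'.trans (mul_le_mul hq1 hq2 hq3 hQ0)
      _ = _ := by ring
  have hd : externalDrift r₀ R A B s c w * absMoment (m + 1) (w i) (c i) ≤ Q := by
    have := H.absMoment_le i (m + 1) 1 hl
    calc externalDrift r₀ R A B s c w * absMoment (m + 1) (w i) (c i)
        ≤ l * absMoment (m + 1) (w i) (c i) := by
          have := absMoment_nonneg (m + 1) (w i) (c i)
          gcongr
      _ = l ^ 1 * absMoment (m + 1) (w i) (c i) := by rw [pow_one]
      _ ≤ Q := this
  have hL : 2 / R ^ 2 * N * A * absMoment (m + 2) (w i) (c i) ≤ 2 / R ^ 2 * N * A * Q := by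
    gcongr
  rw [abs_le] at h hself ⊢
  constructor <;> linarith [h.1, h.2, hself.1, hself.2]

lemma integral_outer_le (H : IsLocalized r₀ ρ R A B a c w) (i : Fin N) (k : ℕ) {t : ℝ}
    (ht : 0 < t) :
    ∫ y, |{y | t < ‖y - c i‖}.indicator (w i) y| ≤ absMoment k (w i) (c i) / t ^ k := by
  rw [le_div_iff₀ (by positivity), ← integral_mul_const, absMoment]
  have hS : MeasurableSet {y : Plane | t < ‖y - c i‖} :=
    measurableSet_lt measurable_const (measurable_id.sub_const _).norm
  apply integral_mono (((H.integrable i).indicator hS).abs.mul_const _)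
    (H.integrable_abs_mul i (h := fun x => ‖x - c i‖ ^ k) (by fun_prop))
  intro y
  by_cases hy : t < ‖y - c i‖
  · simp only [indicator_of_mem (show y ∈ {y | t < ‖y - c i‖} from hy)]
    gcongr
  · simp only [indicator_of_notMem (show y ∉ {y | t < ‖y - c i‖} from hy)]
    rw [abs_zero, zero_mul]; positivity

/-- Sources with |y - c i| ≤ l/2 are at distance at least l/2 from x, and exchanging x - c i for y -
c i in the inner product bounds their effect by the first moment. The remaining sources have little
mass by Chebyshev's inequality at order k, and their potential is estimated by a cut at distance s.
-/
lemma abs_inner_planarVelocity_le (H : IsLocalized r₀ ρ R A B a c w) (i : Fin N) {x : Plane}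
    {l s : ℝ} (hl : 0 < l) (hs : 0 < s) (hx : l ≤ ‖x - c i‖) (k : ℕ) :
    |inner ℝ (x - c i) (planarVelocity (w i) x)| ≤
      2 / l * absMoment 1 (w i) (c i) +
      ‖x - c i‖ * (2 * Real.pi * B * s + absMoment k (w i) (c i) / (l / 2) ^ k / s) := by
  have hb : 0 < ‖x - c i‖ := hl.trans_le hx
  have hS : MeasurableSet {y : Plane | l / 2 < ‖y - c i‖} :=
    measurableSet_lt measurable_const (measurable_id.sub_const _).norm
  set g := {y | l / 2 < ‖y - c i‖}.indicator (w i) with hg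
  have hgi : Integrable g := (H.integrable i).indicator hS
  have hgB : ∀ y, |g y| ≤ B := by
    intro y
    by_cases hy : l / 2 < ‖y - c i‖
    · rw [hg, indicator_of_mem (show y ∈ {y | l / 2 < ‖y - c i‖} from hy)]; exact H.bound i y
    · rw [hg, indicator_of_notMem (show y ∉ {y | l / 2 < ‖y - c i‖} from hy), abs_zero]
      exact H.bound_nonneg i
  obtain ⟨hri, hr⟩ := integrable_mul_inv_norm_sub hgi hgB x hs
  have hout := H.integral_outer_le i k (t := l / 2) (by positivity)
  have hi1 := H.integrable_abs_mul i (h := fun x => ‖x - c i‖ ^ 1) (by fun_prop)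
  rw [planarVelocity, ← integral_inner (integrable_smul_kerK (H.integrable i) (H.bound i) x),
    ← Real.norm_eq_abs]
  have hbi : Integrable fun y => 2 / l * (|w i y| * ‖y - c i‖ ^ 1) +
      ‖x - c i‖ * (|g y| * ‖x - y‖⁻¹) := (hi1.const_mul _).add (hri.const_mul _)
  refine (norm_integral_le_of_norm_le hbi (Filter.Eventually.of_forall fun y => ?_)).trans ?_
  · rw [inner_smul_right, norm_mul, Real.norm_eq_abs, Real.norm_eq_abs]
    by_cases hy : l / 2 < ‖y - c i‖
    · rw [hg, indicator_of_mem (show y ∈ {y | l / 2 < ‖y - c i‖} from hy)]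
      have h1 : |inner ℝ (x - c i) (kerK (x - y))| ≤ ‖x - c i‖ * ‖x - y‖⁻¹ :=
        (abs_real_inner_le_norm _ _).trans (by gcongr; exact norm_kerK_le _)
      have h2 : 0 ≤ 2 / l * (|w i y| * ‖y - c i‖ ^ 1) := by positivity
      calc |w i y| * |inner ℝ (x - c i) (kerK (x - y))|
          ≤ |w i y| * (‖x - c i‖ * ‖x - y‖⁻¹) := by gcongr
        _ = ‖x - c i‖ * (|w i y| * ‖x - y‖⁻¹) := by ring
        _ ≤ _ := le_add_of_nonneg_left h2
    · rw [hg, indicator_of_notMem (show y ∉ {y | l / 2 < ‖y - c i‖} from hy)]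
      push Not at hy
      have e : (x - c i) - (y - c i) = x - y := by abel
      have h1 := abs_inner_kerK_sub_le (x - c i) (y - c i)
      rw [e] at h1
      have h2 : l / 2 ≤ ‖x - y‖ := by
        have := norm_sub_norm_le (x - c i) (y - c i)
        rw [e] at this; linarith
      rw [abs_zero, zero_mul, mul_zero, add_zero, pow_one]
      calc |w i y| * |inner ℝ (x - c i) (kerK (x - y))|
          ≤ |w i y| * (‖y - c i‖ * (l / 2)⁻¹) := by
            gcongr
            exact h1.trans (by gcongr)
        _ = _ := by field_simp
  · rw [integral_add (hi1.const_mul _) (hri.const_mul _), integral_const_mul, integral_const_mul,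
      absMoment]
    gcongr
    exact hr.trans (by gcongr)

/-- The radial growth of the trajectories that are not too close to the center. -/
lemma inner_relativeVelocity_le (H : IsLocalized r₀ ρ R A B a c w) {s : ℝ} (hs : 0 < s)
    (i : Fin N) {x : Plane} (hx : ‖x - c i‖ ≤ ρ) {l : ℝ} (hl : 0 < l) (hlx : l ≤ ‖x - c i‖)
    (hdrift : externalDrift r₀ R A B s c w ≤ l) (h1 : 2 * absMoment 1 (w i) (c i) ≤ l ^ 3)
    {k : ℕ} {s' : ℝ} (hs' : 0 < s')
    (h2 : 2 * Real.pi * B * s' + absMoment k (w i) (c i) / (l / 2) ^ k / s' ≤ l) :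
    inner ℝ (x - c i) (relativeVelocity r₀ a c w i x) ≤
      (2 / R ^ 2 * N * A + 3) * ‖x - c i‖ ^ 2 := by
  have hu := H.norm_relativeVelocity_sub_le hs i hx
  have hp := H.abs_inner_planarVelocity_le i hl hs' hlx k
  set b := ‖x - c i‖ with hb
  have hb0 : 0 < b := hl.trans_le hlx
  have e : relativeVelocity r₀ a c w i x =
      (relativeVelocity r₀ a c w i x - planarVelocity (w i) x) + planarVelocity (w i) x := by abel
  rw [e, inner_add_right]
  have t1 : inner ℝ (x - c i) (relativeVelocity r₀ a c w i x - planarVelocity (w i) x) ≤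
      b * (2 / R ^ 2 * N * A * b + b) := by
    refine (real_inner_le_norm _ _).trans ?_
    rw [← hb]
    gcongr
    exact hu.trans (by linarith)
  have t2 : 2 / l * absMoment 1 (w i) (c i) ≤ b ^ 2 := by
    rw [div_mul_eq_mul_div, div_le_iff₀ hl]
    calc 2 * absMoment 1 (w i) (c i) ≤ l ^ 3 := h1
      _ = l ^ 2 * l := by ring
      _ ≤ b ^ 2 * l := by gcongr
  have t3 : b * (2 * Real.pi * B * s' + absMoment k (w i) (c i) / (l / 2) ^ k / s') ≤ b * b := by
    gcongr; exact h2.trans hlx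
  have := (abs_le.mp hp).2
  nlinarith

end IsLocalized

/-! ### Localization of the weak formulation -/

lemma transported_sum {N : ℕ} (r₀ : ℝ) (ψ : ℝ → Plane → Plane) (w : Fin N → Plane → ℝ) (t : ℝ) :
    transported r₀ ψ (fun x => ∑ j, w j x) t = fun x => ∑ j, transported r₀ ψ (w j) t x := by
  ext x
  by_cases hx : x ∈ halfPlane r₀
  · simp [transported, hx, Finset.mul_sum]
  · simp [transported, hx]

lemma setIntegral_transported_mul (r₀ : ℝ) (ψ : ℝ → Plane → Plane) (w : Plane → ℝ) (t : ℝ)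
    (h : Plane → ℝ) :
    ∫ x in halfPlane r₀, transported r₀ ψ w t x * h x = ∫ x, transported r₀ ψ w t x * h x := by
  apply setIntegral_eq_integral_of_forall_compl_eq_zero
  intro x hx
  simp [transported, hx]

/-- The weak formulation concerns only the total vorticity. This identity extracts one component
from it, when the test function vanishes on the others. -/
lemma sum_mul_eq_of_localized {N : ℕ} (τ : Fin N → ℝ) (i : Fin N) {u v : ℝ}
    (hi : τ i ≠ 0 → u = v) (hj : ∀ j ≠ i, τ j ≠ 0 → u = 0) :
    (∑ j, τ j) * u = τ i * v := by
  rw [Finset.sum_mul, Finset.sum_eq_single i]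
  · by_cases h : τ i = 0
    · simp [h]
    · rw [hi h]
  · intro j _ hji
    by_cases h : τ j = 0
    · simp [h]
    · rw [hj j hji h, mul_zero]
  · simp

/-- The weak formulation for one of the components of the vorticity, as long as their supports
are separated; the test function need not be bounded. -/
lemma IsEulerFlow.hasDerivWithinAt_integral {N : ℕ} {r₀ ρ R T : ℝ} {w : Fin N → Plane → ℝ}
    {φ ψ : ℝ → Plane → Plane} {z : Fin N → ℝ → Plane}
    (hflow : IsEulerFlow r₀ (fun x => ∑ i, w i x) φ ψ)
    (hz : ∀ j, ContinuousOn (z j) (Ici 0))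
    (hsupp : ∀ s ∈ Icc 0 T, ∀ j x, transported r₀ ψ (w j) s x ≠ 0 → ‖x - z j s‖ ≤ ρ)
    (hR : 0 < R) (hρ : ρ ≤ R / 8) {t : ℝ} (ht : t ∈ Icc 0 T) (i : Fin N)
    (hsep : ∀ j, j ≠ i → R ≤ ‖z j t - z i t‖) {g : ℝ × Plane → ℝ} (hg : ContDiff ℝ ∞ g) :
    HasDerivWithinAt (fun s => ∫ x, transported r₀ ψ (w i) s x * g (s, x))
      (∫ x, transported r₀ ψ (w i) t x * fderiv ℝ g (t, x)
        ((1 : ℝ), velocity r₀ (transported r₀ ψ (fun x => ∑ j, w j x) t) x)) (Icc 0 T) t := by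
  -- For times near t, the i-th support lies within R/8 + R/8 of z i t, where χ = 1. The other
  -- supports are at distance at least R - R/8 - R/8 > R/2, where χ = 0. The cutoff also makes any
  -- smooth g bounded.
  let χ : ContDiffBump ((t, z i t) : ℝ × Plane) := ⟨R / 4, R / 2, by positivity, by linarith⟩
  set f : ℝ × Plane → ℝ := fun q => χ q * g q with hf
  have hfc : ContDiff ℝ ∞ f := χ.contDiff.mul hg
  have hfb : ∃ C : ℝ, ∀ q, |f q| ≤ C := by
    have : HasCompactSupport f := χ.hasCompactSupport.mul_right
    exact this.exists_bound_of_continuous hfc.continuous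
  have hin : ∀ q : ℝ × Plane, |q.1 - t| ≤ R / 4 → ‖q.2 - z i t‖ ≤ R / 4 → χ q = 1 := by
    intro q h1 h2
    apply χ.one_of_mem_closedBall
    rw [Metric.mem_closedBall, Prod.dist_eq, max_le_iff, Real.dist_eq, dist_eq_norm]
    exact ⟨h1, h2⟩
  have hout : ∀ q : ℝ × Plane, R / 2 ≤ ‖q.2 - z i t‖ → χ q = 0 := by
    intro q h2
    apply χ.zero_of_le_dist
    rw [Prod.dist_eq, dist_eq_norm q.2]
    exact h2.trans (le_max_right _ _)
  have hw := (hflow.weak f hfc hfb t ht.1).mono (Icc_subset_Ici_self : Icc 0 T ⊆ Ici 0)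
  simp only [setIntegral_transported_mul] at hw
  have hval : ∫ x, transported r₀ ψ (fun x => ∑ j, w j x) t x * fderiv ℝ f (t, x)
        ((1 : ℝ), velocity r₀ (transported r₀ ψ (fun x => ∑ j, w j x) t) x) =
      ∫ x, transported r₀ ψ (w i) t x * fderiv ℝ g (t, x)
        ((1 : ℝ), velocity r₀ (transported r₀ ψ (fun x => ∑ j, w j x) t) x) := by
    congr 1
    ext1 x
    rw [show transported r₀ ψ (fun x => ∑ j, w j x) t x = ∑ j, transported r₀ ψ (w j) t x from
      congrFun (transported_sum r₀ ψ w t) x]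
    apply sum_mul_eq_of_localized (fun j => transported r₀ ψ (w j) t x)
    · intro h
      have hx := hsupp t ht i x h
      have : f =ᶠ[𝓝 (t, x)] g := by
        have h1 : ∀ᶠ q : ℝ × Plane in 𝓝 (t, x), |q.1 - t| < R / 4 := by
          have : ContinuousAt (fun q : ℝ × Plane => |q.1 - t|) (t, x) := by fun_prop
          exact this.eventually_lt continuousAt_const (by simpa using hR)
        have h2 : ∀ᶠ q : ℝ × Plane in 𝓝 (t, x), ‖q.2 - z i t‖ < R / 4 := by
          have : ContinuousAt (fun q : ℝ × Plane => ‖q.2 - z i t‖) (t, x) := by fun_prop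
          exact this.eventually_lt continuousAt_const (by simp only; linarith)
        filter_upwards [h1, h2] with q hq1 hq2
        rw [hf]; simp only [hin q hq1.le hq2.le, one_mul]
      rw [this.fderiv_eq]
    · intro j hj h
      have hx := hsupp t ht j x h
      have hd := hsep j hj
      have hfar : R / 2 < ‖x - z i t‖ := by
        have : ‖z j t - z i t‖ ≤ ‖x - z i t‖ + ‖x - z j t‖ := by
          have := norm_sub_le (x - z i t) (x - z j t)
          simpa using this
        linarith
      have : f =ᶠ[𝓝 (t, x)] fun _ => 0 := by
        have h2 : ∀ᶠ q : ℝ × Plane in 𝓝 (t, x), R / 2 < ‖q.2 - z i t‖ := by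
          have : ContinuousAt (fun q : ℝ × Plane => ‖q.2 - z i t‖) (t, x) := by fun_prop
          exact continuousAt_const.eventually_lt this hfar
        filter_upwards [h2] with q hq2
        rw [hf]; simp only [hout q hq2.le, zero_mul]
      rw [this.fderiv_eq]; simp
  rw [hval] at hw
  have hkey : ∀ s ∈ Icc 0 T, |s - t| ≤ R / 4 → (∀ j, ‖z j s - z j t‖ ≤ R / 8) →
      ∫ x, transported r₀ ψ (w i) s x * g (s, x) =
      ∫ x, transported r₀ ψ (fun x => ∑ j, w j x) s x * f (s, x) := by
    intro s hs hst hzs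
    congr 1
    ext1 x
    rw [show transported r₀ ψ (fun x => ∑ j, w j x) s x = ∑ j, transported r₀ ψ (w j) s x from
      congrFun (transported_sum r₀ ψ w s) x]
    symm
    apply sum_mul_eq_of_localized (fun j => transported r₀ ψ (w j) s x)
    · intro h
      have hx := hsupp s hs i x h
      have : ‖x - z i t‖ ≤ R / 4 := by
        have := norm_add_le (x - z i s) (z i s - z i t)
        rw [sub_add_sub_cancel] at this
        linarith [hzs i]
      rw [hf]; simp only [hin (s, x) hst this, one_mul]
    · intro j hj h
      have hx := hsupp s hs j x h
      have hd := hsep j hj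
      have hfar : R / 2 ≤ ‖x - z i t‖ := by
        have h1 : ‖z j t - z i t‖ ≤ ‖x - z i t‖ + ‖x - z j t‖ := by
          have := norm_sub_le (x - z i t) (x - z j t)
          simpa using this
        have h2 := norm_add_le (x - z j s) (z j s - z j t)
        rw [sub_add_sub_cancel] at h2
        linarith [hzs j]
      rw [hf]; simp only [hout (s, x) hfar, zero_mul]
  refine hw.congr_of_eventuallyEq ?_ (hkey t ht (by simpa using by positivity) fun j => by
    simpa using by positivity)
  have e1 : ∀ᶠ s in 𝓝[Icc 0 T] t, |s - t| < R / 4 := by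
    have : ContinuousAt (fun s => |s - t|) t := by fun_prop
    exact (this.eventually_lt continuousAt_const (by simpa using hR)).filter_mono
      nhdsWithin_le_nhds
  have e2 : ∀ᶠ s in 𝓝[Icc 0 T] t, ∀ j, ‖z j s - z j t‖ < R / 8 := by
    rw [eventually_all]
    intro j
    have hc : ContinuousWithinAt (fun s => ‖z j s - z j t‖) (Icc 0 T) t :=
      (((hz j) t ht.1).mono Icc_subset_Ici_self |>.sub continuousWithinAt_const).norm
    exact Tendsto.eventually_lt hc tendsto_const_nhds (by simpa using hR)
  filter_upwards [e1, e2, self_mem_nhdsWithin] with s h1 h2 h3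
  exact hkey s h3 h1.le fun j => (h2 j).le

/-! ### Evolution of the moments -/

/-- An Euler flow whose `N` vorticity components stay localized near the point vortices `z` in the
time interval `[0, T]`. -/
structure IsConfinedFlow {N : ℕ} (r₀ ρ R A B : ℝ) (a : Fin N → ℝ) (w : Fin N → Plane → ℝ)
    (φ ψ : ℝ → Plane → Plane) (z : Fin N → ℝ → Plane) (T : ℝ) : Prop where
  flow : IsEulerFlow r₀ (fun x => ∑ i, w i x) φ ψ
  localized : ∀ t ∈ Icc 0 T, IsLocalized r₀ ρ R A B a (fun i => z i t)
    (fun i => transported r₀ ψ (w i) t)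
  deriv : ∀ i, ∀ t : ℝ, 0 ≤ t →
    HasDerivWithinAt (z i) (∑ j with j ≠ i, a j • kerK (z i t - z j t)) (Ici 0) t
  sign : ∀ i, ∃ σ : ℝ, |σ| = 1 ∧ ∀ x, |w i x| = σ * w i x

lemma abs_transported {r₀ : ℝ} {ψ : ℝ → Plane → Plane} {w : Plane → ℝ} {t σ : ℝ}
    (hψ : MapsTo (ψ t) (halfPlane r₀) (halfPlane r₀)) (hσ : ∀ x, |w x| = σ * w x) (x : Plane) :
    |transported r₀ ψ w t x| = σ * transported r₀ ψ w t x := by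
  by_cases hx : x ∈ halfPlane r₀
  · have h1 : 0 < r₀ + x 1 := hx
    have h2 : 0 < r₀ + ψ t x 1 := hψ hx
    simp only [transported, indicator_of_mem hx]
    rw [abs_mul, hσ, abs_of_pos (by positivity)]
    ring
  · simp [transported, hx]

lemma abs_pow_sub_pow_le {a b K : ℝ} (ha : 0 ≤ a) (hb : 0 ≤ b) (haK : a ≤ K) (hbK : b ≤ K)
    (m : ℕ) : |a ^ m - b ^ m| ≤ m * K ^ (m - 1) * |a - b| := by
  rcases le_total a b with h | h
  · have h1 := pow_sub_pow_le_mul ha h m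
    have h2 : a ^ m ≤ b ^ m := by gcongr
    rw [abs_sub_comm, abs_of_nonneg (by linarith), abs_sub_comm, abs_of_nonneg (by linarith)]
    refine h1.trans ?_
    have : 0 ≤ b - a := by linarith
    gcongr
  · have h1 := pow_sub_pow_le_mul hb h m
    have h2 : b ^ m ≤ a ^ m := by gcongr
    rw [abs_of_nonneg (by linarith), abs_of_nonneg (by linarith)]
    refine h1.trans ?_
    have : 0 ≤ a - b := by linarith
    gcongr

/-- The even powers of the distance from a center moving with constant velocity. -/
def movingPow (k : ℕ) (c v : Plane) (t : ℝ) (q : ℝ × Plane) : ℝ :=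
  (‖q.2 - c - (q.1 - t) • v‖ ^ 2) ^ (k + 1)

lemma contDiff_movingPow (k : ℕ) (c v : Plane) (t : ℝ) : ContDiff ℝ ∞ (movingPow k c v t) := by
  unfold movingPow
  apply ContDiff.pow
  apply ContDiff.norm_sq ℝ
  fun_prop

/-- Moving the center with velocity v makes the velocity relative to the vortex appear. Only even
powers are used, since they are smooth at the center. -/
lemma fderiv_movingPow (k : ℕ) (c v : Plane) (t : ℝ) (x u : Plane) :
    fderiv ℝ (movingPow k c v t) (t, x) ((1 : ℝ), u) =
      (2 * k + 2 : ℕ) * (‖x - c‖ ^ (2 * k) * inner ℝ (x - c) (u - v)) := by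
  have h1 : HasFDerivAt (fun q : ℝ × Plane => q.2 - c - (q.1 - t) • v)
      (ContinuousLinearMap.snd ℝ ℝ Plane - (ContinuousLinearMap.fst ℝ ℝ Plane).smulRight v)
      (t, x) :=
    (hasFDerivAt_snd.sub_const c).sub ((hasFDerivAt_fst.sub_const t).smul_const v)
  have h2 := (h1.norm_sq).pow (k + 1)
  have h3 : HasFDerivAt (movingPow k c v t) _ (t, x) := h2
  rw [h3.fderiv]
  simp only [smul_apply, ContinuousLinearMap.comp_apply,
    sub_apply, ContinuousLinearMap.coe_snd', innerSL_apply_apply,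
    ContinuousLinearMap.smulRight_apply, ContinuousLinearMap.coe_fst', sub_self, zero_smul,
    sub_zero, one_smul, smul_eq_mul, nsmul_eq_mul, Nat.add_sub_cancel]
  rw [pow_mul]
  push_cast
  ring

namespace IsConfinedFlow

variable {N : ℕ} {r₀ ρ R A B : ℝ} {a : Fin N → ℝ} {w : Fin N → Plane → ℝ}
  {φ ψ : ℝ → Plane → Plane} {z : Fin N → ℝ → Plane} {T : ℝ}

/-- The absolute moments of the `i`-th component of the vorticity at time `t`. -/
def moment (r₀ : ℝ) (w : Fin N → Plane → ℝ) (ψ : ℝ → Plane → Plane) (z : Fin N → ℝ → Plane)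
    (k : ℕ) (i : Fin N) (t : ℝ) : ℝ :=
  absMoment k (transported r₀ ψ (w i) t) (z i t)

/-- The rate of growth of the moments at time `t`. -/
def rate (r₀ : ℝ) (a : Fin N → ℝ) (w : Fin N → Plane → ℝ) (ψ : ℝ → Plane → Plane)
    (z : Fin N → ℝ → Plane) (k : ℕ) (i : Fin N) (t : ℝ) : ℝ :=
  momentRate k r₀ a (fun j => z j t) (fun j => transported r₀ ψ (w j) t) i

lemma continuousOn_center (H : IsConfinedFlow r₀ ρ R A B a w φ ψ z T) (i : Fin N) :
    ContinuousOn (z i) (Ici 0) := fun t ht => (H.deriv i t ht).continuousWithinAt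

lemma hasDerivWithinAt_moment (H : IsConfinedFlow r₀ ρ R A B a w φ ψ z T) (i : Fin N) (k : ℕ)
    {t : ℝ} (ht : t ∈ Icc 0 T) :
    HasDerivWithinAt (moment r₀ w ψ z (2 * k + 2) i)
      ((2 * k + 2 : ℕ) * rate r₀ a w ψ z (2 * k) i t) (Icc 0 T) t := by
  obtain ⟨σ, hσ1, hσ⟩ := H.sign i
  have hL := H.localized t ht
  set v := ∑ j with j ≠ i, a j • kerK (z i t - z j t) with hv
  have habs : ∀ s ∈ Icc 0 T, ∀ x, |transported r₀ ψ (w i) s x| = σ * transported r₀ ψ (w i) s x :=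
    fun s hs => abs_transported (H.flow.mapsTo_inv s hs.1) hσ
  have hmain := (H.flow.hasDerivWithinAt_integral (T := T) (t := t) (ρ := ρ) (R := R) (i := i)
    (z := z) H.continuousOn_center (fun s hs j x hx => (H.localized s hs).support j x hx) hL.pos
    hL.radius_le ht (fun j hj => hL.separated j i hj)
    (contDiff_movingPow k (z i t) v t)).const_mul σ
  have hval : σ * ∫ x, transported r₀ ψ (w i) t x * fderiv ℝ (movingPow k (z i t) v t) (t, x)
        ((1 : ℝ), velocity r₀ (transported r₀ ψ (fun x => ∑ j, w j x) t) x) =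
      (2 * k + 2 : ℕ) * rate r₀ a w ψ z (2 * k) i t := by
    rw [rate, momentRate, ← integral_const_mul, ← integral_const_mul]
    congr 1
    ext1 x
    rw [fderiv_movingPow, habs t ht x, transported_sum, relativeVelocity]
    ring
  rw [hval] at hmain
  set F : ℝ → ℝ := fun s => σ * ∫ x, transported r₀ ψ (w i) s x * movingPow k (z i t) v t (s, x)
    with hF
  have hFeq : ∀ s ∈ Icc 0 T,
      F s = ∫ x, |transported r₀ ψ (w i) s x| * movingPow k (z i t) v t (s, x) := by
    intro s hs
    rw [hF]
    simp only
    rw [← integral_const_mul]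
    congr 1
    ext1 x
    rw [habs s hs x]; ring
  have hA := hL.mass_nonneg i
  -- The path z i need not be smooth, so the test function follows its tangent line at time t. On
  -- the bounded support the two powers differ by O(|z i s - z i t - (s - t)v|) = o(s - t), which
  -- does not affect the derivative at t.
  have hzero : HasDerivWithinAt (fun s => moment r₀ w ψ z (2 * k + 2) i s - F s) 0 (Icc 0 T) t := by
    have hz := ((H.deriv i t ht.1).mono (Icc_subset_Ici_self : Icc 0 T ⊆ Ici 0))
    rw [← hv] at hz
    have hzo := hz.isLittleO
    have ht0 : moment r₀ w ψ z (2 * k + 2) i t - F t = 0 := by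
      rw [hFeq t ht, moment, absMoment, sub_eq_zero]
      congr 1
      ext1 x
      simp only [movingPow, sub_self, zero_smul, sub_zero]
      rw [← pow_mul]; ring_nf
    rw [hasDerivWithinAt_iff_isLittleO]
    simp only [smul_zero, sub_zero, ht0]
    refine Asymptotics.IsBigO.trans_isLittleO ?_ hzo
    set D := (2 * k + 2 : ℕ) * (ρ + 1) ^ (2 * k + 2 - 1) * A with hD
    refine Asymptotics.IsBigO.of_bound D ?_
    have e1 : ∀ᶠ s in 𝓝[Icc 0 T] t, ‖z i s - z i t - (s - t) • v‖ < 1 := by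
      have hc : ContinuousWithinAt (fun s => ‖z i s - z i t - (s - t) • v‖) (Icc 0 T) t := by
        have := ((H.continuousOn_center i) t ht.1).mono (Icc_subset_Ici_self : Icc 0 T ⊆ Ici 0)
        exact ((this.sub continuousWithinAt_const).sub (by fun_prop)).norm
      exact Tendsto.eventually_lt hc tendsto_const_nhds (by simp)
    filter_upwards [e1, self_mem_nhdsWithin] with s h1 hs
    have hLs := H.localized s hs
    rw [hFeq s hs, moment, absMoment, ← integral_sub
      (hLs.integrable_abs_mul i (h := fun x => ‖x - z i s‖ ^ (2 * k + 2)) (by fun_prop))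
      (hLs.integrable_abs_mul i (h := fun x => movingPow k (z i t) v t (s, x))
        ((contDiff_movingPow k (z i t) v t).continuous.comp (by fun_prop)))]
    set d := ‖z i s - z i t - (s - t) • v‖ with hd
    have hbi : Integrable fun x => |transported r₀ ψ (w i) s x| *
        ((2 * k + 2 : ℕ) * (ρ + 1) ^ (2 * k + 2 - 1) * d) :=
      (hLs.integrable i).abs.mul_const _
    refine (norm_integral_le_of_norm_le hbi (Eventually.of_forall fun x => ?_)).trans ?_
    · rw [← mul_sub, norm_mul, Real.norm_eq_abs, abs_abs]
      by_cases h0 : transported r₀ ψ (w i) s x = 0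
      · simp [h0]
      have hx : ‖x - z i s‖ ≤ ρ := hLs.support i x h0
      have e : x - z i t - (s - t) • v = (x - z i s) + (z i s - z i t - (s - t) • v) := by abel
      refine mul_le_mul_of_nonneg_left ?_ (abs_nonneg _)
      have hy : ‖x - z i t - (s - t) • v‖ ≤ ρ + 1 := by
        rw [e]; exact (norm_add_le _ _).trans (by linarith)
      have e2 : movingPow k (z i t) v t (s, x) = ‖x - z i t - (s - t) • v‖ ^ (2 * k + 2) := by
        rw [movingPow, ← pow_mul]; ring_nf
      rw [e2, Real.norm_eq_abs]
      refine (abs_pow_sub_pow_le (norm_nonneg _) (norm_nonneg _) (hx.trans (by linarith)) hy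
        _).trans ?_
      have hρ := hL.radius_nonneg
      gcongr
      refine (abs_norm_sub_norm_le _ _).trans_eq ?_
      rw [e, hd, ← norm_neg]; congr 1; abel
    · rw [integral_mul_const]
      have hm : ∫ x, |transported r₀ ψ (w i) s x| ≤ A := hLs.abs_mass i
      have hρ := hL.radius_nonneg
      calc _ ≤ A * ((2 * k + 2 : ℕ) * (ρ + 1) ^ (2 * k + 2 - 1) * d) := by gcongr
        _ = _ := by rw [hD]; ring
  have := hzero.add hmain
  refine (this.congr_of_eventuallyEq ?_ ?_).congr_deriv (by simp)
  · exact Eventually.of_forall fun s => by simp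
  · simp

end IsConfinedFlow

/-! ### Growth of moments and trajectories along a confined flow. -/

lemma _root_.HasDerivWithinAt.Ici_of_Icc {f : ℝ → ℝ} {f' T t : ℝ}
    (h : HasDerivWithinAt f f' (Icc 0 T) t) (ht : t ∈ Ico 0 T) : HasDerivWithinAt f f' (Ici t) t := by
  apply h.mono_of_mem_nhdsWithin
  filter_upwards [Icc_mem_nhdsGE ht.2] with s hs
  exact ⟨ht.1.trans hs.1, hs.2⟩

/-- A barrier argument with an exponentially growing barrier. -/
lemma le_mul_exp_of_hasDerivWithinAt {f f' : ℝ → ℝ} {T K b : ℝ}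
    (hf : ∀ t ∈ Icc 0 T, HasDerivWithinAt f (f' t) (Icc 0 T) t) (h0 : f 0 ≤ b)
    (hb : ∀ t ∈ Ico 0 T, f t = b * Real.exp (K * t) → f' t < K * (b * Real.exp (K * t))) :
    ∀ t ∈ Icc 0 T, f t ≤ b * Real.exp (K * t) := by
  have hB : ∀ t, HasDerivAt (fun t => b * Real.exp (K * t)) (K * (b * Real.exp (K * t))) t := by
    intro t
    have := (((hasDerivAt_id t).const_mul K).exp).const_mul b
    refine this.congr_deriv ?_
    simp only [id]; ring
  refine image_le_of_deriv_right_lt_deriv_boundary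
    (fun t ht => (hf t ht).continuousWithinAt)
    (fun t ht => (hf t (Ico_subset_Icc_self ht)).Ici_of_Icc ht) (by simpa using h0) hB hb

/-- The Lipschitz constant of the field generated by the other vortices. -/
def lipConst (N : ℕ) (R A : ℝ) : ℝ := 2 / R ^ 2 * N * A

/-- The ratio between the external drift and the scale of the second moments. -/
def driftConst (N : ℕ) (R A : ℝ) : ℝ := 2 / R ^ 2 * N * (1 + A) + 1

/-- The exponential rate of growth of the second moments. -/
def growthConst (N : ℕ) (R A : ℝ) : ℝ :=
  N * (2 * (lipConst N R A + driftConst N R A * (1 + A))) + 1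

lemma lipConst_nonneg {N : ℕ} {R A : ℝ} (hA : 0 ≤ A) : 0 ≤ lipConst N R A := by
  unfold lipConst; positivity

lemma driftConst_pos {N : ℕ} {R A : ℝ} (hA : 0 ≤ A) : 0 < driftConst N R A := by
  unfold driftConst; positivity

lemma growthConst_pos {N : ℕ} {R A : ℝ} (hA : 0 ≤ A) : 0 < growthConst N R A := by
  have := lipConst_nonneg (N := N) (R := R) hA
  have := driftConst_pos (N := N) (R := R) hA
  unfold growthConst; positivity

/-- First moments are at most (1 + A)μ by interpolation with the second moments; the summand 1 in
`driftConst` absorbs the axisymmetric error, as δ ≤ μ. -/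
lemma IsLocalized.externalDrift_le {N : ℕ} {r₀ ρ R A B s δ μ : ℝ} {a : Fin N → ℝ}
    {c : Fin N → Plane} {w : Fin N → Plane → ℝ} (H : IsLocalized r₀ ρ R A B a c w)
    (hδ : axisymmetricError N r₀ A B s ≤ δ) (hδμ : δ ≤ μ) (hμ : 0 < μ)
    (h : ∀ i, absMoment 2 (w i) (c i) ≤ μ ^ 2) :
    externalDrift r₀ R A B s c w ≤ driftConst N R A * μ := by
  have hR := H.pos
  have h1 : ∑ j, absMoment 1 (w j) (c j) ≤ ∑ _j : Fin N, (1 + A) * μ :=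
    Finset.sum_le_sum fun j _ => H.absMoment_one_le j hμ (h j)
  simp only [Finset.sum_const, Finset.card_univ, Fintype.card_fin, nsmul_eq_mul] at h1
  have h2 : 2 / R ^ 2 * ∑ j, absMoment 1 (w j) (c j) ≤ 2 / R ^ 2 * (N * ((1 + A) * μ)) := by gcongr
  rw [externalDrift, driftConst]
  linarith [show (2 / R ^ 2 * N * (1 + A) + 1) * μ = 2 / R ^ 2 * (N * ((1 + A) * μ)) + μ by ring]

namespace IsConfinedFlow

variable {N : ℕ} {r₀ ρ R A B : ℝ} {a : Fin N → ℝ} {w : Fin N → Plane → ℝ}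
  {φ ψ : ℝ → Plane → Plane} {z : Fin N → ℝ → Plane} {T : ℝ}

lemma exists_sign (H : IsConfinedFlow r₀ ρ R A B a w φ ψ z T) (i : Fin N) {t : ℝ}
    (ht : 0 ≤ t) :
    ∃ σ : ℝ, |σ| = 1 ∧ ∀ x, transported r₀ ψ (w i) t x = σ * |transported r₀ ψ (w i) t x| := by
  obtain ⟨σ, hσ1, hσ⟩ := H.sign i
  refine ⟨σ, hσ1, fun x => ?_⟩
  rw [abs_transported (H.flow.mapsTo_inv t ht) hσ x, ← mul_assoc, ← sq, ← sq_abs, hσ1]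
  ring

/-- The second moments remain of the order of the square of the axisymmetric error. -/
lemma secondMoment_le (H : IsConfinedFlow r₀ ρ R A B a w φ ψ z T) (hA : 0 ≤ A) {s δ : ℝ}
    (hs : 0 < s) (hδ0 : 0 < δ) (hδ : axisymmetricError N r₀ A B s ≤ δ)
    (h0 : ∑ i, moment r₀ w ψ z 2 i 0 ≤ δ ^ 2) {t : ℝ} (ht : t ∈ Icc 0 T) (i : Fin N) :
    moment r₀ w ψ z 2 i t ≤ (δ * Real.exp (growthConst N R A * t)) ^ 2 := by
  have hG := growthConst_pos (N := N) (R := R) hA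
  have hD := driftConst_pos (N := N) (R := R) hA
  have hder : ∀ t ∈ Icc 0 T, HasDerivWithinAt (fun t => ∑ i, moment r₀ w ψ z 2 i t)
      (∑ i, 2 * rate r₀ a w ψ z 0 i t) (Icc 0 T) t := by
    intro t ht
    refine HasDerivWithinAt.fun_sum fun i _ => ?_
    simpa using H.hasDerivWithinAt_moment i 0 ht
  have hsum := le_mul_exp_of_hasDerivWithinAt (K := growthConst N R A) hder h0
    (fun t ht heq => by
      have hL := H.localized t (Ico_subset_Icc_self ht)
      -- At a time of contact the sum of the second moments equals the barrier μ², hence every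
      -- single one is at most μ². All the terms in the derivative are then multiples of μ², and the
      -- summand 1 in `growthConst` makes the inequality strict.
      set μ := δ * Real.exp (growthConst N R A * t / 2) with hμ
      have hμ0 : 0 < μ := by positivity
      have hδμ : δ ≤ μ := by
        have : 1 ≤ Real.exp (growthConst N R A * t / 2) :=
          Real.one_le_exp (by have := ht.1; positivity)
        exact le_mul_of_one_le_right hδ0.le this
      have hμ2 : δ ^ 2 * Real.exp (growthConst N R A * t) = μ ^ 2 := by
        rw [hμ, mul_pow, ← Real.exp_nat_mul]; congr 2; push_cast; ring
      rw [hμ2] at heq ⊢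
      have hM : ∀ i, moment r₀ w ψ z 2 i t ≤ μ ^ 2 := fun i => by
        rw [← heq]
        exact Finset.single_le_sum (f := fun i => moment r₀ w ψ z 2 i t)
          (fun j _ => absMoment_nonneg _ _ _) (Finset.mem_univ i)
      have hdr := hL.externalDrift_le hδ hδμ hμ0 hM
      have hrate : ∀ i, 2 * rate r₀ a w ψ z 0 i t ≤
          2 * (lipConst N R A + driftConst N R A * (1 + A)) * μ ^ 2 := by
        intro i
        obtain ⟨σ, -, hσ⟩ := H.exists_sign i ht.1
        have h1 := (abs_le.mp (hL.abs_momentRate_zero_le hs i hσ)).2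
        have hl := lipConst_nonneg (N := N) (R := R) hA
        have hm1 := hL.absMoment_one_le i hμ0 (hM i)
        have h2 : 2 / R ^ 2 * N * A * absMoment 2 (transported r₀ ψ (w i) t) (z i t) ≤
            lipConst N R A * μ ^ 2 := by
          have := hM i
          rw [moment] at this
          unfold lipConst at hl ⊢
          gcongr
        have h3 : externalDrift r₀ R A B s (fun j => z j t) (fun j => transported r₀ ψ (w j) t) *
            absMoment 1 (transported r₀ ψ (w i) t) (z i t) ≤
            (driftConst N R A * μ) * ((1 + A) * μ) := by
          have := absMoment_nonneg 1 (transported r₀ ψ (w i) t) (z i t)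
          gcongr
        rw [rate]
        nlinarith
      refine (Finset.sum_le_sum fun i _ => hrate i).trans_lt ?_
      simp only [Finset.sum_const, Finset.card_univ, Fintype.card_fin, nsmul_eq_mul]
      rw [growthConst]
      nlinarith [sq_pos_of_pos hμ0]) t ht
  have h1 : moment r₀ w ψ z 2 i t ≤ ∑ i, moment r₀ w ψ z 2 i t :=
    Finset.single_le_sum (f := fun i => moment r₀ w ψ z 2 i t)
      (fun j _ => absMoment_nonneg _ _ _) (Finset.mem_univ i)
  refine (h1.trans hsum).trans ?_
  rw [mul_pow]
  gcongr
  exact le_self_pow₀ (Real.one_le_exp (mul_nonneg hG.le ht.1)) two_ne_zero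

/-- Growth of a high moment, at scale `l`. -/
lemma moment_le (H : IsConfinedFlow r₀ ρ R A B a w φ ψ z T) (hA : 0 ≤ A) {s : ℝ}
    (hs : 0 < s) (i : Fin N) {k p : ℕ} (hp : 1 ≤ p) (hpk : p ≤ 2 * k) {l : ℝ} (hl : 0 < l)
    (hdrift : ∀ t ∈ Icc 0 T, externalDrift r₀ R A B s (fun j => z j t)
      (fun j => transported r₀ ψ (w j) t) ≤ l)
    (h1 : ∀ t ∈ Icc 0 T, 2 * moment r₀ w ψ z 1 i t ≤ l ^ 3)
    (h2 : ∀ t ∈ Icc 0 T, (2 * k : ℕ) * 2 ^ p * moment r₀ w ψ z p i t ≤ l ^ (p + 2))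
    (h0 : moment r₀ w ψ z (2 * k + 2) i 0 ≤ A * l ^ (2 * k + 2)) {t : ℝ} (ht : t ∈ Icc 0 T) :
    moment r₀ w ψ z (2 * k + 2) i t ≤
      (2 * A + 1) * l ^ (2 * k + 2) *
        Real.exp ((2 * k + 2 : ℕ) * (lipConst N R A + 4) * t) := by
  have hLip := lipConst_nonneg (N := N) (R := R) hA
  -- Adding the constant A l^(2k+2) to the moment makes its rate proportional to the quantity
  -- itself. The factor 2A + 1 instead of 2A keeps the barrier positive when A = 0, and the rate 4
  -- instead of 3 makes the inequality strict.
  have hder : ∀ t ∈ Icc 0 T, HasDerivWithinAt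
      (fun t => moment r₀ w ψ z (2 * k + 2) i t + A * l ^ (2 * k + 2))
      ((2 * k + 2 : ℕ) * rate r₀ a w ψ z (2 * k) i t) (Icc 0 T) t :=
    fun t ht => (H.hasDerivWithinAt_moment i k ht).add_const _
  have hlk : 0 < l ^ (2 * k + 2) := by positivity
  have := le_mul_exp_of_hasDerivWithinAt (b := (2 * A + 1) * l ^ (2 * k + 2))
    (K := (2 * k + 2 : ℕ) * (lipConst N R A + 4)) hder (by linarith)
    (fun t ht heq => by
      have ht' := Ico_subset_Icc_self ht
      have hL := H.localized t ht'
      obtain ⟨σ, hσ1, hσ⟩ := H.exists_sign i ht.1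
      have hr := (abs_le.mp (hL.abs_momentRate_le hs i hσ1.le hσ hp hpk hl (hdrift t ht')
        (h1 t ht') (h2 t ht'))).2
      rw [moment] at heq
      rw [heq] at hr
      set Q := (2 * A + 1) * l ^ (2 * k + 2) *
        Real.exp ((2 * k + 2 : ℕ) * (lipConst N R A + 4) * t) with hQ
      have hQ0 : 0 < Q := by positivity
      have hr' : rate r₀ a w ψ z (2 * k) i t ≤ (lipConst N R A + 3) * Q := hr
      have hk : (0 : ℝ) < (2 * k + 2 : ℕ) := by positivity
      calc (2 * k + 2 : ℕ) * rate r₀ a w ψ z (2 * k) i t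
          ≤ (2 * k + 2 : ℕ) * ((lipConst N R A + 3) * Q) := by gcongr
        _ < (2 * k + 2 : ℕ) * ((lipConst N R A + 4) * Q) := by gcongr; norm_num
        _ = _ := by ring) t ht
  have hAl : 0 ≤ A * l ^ (2 * k + 2) := by positivity
  linarith

/-- A trajectory starting close to the center stays close to it. -/
lemma trajectory_le (H : IsConfinedFlow r₀ ρ R A B a w φ ψ z T) (hA : 0 ≤ A) {s : ℝ}
    (hs : 0 < s) (i : Fin N) {y : Plane} (hy : y ∈ halfPlane r₀)
    (hyρ : ∀ t ∈ Icc 0 T, ‖φ t y - z i t‖ ≤ ρ) {l : ℝ} (hl : 0 < l)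
    (hdrift : ∀ t ∈ Icc 0 T, externalDrift r₀ R A B s (fun j => z j t)
      (fun j => transported r₀ ψ (w j) t) ≤ l)
    (h1 : ∀ t ∈ Icc 0 T, 2 * moment r₀ w ψ z 1 i t ≤ l ^ 3) {k : ℕ} {s' : ℝ} (hs' : 0 < s')
    (h2 : ∀ t ∈ Icc 0 T, 2 * Real.pi * B * s' + moment r₀ w ψ z k i t / (l / 2) ^ k / s' ≤ l)
    (h0 : ‖φ 0 y - z i 0‖ ≤ l) {t : ℝ} (ht : t ∈ Icc 0 T) :
    ‖φ t y - z i t‖ ≤ l * Real.exp ((lipConst N R A + 4) * t) := by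
  have hLip := lipConst_nonneg (N := N) (R := R) hA
  have hder : ∀ t ∈ Icc 0 T, HasDerivWithinAt (fun t => ‖φ t y - z i t‖ ^ 2)
      (2 * inner ℝ (φ t y - z i t) (relativeVelocity r₀ a (fun j => z j t)
        (fun j => transported r₀ ψ (w j) t) i (φ t y))) (Icc 0 T) t := by
    intro t ht
    have h1 := (H.flow.trajectory y hy t ht.1).sub (H.deriv i t ht.1)
    rw [transported_sum] at h1
    exact h1.norm_sq.mono Icc_subset_Ici_self
  have := le_mul_exp_of_hasDerivWithinAt (b := l ^ 2) (K := 2 * (lipConst N R A + 4)) hder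
    (by gcongr)
    (fun t ht heq => by
      have ht' := Ico_subset_Icc_self ht
      -- The barrier never goes below l², so the radial estimate is needed only at distance at least
      -- l, where it is available.
      have hlt : l ≤ ‖φ t y - z i t‖ := by
        apply le_of_sq_le_sq _ (norm_nonneg _)
        rw [heq]
        exact le_mul_of_one_le_right (by positivity)
          (Real.one_le_exp (by have := ht.1; positivity))
      have hr := (H.localized t ht').inner_relativeVelocity_le hs i (hyρ t ht') hl hlt
        (hdrift t ht') (h1 t ht') hs' (h2 t ht')
      rw [heq] at hr
      have hpos : 0 < l ^ 2 * Real.exp (2 * (lipConst N R A + 4) * t) := by positivity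
      have hr' := mul_le_mul_of_nonneg_left hr (zero_le_two (α := ℝ))
      refine hr'.trans_lt ?_
      rw [← lipConst, ← mul_assoc]
      gcongr
      norm_num) t ht
  apply le_of_sq_le_sq _ (by positivity)
  refine this.trans_eq ?_
  rw [mul_pow, ← Real.exp_nat_mul]
  congr 2; push_cast; ring

end IsConfinedFlow

/-- The relations between the time `T`, the size `ε` of the initial supports, the size `δ` of the
axisymmetric error, and the scales `l₁ ≤ l₂ ≤ l₃` on which the vorticity is successively
localized. -/
structure IsRegime (N : ℕ) (R A B T ε δ l₁ l₂ l₃ s' : ℝ) (k n : ℕ) : Prop where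
  eps_pos : 0 < ε
  delta_pos : 0 < δ
  l₁_pos : 0 < l₁
  s'_pos : 0 < s'
  l₁_le : l₁ ≤ l₂
  l₂_le : l₂ ≤ l₃
  eps_le : ε ≤ l₁
  second : N * (A * ε ^ 2) ≤ δ ^ 2
  k_pos : 1 ≤ k
  k_lt : k + 1 ≤ n
  drift : driftConst N R A * (δ * Real.exp (growthConst N R A * T)) ≤ l₁
  first : 4 * k * ((1 + A) * (δ * Real.exp (growthConst N R A * T))) ≤ l₁ ^ 3
  intermediate : (2 * n : ℕ) * 2 ^ (2 * k + 2) * ((2 * A + 1) * l₁ ^ (2 * k + 2) *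
    Real.exp ((2 * k + 2 : ℕ) * (lipConst N R A + 4) * T)) ≤ l₂ ^ (2 * k + 2 + 2)
  outer : 2 * Real.pi * B * s' + (2 * A + 1) * l₂ ^ (2 * n + 2) *
    Real.exp ((2 * n + 2 : ℕ) * (lipConst N R A + 4) * T) / (l₃ / 2) ^ (2 * n + 2) / s' ≤ l₃

/-- In the regime above, the trajectories starting in the supports stay at distance of order `l₃`
from the point vortices. -/
lemma IsConfinedFlow.norm_trajectory_sub_le {N : ℕ} {r₀ ρ R A B T T' ε δ l₁ l₂ l₃ s' : ℝ}
    {k n : ℕ} {a : Fin N → ℝ} {w : Fin N → Plane → ℝ} {φ ψ : ℝ → Plane → Plane}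
    {z : Fin N → ℝ → Plane} (H : IsConfinedFlow r₀ ρ R A B a w φ ψ z T') (hT : T' ≤ T)
    (hA : 0 ≤ A) (hreg : IsRegime N R A B T ε δ l₁ l₂ l₃ s' k n)
    (herr : axisymmetricError N r₀ A B ε ≤ δ)
    (hinit : ∀ i x, transported r₀ ψ (w i) 0 x ≠ 0 → ‖x - z i 0‖ ≤ ε)
    (i : Fin N) {y : Plane} (hy : y ∈ halfPlane r₀)
    (hyρ : ∀ t ∈ Icc 0 T', ‖φ t y - z i t‖ ≤ ρ) (hy0 : ‖φ 0 y - z i 0‖ ≤ ε)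
    {t : ℝ} (ht : t ∈ Icc 0 T') :
    ‖φ t y - z i t‖ ≤ l₃ * Real.exp ((lipConst N R A + 4) * T) := by
  have hG := (growthConst_pos (N := N) (R := R) hA).le
  have hLip := lipConst_nonneg (N := N) (R := R) hA
  have hl₁ := hreg.l₁_pos
  have hl₂ : 0 < l₂ := hl₁.trans_le hreg.l₁_le
  have hl₃ : 0 < l₃ := hl₂.trans_le hreg.l₂_le
  have hε := hreg.eps_pos
  have hδ := hreg.delta_pos
  have hT0 : (0 : ℝ) ∈ Icc 0 T' := ⟨le_rfl, ht.1.trans ht.2⟩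
  set μ := δ * Real.exp (growthConst N R A * T) with hμ
  have hμ0 : 0 < μ := by positivity
  have hm0 : ∀ j m, IsConfinedFlow.moment r₀ w ψ z m j 0 ≤ A * ε ^ m := by
    intro j m
    have hL := H.localized 0 hT0
    refine le_trans (b := ∫ x, |transported r₀ ψ (w j) 0 x| * ε ^ m) ?_ ?_
    · apply integral_mono (hL.integrable_abs_mul j (h := fun x => ‖x - z j 0‖ ^ m) (by fun_prop))
        ((hL.integrable j).abs.mul_const _)
      intro x
      by_cases h : transported r₀ ψ (w j) 0 x = 0
      · simp [h]
      · have := hinit j x h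
        simp only
        gcongr
    · rw [integral_mul_const]
      exact mul_le_mul_of_nonneg_right (hL.abs_mass j) (by positivity)
  have hM2 : ∀ t ∈ Icc 0 T', ∀ j, IsConfinedFlow.moment r₀ w ψ z 2 j t ≤ μ ^ 2 := by
    intro t ht j
    have h0 : ∑ j, IsConfinedFlow.moment r₀ w ψ z 2 j 0 ≤ δ ^ 2 := by
      refine (Finset.sum_le_sum fun j _ => hm0 j 2).trans ?_
      simpa using hreg.second
    refine (H.secondMoment_le hA hε hδ herr h0 ht j).trans ?_
    rw [hμ]
    have : t ≤ T := ht.2.trans hT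
    gcongr
  have hM1 : ∀ t ∈ Icc 0 T', ∀ j, IsConfinedFlow.moment r₀ w ψ z 1 j t ≤ (1 + A) * μ :=
    fun t ht j => (H.localized t ht).absMoment_one_le j hμ0 (hM2 t ht j)
  have hδμ : δ ≤ μ := le_mul_of_one_le_right hδ.le (Real.one_le_exp
    (mul_nonneg hG ((ht.1.trans ht.2).trans hT)))
  have hdrift : ∀ t ∈ Icc 0 T', externalDrift r₀ R A B ε (fun j => z j t)
      (fun j => transported r₀ ψ (w j) t) ≤ l₁ := fun t ht =>
    ((H.localized t ht).externalDrift_le herr hδμ hμ0 (hM2 t ht)).trans hreg.drift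
  have hk : (1 : ℝ) ≤ k := by exact_mod_cast hreg.k_pos
  have hAμ : 0 ≤ (1 + A) * μ := by positivity
  have h1 : ∀ t ∈ Icc 0 T', 2 * IsConfinedFlow.moment r₀ w ψ z 1 i t ≤ l₁ ^ 3 := by
    intro t ht
    have := hM1 t ht i
    have := hreg.first
    nlinarith
  -- First stage, with p = 1: both conditions of `moment_le` concern the first moment, and the
  -- factor 4k in `first` covers both.
  have hstep1 : ∀ t ∈ Icc 0 T', IsConfinedFlow.moment r₀ w ψ z (2 * k + 2) i t ≤
      (2 * A + 1) * l₁ ^ (2 * k + 2) *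
        Real.exp ((2 * k + 2 : ℕ) * (lipConst N R A + 4) * T) := by
    intro t ht
    refine (H.moment_le hA hε i (p := 1) le_rfl (by have := hreg.k_pos; omega) hl₁ hdrift h1
      (fun t ht => ?_) ((hm0 i _).trans ?_) ht).trans ?_
    · have h := hM1 t ht i
      have h' := hreg.first
      push_cast
      calc 2 * (k : ℝ) * 2 ^ 1 * IsConfinedFlow.moment r₀ w ψ z 1 i t
          ≤ 2 * (k : ℝ) * 2 ^ 1 * ((1 + A) * μ) := by gcongr
        _ = 4 * k * ((1 + A) * μ) := by ring
        _ ≤ _ := h'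
    · have := hreg.eps_le
      gcongr
    · have : t ≤ T := ht.2.trans hT
      gcongr
  have hpow3 : l₁ ^ 3 ≤ l₂ ^ 3 := by have := hreg.l₁_le; gcongr
  -- Second stage, with p = 2k+2: the factor 2n is paid by the moment just bounded.
  have hstep2 : ∀ t ∈ Icc 0 T', IsConfinedFlow.moment r₀ w ψ z (2 * n + 2) i t ≤
      (2 * A + 1) * l₂ ^ (2 * n + 2) *
        Real.exp ((2 * n + 2 : ℕ) * (lipConst N R A + 4) * T) := by
    intro t ht
    refine (H.moment_le hA hε i (p := 2 * k + 2) (by omega) (by have := hreg.k_lt; omega) hl₂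
      (fun t ht => (hdrift t ht).trans hreg.l₁_le) (fun t ht => (h1 t ht).trans hpow3)
      (fun t ht => ?_) ((hm0 i _).trans ?_) ht).trans ?_
    · refine le_trans ?_ hreg.intermediate
      have := hstep1 t ht
      gcongr
    · have := hreg.eps_le.trans hreg.l₁_le
      gcongr
    · have : t ≤ T := ht.2.trans hT
      gcongr
  have h13 : l₁ ≤ l₃ := hreg.l₁_le.trans hreg.l₂_le
  refine (H.trajectory_le hA hε i hy hyρ hl₃ (fun t ht => (hdrift t ht).trans h13)
    (fun t ht => (h1 t ht).trans (by gcongr)) (k := 2 * n + 2) hreg.s'_pos (fun t ht => ?_)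
    (hy0.trans (hreg.eps_le.trans h13)) ht).trans ?_
  · refine le_trans ?_ hreg.outer
    have := hstep2 t ht
    have := hreg.s'_pos
    gcongr
  · have : t ≤ T := ht.2.trans hT
    gcongr

/-! ### The continuity argument -/

/-- The step hypothesis is given the property at all times up to t, not only at t, because the
moment bounds integrate the dynamics from time 0. -/
lemma forall_mem_Icc_of_continuation {P : ℝ → Prop} {T : ℝ} (h0 : P 0)
    (hcl : IsClosed {t | t ∈ Icc 0 T ∧ P t})
    (hstep : ∀ t ∈ Ico 0 T, (∀ s ∈ Icc 0 t, P s) → ∀ᶠ s in 𝓝[>] t, P s) :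
    ∀ t ∈ Icc 0 T, P t := by
  set S : Set ℝ := {t | ∀ s ∈ Icc 0 t, P s} with hS
  suffices Icc 0 T ⊆ S from fun t ht => this ht t ⟨ht.1, le_rfl⟩
  refine IsClosed.Icc_subset_of_forall_exists_gt ?_ ?_ ?_
  · refine isClosed_of_closure_subset fun t ht => ?_
    have htI : t ∈ Icc 0 T := closure_minimal inter_subset_right isClosed_Icc ht
    have htP : P t := by
      have hsub : S ∩ Icc 0 T ⊆ {t | t ∈ Icc 0 T ∧ P t} :=
        fun s hs => ⟨hs.2, hs.1 s ⟨hs.2.1, le_rfl⟩⟩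
      exact (closure_minimal hsub hcl ht).2
    refine ⟨fun s hs => ?_, htI⟩
    rcases hs.2.eq_or_lt with rfl | hlt
    · exact htP
    · obtain ⟨t', ht', hS'⟩ := mem_closure_iff.mp ht (Ioi s) isOpen_Ioi hlt
      exact hS'.1 s ⟨hs.1, le_of_lt ht'⟩
  · intro s hs
    have : s = 0 := le_antisymm hs.2 hs.1
    rwa [this]
  · intro t ht y hy
    have hy : t < y := hy
    obtain ⟨u, hu, hPu⟩ := (mem_nhdsGT_iff_exists_Ioo_subset).mp (hstep t ht.2 ht.1)
    have hu : t < u := hu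
    obtain ⟨m, hm1, hm2⟩ := exists_between (lt_min hy hu)
    refine ⟨m, fun s hs => ?_, hm1, (hm2.trans_le (min_le_left _ _)).le⟩
    rcases le_or_gt s t with h | h
    · exact ht.1 s ⟨hs.1, h⟩
    · exact hPu ⟨h, hs.2.trans_lt (hm2.trans_le (min_le_right _ _))⟩

/-! ### From confined trajectories to localized densities. -/

lemma isOpen_halfPlane (r₀ : ℝ) : IsOpen (halfPlane r₀) := by
  have : Continuous fun x : Plane => r₀ + x 1 := by fun_prop
  exact isOpen_lt continuous_const this

/-- The inverse flow is controlled only on the half-plane, so it is replaced outside by a constant,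
which the indicator hides. -/
lemma measurable_transported {r₀ : ℝ} {ψ : ℝ → Plane → Plane} {w : Plane → ℝ} {t : ℝ}
    (hψ : ContinuousOn (ψ t) (halfPlane r₀)) (hw : Measurable w) :
    Measurable (transported r₀ ψ w t) := by
  classical
  have hS := (isOpen_halfPlane r₀).measurableSet
  have hψ' : Measurable ((halfPlane r₀).piecewise (ψ t) fun _ => 0) :=
    hψ.measurable_piecewise continuousOn_const hS
  set ψ' := (halfPlane r₀).piecewise (ψ t) fun _ => 0
  have e : transported r₀ ψ w t =
      (halfPlane r₀).indicator fun x => (r₀ + x 1) / (r₀ + ψ' x 1) * w (ψ' x) := by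
    ext x
    by_cases hx : x ∈ halfPlane r₀
    · simp [transported, hx, ψ']
    · simp [transported, hx]
  rw [e]
  have h1 : Measurable fun x : Plane => x 1 := by fun_prop
  exact (((h1.const_add _).div ((h1.comp hψ').const_add _)).mul (hw.comp hψ')).indicator hS

lemma IsEulerFlow.transported_zero {r₀ : ℝ} {w₀ w : Plane → ℝ} {φ ψ : ℝ → Plane → Plane}
    (h : IsEulerFlow r₀ w₀ φ ψ) (hw : ∀ x, w x ≠ 0 → x ∈ halfPlane r₀) :
    transported r₀ ψ w 0 = w := by
  ext x
  by_cases hx : x ∈ halfPlane r₀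
  · have e : ψ 0 x = x := by
      have := h.left_inv 0 le_rfl x hx
      rwa [h.init x hx] at this
    have h0 : 0 < r₀ + x 1 := hx
    simp only [transported, indicator_of_mem hx, e]
    rw [div_self h0.ne', one_mul]
  · simp only [transported, indicator_of_notMem hx]
    by_contra hne
    exact hx (hw x fun h => hne h.symm)

lemma norm_sub_le_of_transported_ne_zero {r₀ ρ t : ℝ} {w₀ w : Plane → ℝ}
    {φ ψ : ℝ → Plane → Plane} {c : Plane} (h : IsEulerFlow r₀ w₀ φ ψ) (ht : 0 ≤ t)
    (hρ : ∀ y ∈ tsupport w, ‖φ t y - c‖ ≤ ρ) {x : Plane} (hx : transported r₀ ψ w t x ≠ 0) :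
    x ∈ halfPlane r₀ ∧ ψ t x ∈ tsupport w ∧ ‖x - c‖ ≤ ρ := by
  have hxH : x ∈ halfPlane r₀ := by
    by_contra hn
    exact hx (by simp [transported, hn])
  have hw : w (ψ t x) ≠ 0 := by
    intro h0
    exact hx (by simp [transported, hxH, h0])
  have hs : ψ t x ∈ tsupport w := subset_tsupport _ hw
  refine ⟨hxH, hs, ?_⟩
  have := hρ _ hs
  rwa [h.right_inv t ht x hxH] at this

/-- An Euler flow with concentrated initial data that follows well separated point vortices, far
from the axis up to time `T`. -/
structure IsVortexSetting {N : ℕ} (r₀ ρ R A M ε : ℝ) (a : Fin N → ℝ) (z₀ : Fin N → Plane)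
    (w : Fin N → Plane → ℝ) (φ ψ : ℝ → Plane → Plane) (z : Fin N → ℝ → Plane) (T : ℝ) : Prop where
  data : IsConcentratedData M ε a z₀ w
  flow : IsEulerFlow r₀ (fun x => ∑ i, w i x) φ ψ
  motion : IsPointVortexMotion a z₀ z
  separated : ∀ t, 0 ≤ t → ∀ i j, i ≠ j → R ≤ ‖z i t - z j t‖
  pos : 0 < R
  radius_pos : 0 < ρ
  radius_le : ρ ≤ R / 8
  mass_le : ∀ i, |a i| ≤ A
  axis : 0 < r₀
  far : ∀ t ∈ Icc 0 T, ∀ i, ‖z i t‖ + ρ ≤ r₀ / 2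
  eps_pos : 0 < ε
  eps_le : ε ≤ ρ

namespace IsVortexSetting

variable {N : ℕ} {r₀ ρ R A M ε T : ℝ} {a : Fin N → ℝ} {z₀ : Fin N → Plane}
  {w : Fin N → Plane → ℝ} {φ ψ : ℝ → Plane → Plane} {z : Fin N → ℝ → Plane}

lemma mono (H : IsVortexSetting r₀ ρ R A M ε a z₀ w φ ψ z T) {T' : ℝ} (h : T' ≤ T) :
    IsVortexSetting r₀ ρ R A M ε a z₀ w φ ψ z T' :=
  { H with far := fun t ht => H.far t ⟨ht.1, ht.2.trans h⟩ }

lemma norm_le_of_mem_tsupport (H : IsVortexSetting r₀ ρ R A M ε a z₀ w φ ψ z T) (i : Fin N)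
    {y : Plane} (hy : y ∈ tsupport (w i)) : ‖y - z i 0‖ ≤ ε := by
  have := H.data.support i hy
  rw [Metric.mem_ball, dist_eq_norm] at this
  rw [H.motion.init]
  exact this.le

lemma norm_le_half (H : IsVortexSetting r₀ ρ R A M ε a z₀ w φ ψ z T) {t : ℝ} (ht : t ∈ Icc 0 T)
    (i : Fin N) {x : Plane} (hx : ‖x - z i t‖ ≤ ρ) : ‖x‖ ≤ r₀ / 2 := by
  have := H.far t ht i
  calc ‖x‖ = ‖(x - z i t) + z i t‖ := by simp
    _ ≤ ‖x - z i t‖ + ‖z i t‖ := norm_add_le _ _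
    _ ≤ _ := by linarith

lemma mem_halfPlane (H : IsVortexSetting r₀ ρ R A M ε a z₀ w φ ψ z T) (hT : 0 ≤ T) (i : Fin N)
    {y : Plane} (hy : y ∈ tsupport (w i)) : y ∈ halfPlane r₀ := by
  have h := H.norm_le_half ⟨le_rfl, hT⟩ i ((H.norm_le_of_mem_tsupport i hy).trans H.eps_le)
  have h1 := abs_le.mp ((abs_apply_le_norm y 1).trans h)
  have := H.axis
  change 0 < r₀ + y 1
  linarith

lemma transported_zero (H : IsVortexSetting r₀ ρ R A M ε a z₀ w φ ψ z T) (hT : 0 ≤ T)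
    (i : Fin N) : transported r₀ ψ (w i) 0 = w i :=
  H.flow.transported_zero fun _ hx => H.mem_halfPlane hT i (subset_tsupport _ hx)

lemma exists_sign (H : IsVortexSetting r₀ ρ R A M ε a z₀ w φ ψ z T) (i : Fin N) :
    ∃ σ : ℝ, |σ| = 1 ∧ ∀ x, |w i x| = σ * w i x := by
  rcases H.data.sign i with h | h
  · exact ⟨1, by simp, fun x => by rw [abs_of_nonneg (h x), one_mul]⟩
  · exact ⟨-1, by simp, fun x => by rw [abs_of_nonpos (h x)]; ring⟩

lemma continuousOn_center (H : IsVortexSetting r₀ ρ R A M ε a z₀ w φ ψ z T) (i : Fin N) :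
    ContinuousOn (z i) (Ici 0) := fun t ht => (H.motion.deriv i t ht).continuousWithinAt

/-- Both endpoints of the trajectory have norm at most r₀/2, so the ratio of their distances to the
axis is at most 3, hence at most 4. -/
lemma abs_transported_le (H : IsVortexSetting r₀ ρ R A M ε a z₀ w φ ψ z T) {t : ℝ}
    (ht : t ∈ Icc 0 T) (i : Fin N) (h : ∀ y ∈ tsupport (w i), ‖φ t y - z i t‖ ≤ ρ) (x : Plane) :
    |transported r₀ ψ (w i) t x| ≤ 4 * (M / ε ^ 2) := by
  have hb := H.data.bound i (ψ t x)
  have hM : 0 ≤ M / ε ^ 2 := (abs_nonneg _).trans hb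
  by_cases hx : transported r₀ ψ (w i) t x = 0
  · rw [hx, abs_zero]; positivity
  obtain ⟨hxH, hψ, hxz⟩ := norm_sub_le_of_transported_ne_zero H.flow ht.1 h hx
  have h1 := abs_le.mp ((abs_apply_le_norm x 1).trans (H.norm_le_half ht i hxz))
  have h2 := abs_le.mp ((abs_apply_le_norm (ψ t x) 1).trans
    (H.norm_le_half ⟨le_rfl, ht.1.trans ht.2⟩ i
      ((H.norm_le_of_mem_tsupport i hψ).trans H.eps_le)))
  have hr := H.axis
  have hden : r₀ / 2 ≤ r₀ + ψ t x 1 := by linarith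
  simp only [transported, indicator_of_mem hxH]
  have hratio : |(r₀ + x 1) / (r₀ + ψ t x 1)| ≤ 4 := by
    rw [abs_div, abs_of_nonneg (by linarith), abs_of_pos (by linarith), div_le_iff₀ (by linarith)]
    linarith
  rw [abs_mul]
  gcongr

/-- The localized weak formulation with test function 1 conserves the mass of each component
separately while the supports are apart. -/
lemma integral_transported (H : IsVortexSetting r₀ ρ R A M ε a z₀ w φ ψ z T)
    (h : ∀ t ∈ Icc 0 T, ∀ i, ∀ y ∈ tsupport (w i), ‖φ t y - z i t‖ ≤ ρ) {t : ℝ}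
    (ht : t ∈ Icc 0 T) (i : Fin N) : ∫ x, transported r₀ ψ (w i) t x = a i := by
  have hder : ∀ t ∈ Icc 0 T,
      HasDerivWithinAt (fun s => ∫ x, transported r₀ ψ (w i) s x) 0 (Icc 0 T) t := by
    intro t ht
    have := H.flow.hasDerivWithinAt_integral (T := T) (z := z) (ρ := ρ) (R := R)
      H.continuousOn_center
      (fun s hs j x hx => (norm_sub_le_of_transported_ne_zero H.flow hs.1 (h s hs j) hx).2.2)
      H.pos H.radius_le ht i (fun j hj => H.separated t ht.1 j i hj)
      (g := fun _ => 1) contDiff_const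
    simpa using this
  have := constant_of_has_deriv_right_zero (f := fun s => ∫ x, transported r₀ ψ (w i) s x)
    (fun t ht => (hder t ht).continuousWithinAt)
    (fun t ht => (hder t (Ico_subset_Icc_self ht)).Ici_of_Icc ht) t ht
  rw [this, H.transported_zero (ht.1.trans ht.2), H.data.mass]

lemma isConfinedFlow (H : IsVortexSetting r₀ ρ R A M ε a z₀ w φ ψ z T)
    (h : ∀ t ∈ Icc 0 T, ∀ i, ∀ y ∈ tsupport (w i), ‖φ t y - z i t‖ ≤ ρ) :
    IsConfinedFlow r₀ ρ R A (4 * (M / ε ^ 2)) a w φ ψ z T where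
  flow := H.flow
  deriv := H.motion.deriv
  sign := H.exists_sign
  localized t ht :=
    { measurable := fun i => by
        refine measurable_transported ?_ (H.data.measurable i)
        have := H.flow.continuous_inv
        exact this.comp (f := fun x => (t, x)) (by fun_prop) fun x hx => ⟨ht.1, hx⟩
      bound := fun i x => H.abs_transported_le ht i (h t ht i) x
      support := fun i x hx =>
        (norm_sub_le_of_transported_ne_zero H.flow ht.1 (h t ht i) hx).2.2
      mass := fun i => H.integral_transported h ht i
      abs_mass := fun i => by
        obtain ⟨σ, hσ1, hσ⟩ := H.exists_sign i
        simp only [abs_transported (H.flow.mapsTo_inv t ht.1) hσ]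
        rw [integral_const_mul, H.integral_transported h ht]
        refine (le_abs_self _).trans ?_
        rw [abs_mul, hσ1, one_mul]
        exact H.mass_le i
      separated := H.separated t ht.1
      pos := H.pos
      radius_nonneg := H.radius_pos.le
      radius_le := H.radius_le
      far := H.far t ht
      axis := H.axis }

lemma isCompact_tsupport (H : IsVortexSetting r₀ ρ R A M ε a z₀ w φ ψ z T) (i : Fin N) :
    IsCompact (tsupport (w i)) :=
  (isCompact_closedBall (z₀ i) ε).of_isClosed_subset (isClosed_tsupport _)
    ((H.data.support i).trans Metric.ball_subset_closedBall)

lemma continuousOn_norm_sub (H : IsVortexSetting r₀ ρ R A M ε a z₀ w φ ψ z T) (i : Fin N) :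
    ContinuousOn (fun q : ℝ × Plane => ‖φ q.1 q.2 - z i q.1‖) (Ici 0 ×ˢ halfPlane r₀) :=
  (H.flow.continuous.sub ((H.continuousOn_center i).comp continuousOn_fst
    fun _ hq => hq.1)).norm

/-- The supports stay in the disks of radius `ρ` around the point vortices up to time `T`. -/
lemma norm_trajectory_sub_le (H : IsVortexSetting r₀ ρ R A M ε a z₀ w φ ψ z T) (hA : 0 ≤ A)
    {δ l₁ l₂ l₃ s' : ℝ} {k n : ℕ}
    (hreg : IsRegime N R A (4 * (M / ε ^ 2)) T ε δ l₁ l₂ l₃ s' k n)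
    (herr : axisymmetricError N r₀ A (4 * (M / ε ^ 2)) ε ≤ δ)
    (hl : l₃ * Real.exp ((lipConst N R A + 4) * T) < ρ) :
    ∀ t ∈ Icc 0 T, ∀ i, ∀ y ∈ tsupport (w i), ‖φ t y - z i t‖ ≤ ρ := by
  intro t ht
  have hT : 0 ≤ T := ht.1.trans ht.2
  have hφ0 : ∀ i, ∀ y ∈ tsupport (w i), ‖φ 0 y - z i 0‖ ≤ ε := fun i y hy => by
    rw [H.flow.init y (H.mem_halfPlane hT i hy)]
    exact H.norm_le_of_mem_tsupport i hy
  revert t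
  apply forall_mem_Icc_of_continuation
  · exact fun i y hy => (hφ0 i y hy).trans H.eps_le
  · have e : {t | t ∈ Icc 0 T ∧ ∀ i, ∀ y ∈ tsupport (w i), ‖φ t y - z i t‖ ≤ ρ} =
        Icc 0 T ∩ ⋂ i, ⋂ y ∈ tsupport (w i), {t | t ∈ Icc 0 T ∧ ‖φ t y - z i t‖ ≤ ρ} := by
      ext t
      simp only [mem_ofPred_eq, mem_inter_iff, mem_iInter]
      exact ⟨fun h => ⟨h.1, fun i y hy => ⟨h.1, h.2 i y hy⟩⟩,
        fun h => ⟨h.1, fun i y hy => (h.2 i y hy).2⟩⟩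
    rw [e]
    refine isClosed_Icc.inter (isClosed_iInter fun i => isClosed_biInter fun y hy => ?_)
    have hc : ContinuousOn (fun t => ‖φ t y - z i t‖) (Icc 0 T) :=
      (H.continuousOn_norm_sub i).comp (f := fun t => (t, y)) (by fun_prop)
        fun t ht => ⟨ht.1, H.mem_halfPlane hT i hy⟩
    exact hc.preimage_isClosed_of_isClosed isClosed_Icc isClosed_Iic
  · intro t ht hP
    have hc := (H.mono ht.2.le).isConfinedFlow hP
    -- Confinement up to time t yields the moment bounds up to time t, and these return a radius
    -- strictly smaller than ρ.
    have hlt : ∀ i, ∀ y ∈ tsupport (w i), ‖φ t y - z i t‖ < ρ := by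
      intro i y hy
      refine (hc.norm_trajectory_sub_le ht.2.le hA hreg herr (fun j x hx => ?_) i
        (H.mem_halfPlane hT i hy) (fun s hs => hP s hs i y hy) (hφ0 i y hy)
        ⟨ht.1, le_rfl⟩).trans_lt hl
      rw [H.transported_zero hT] at hx
      exact H.norm_le_of_mem_tsupport j (subset_tsupport _ hx)
    rw [eventually_all]
    intro i
    -- The strict inequality persists for a short time uniformly in y, because the initial support
    -- is compact and the flow is jointly continuous.
    have hev : ∀ᶠ s in 𝓝 t, ∀ y ∈ tsupport (w i), t ≤ s → ‖φ s y - z i s‖ < ρ := by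
      apply (H.isCompact_tsupport i).eventually_forall_of_forall_eventually
      intro y hy
      have hyH := H.mem_halfPlane hT i hy
      have h1 := H.continuousOn_norm_sub i (t, y) ⟨ht.1, hyH⟩
      have h2 : ∀ᶠ q in 𝓝[Ici 0 ×ˢ halfPlane r₀] (t, y), ‖φ q.1 q.2 - z i q.1‖ < ρ :=
        Tendsto.eventually_lt h1 tendsto_const_nhds (hlt i y hy)
      rw [eventually_nhdsWithin_iff] at h2
      have h3 : ∀ᶠ q : ℝ × Plane in 𝓝 (t, y), q.2 ∈ halfPlane r₀ :=
        continuous_snd.continuousAt.eventually_mem ((isOpen_halfPlane r₀).mem_nhds hyH)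
      filter_upwards [h2, h3] with q hq2 hq3 hq
      exact hq2 ⟨ht.1.trans hq, hq3⟩
    filter_upwards [hev.filter_mono nhdsWithin_le_nhds, self_mem_nhdsWithin] with s hs hts y hy
    exact (hs y hy (le_of_lt hts)).le

lemma norm_sub_le_of_mem_tsupport (H : IsVortexSetting r₀ ρ R A M ε a z₀ w φ ψ z T)
    (h : ∀ t ∈ Icc 0 T, ∀ i, ∀ y ∈ tsupport (w i), ‖φ t y - z i t‖ ≤ ρ) {t : ℝ}
    (ht : t ∈ Icc 0 T) (i : Fin N) {x : Plane} (hx : x ∈ tsupport (transported r₀ ψ (w i) t)) :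
    ‖x - z i t‖ ≤ ρ := by
  have hcl : IsClosed {x : Plane | ‖x - z i t‖ ≤ ρ} :=
    isClosed_le (by fun_prop) continuous_const
  exact closure_minimal (fun x hx =>
    (norm_sub_le_of_transported_ne_zero H.flow ht.1 (h t ht i) hx).2.2) hcl hx

end IsVortexSetting

/-- The speed of the point vortices is bounded in terms of their separation. -/
lemma IsPointVortexMotion.norm_le {N : ℕ} {a : Fin N → ℝ} {z₀ : Fin N → Plane}
    {z : Fin N → ℝ → Plane} (hz : IsPointVortexMotion a z₀ z) {R A : ℝ} (hR : 0 < R)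
    (hsep : ∀ t, 0 ≤ t → ∀ i j, i ≠ j → R ≤ ‖z i t - z j t‖) (hA : ∀ i, |a i| ≤ A) (i : Fin N)
    {t : ℝ} (ht : 0 ≤ t) : ‖z i t‖ ≤ ‖z₀ i‖ + N * (A / R) * t := by
  have hA0 : 0 ≤ A := (abs_nonneg _).trans (hA i)
  have hv : ∀ s, 0 ≤ s → ‖∑ j with j ≠ i, a j • kerK (z i s - z j s)‖ ≤ N * (A / R) := by
    intro s hs
    refine (norm_sum_le _ _).trans ?_
    calc ∑ j with j ≠ i, ‖a j • kerK (z i s - z j s)‖ ≤ ∑ j with j ≠ i, A / R := by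
          apply Finset.sum_le_sum
          intro j hj
          have := hsep s hs i j (Finset.mem_filter.mp hj).2.symm
          rw [norm_smul, Real.norm_eq_abs, div_eq_mul_inv]
          gcongr
          · exact hA j
          · exact (norm_kerK_le _).trans (by gcongr)
      _ ≤ ∑ _j : Fin N, A / R :=
          Finset.sum_le_sum_of_subset_of_nonneg (Finset.filter_subset _ _)
            fun _ _ _ => by positivity
      _ = _ := by simp
  have h := norm_image_sub_le_of_norm_deriv_le_segment' (f := z i) (a := 0) (b := t)
    (C := N * (A / R)) (fun s hs => (hz.deriv i s hs.1).mono Icc_subset_Ici_self)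
    (fun s hs => hv s hs.1) t ⟨ht, le_rfl⟩
  rw [hz.init, sub_zero] at h
  calc ‖z i t‖ = ‖z₀ i + (z i t - z₀ i)‖ := by simp
    _ ≤ ‖z₀ i‖ + ‖z i t - z₀ i‖ := norm_add_le _ _
    _ ≤ _ := by linarith

/-- Positive separation of the point vortices, as a bound from below by a positive real number. -/
lemma exists_separation {N : ℕ} {z : Fin N → ℝ → Plane} (h : 0 < minSeparation z) :
    ∃ R : ℝ, 0 < R ∧ ∀ t, 0 ≤ t → ∀ i j, i ≠ j → R ≤ ‖z i t - z j t‖ := by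
  obtain ⟨R, hR0, hR⟩ := ENNReal.lt_iff_exists_nnreal_btwn.mp h
  refine ⟨R, by exact_mod_cast hR0, fun t ht i j hij => ?_⟩
  have h1 : minSeparation z ≤ edist (z i t) (z j t) :=
    iInf_le_of_le t <| iInf_le_of_le ht <| iInf_le_of_le i <| iInf_le_of_le j <|
      iInf_le_of_le hij le_rfl
  have h2 : (R : ENNReal) ≤ edist (z i t) (z j t) := hR.le.trans h1
  rw [edist_nndist] at h2
  have h3 : R ≤ nndist (z i t) (z j t) := by exact_mod_cast h2
  rw [← dist_eq_norm]
  exact_mod_cast h3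

lemma le_exitTime {N : ℕ} {r₀ ρ T : ℝ} {ψ : ℝ → Plane → Plane} {w : Fin N → Plane → ℝ}
    {z : Fin N → ℝ → Plane} (hT : 0 < T)
    (h : ∀ t ∈ Icc 0 T, ∀ i, ∀ x ∈ tsupport (transported r₀ ψ (w i) t), ‖x - z i t‖ ≤ ρ) :
    (T : EReal) ≤ exitTime r₀ ψ w z ρ :=
  le_iInf fun i => le_sSup ⟨T, ⟨hT, fun s hs x hx => h s hs i x hx⟩, rfl⟩

/-! ### Choice of the scales -/

lemma eventually_mul_rpow_le (C : ℝ) {p q : ℝ} (h : p < q) :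
    ∀ᶠ L : ℝ in atTop, C * L ^ p ≤ L ^ q := by
  filter_upwards [(tendsto_rpow_atTop (sub_pos.mpr h)).eventually_ge_atTop C,
    eventually_gt_atTop 0] with L h1 h2
  have h3 : 0 < L ^ p := Real.rpow_pos_of_pos h2 p
  calc C * L ^ p ≤ L ^ (q - p) * L ^ p := by gcongr
    _ = L ^ q := by rw [← Real.rpow_add h2]; ring_nf

lemma eventually_mul_exp_neg_le (C q : ℝ) :
    ∀ᶠ L : ℝ in atTop, C * Real.exp (-L) ≤ L ^ q := by
  filter_upwards [(tendsto_exp_div_rpow_atTop (-q)).eventually_ge_atTop C,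
    eventually_gt_atTop 0] with L h1 h2
  have h3 : 0 < L ^ (-q) := Real.rpow_pos_of_pos h2 _
  rw [le_div_iff₀ h3] at h1
  have h4 : L ^ q * L ^ (-q) = 1 := by rw [← Real.rpow_add h2]; simp
  have h5 : 0 < L ^ q := Real.rpow_pos_of_pos h2 _
  have h6 : Real.exp L * Real.exp (-L) = 1 := by rw [← Real.exp_add]; simp
  have h7 : 0 < Real.exp (-L) := Real.exp_pos _
  calc C * Real.exp (-L) = C * (L ^ (-q)) * L ^ q * Real.exp (-L) := by
        rw [mul_assoc C, mul_comm (L ^ (-q)), h4, mul_one]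
    _ ≤ Real.exp L * L ^ q * Real.exp (-L) := by gcongr
    _ = L ^ q * (Real.exp L * Real.exp (-L)) := by ring
    _ = L ^ q := by rw [h6, mul_one]

/-- A time of order log L costs only a small power of L in any exponential of rate at most κ: this
is the origin of the time scale log |log ε|. -/
lemma exp_mul_log_le {c κ θ L : ℝ} (hκ : 0 < κ) (hc : c ≤ κ) (hθ : 0 ≤ θ) (hL : 1 ≤ L) :
    Real.exp (c * (θ / κ * Real.log L)) ≤ L ^ θ := by
  rw [Real.rpow_def_of_pos (by linarith)]
  apply Real.exp_le_exp.mpr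
  have hl : 0 ≤ Real.log L := Real.log_nonneg hL
  calc c * (θ / κ * Real.log L) ≤ κ * (θ / κ * Real.log L) := by gcongr
    _ = Real.log L * θ := by field_simp

/-- The constant in the bound of the axisymmetric error. -/
def errorConst (N : ℕ) (A M α : ℝ) : ℝ := N * (20 * (A * (5 + α) + 8 * Real.pi * M)) + 1

lemma errorConst_pos {N : ℕ} {A M α : ℝ} (hA : 0 ≤ A) (hM : 0 ≤ M) (hα : 0 ≤ α) :
    0 < errorConst N A M α := by
  have := Real.pi_pos
  unfold errorConst; positivity

/-- Concentration at scale s = ε makes the local term bounded: ε · (2π · 4Mε⁻² · ε + A/ε) = 8πM + A.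
The logarithm is O(L), and the prefactor 1/r₀ = L^(-α) leaves L^(1-α). -/
lemma axisymmetricError_le {N : ℕ} {A M α L : ℝ} (hA : 0 ≤ A) (hM : 0 ≤ M) (hα : 0 ≤ α)
    (hL : 1 ≤ L) :
    axisymmetricError N (L ^ α) A (4 * (M / Real.exp (-L) ^ 2)) (Real.exp (-L)) ≤
      errorConst N A M α * L ^ (-(α - 1)) := by
  have hL0 : 0 < L := by linarith
  have hr : 0 < L ^ α := Real.rpow_pos_of_pos hL0 α
  have hε := Real.exp_pos (-L)
  have hpi := Real.pi_pos
  have hlog : Real.log (1 + 4 * L ^ α / Real.exp (-L)) ≤ (3 + α) * L := by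
    have h1 : (1 : ℝ) ≤ L ^ α * Real.exp L :=
      one_le_mul_of_one_le_of_one_le (Real.one_le_rpow hL hα) (Real.one_le_exp hL0.le)
    have h2 : 1 + 4 * L ^ α / Real.exp (-L) ≤ Real.exp 2 * (L ^ α * Real.exp L) := by
      have e : 4 * L ^ α / Real.exp (-L) = 4 * (L ^ α * Real.exp L) := by
        rw [Real.exp_neg]; field_simp
      have : (5 : ℝ) ≤ Real.exp 2 := by
        have := Real.exp_one_gt_d9
        rw [show (2 : ℝ) = 1 + 1 by norm_num, Real.exp_add]
        nlinarith
      rw [e]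
      nlinarith
    calc _ ≤ Real.log (Real.exp 2 * (L ^ α * Real.exp L)) := by
          apply Real.log_le_log (by positivity) h2
      _ = 2 + (α * Real.log L + L) := by
          rw [Real.log_mul (by positivity) (by positivity), Real.log_exp,
            Real.log_mul hr.ne' (by positivity), Real.log_exp, Real.log_rpow hL0]
      _ ≤ (3 + α) * L := by
          have : Real.log L ≤ L := (Real.log_le_sub_one_of_pos hL0).trans (by linarith)
          nlinarith [mul_le_mul_of_nonneg_left this hα]
  have hrpow : L ^ (-(α - 1)) = L / L ^ α := by
    rw [neg_sub, Real.rpow_sub hL0, Real.rpow_one]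
  rw [axisymmetricError, errorConst, hrpow]
  have e : Real.exp (-L) * (2 * Real.pi * (4 * (M / Real.exp (-L) ^ 2)) * Real.exp (-L) +
      A / Real.exp (-L)) = 8 * Real.pi * M + A := by field_simp; ring
  rw [e]
  have hb : A * (1 + Real.log (1 + 4 * L ^ α / Real.exp (-L))) + (8 * Real.pi * M + A) ≤
      (A * (5 + α) + 8 * Real.pi * M) * L := by
    have h1 : A * (1 + Real.log (1 + 4 * L ^ α / Real.exp (-L))) ≤ A * (L + (3 + α) * L) := by
      gcongr
    have h2 : (8 * Real.pi * M + A) * 1 ≤ (8 * Real.pi * M + A) * L := by gcongr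
    linarith [show A * (L + (3 + α) * L) + (8 * Real.pi * M + A) * L =
      (A * (5 + α) + 8 * Real.pi * M) * L by ring]
  calc _ ≤ N * (20 / L ^ α * ((A * (5 + α) + 8 * Real.pi * M) * L)) := by gcongr
    _ = N * (20 * (A * (5 + α) + 8 * Real.pi * M)) * (L / L ^ α) := by ring
    _ ≤ _ := by gcongr; linarith

lemma eventually_isRegime (N : ℕ) {R A M γ β C : ℝ} (hA : 0 ≤ A)
    (hβ : β ∈ Ioo 0 (γ / 4)) (hC : 0 < C) :
    ∃ ζ : ℝ, 0 < ζ ∧ ∀ᶠ L : ℝ in atTop, ∃ l₁ l₂ l₃ s' : ℝ, ∃ k n : ℕ,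
      IsRegime N R A (4 * (M / Real.exp (-L) ^ 2)) (ζ * Real.log L) (Real.exp (-L))
        (C * L ^ (-γ)) l₁ l₂ l₃ s' k n ∧
      l₃ * Real.exp ((lipConst N R A + 4) * (ζ * Real.log L)) < L ^ (-β) := by
  obtain ⟨hβ0, hβγ⟩ := hβ
  have hG := growthConst_pos (N := N) (R := R) hA
  have hD := driftConst_pos (N := N) (R := R) hA
  have hLip := lipConst_nonneg (N := N) (R := R) hA
  set Λ := lipConst N R A + 4 with hΛ
  have hΛ0 : 0 < Λ := by linarith
  set κ := growthConst N R A + Λ with hκ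
  have hκ0 : 0 < κ := by linarith
  -- The gap between β and γ/4 is divided in three equal steps, giving the exponents γ/4, β + 2η and
  -- β + η of l₁, l₂ and l₃. The loss θ = η/2 due to the exponentials is half a step.
  set η := (γ / 4 - β) / 3 with hη
  have hη0 : 0 < η := by rw [hη]; linarith
  set θ := η / 2 with hθ
  have hθ0 : 0 < θ := by positivity
  set β₂ := β + 2 * η with hβ₂
  set β₃ := β + η with hβ₃
  have hβ₁ : γ / 4 = β + 3 * η := by rw [hη]; ring
  -- The second-stage condition reads 1 + (θ - γ/4)(2k+2) < -β₂(2k+4), where 1 is the exponent of n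
  -- ~ L. As γ/4 - θ - β₂ = η/2, this is 1 + 2β₂ < (k+1)η.
  obtain ⟨k₀, hk₀⟩ := exists_nat_gt ((1 + 2 * β₂) / η)
  set k := k₀ + 1 with hk
  have hkη : 1 + 2 * β₂ < (k + 1) * η := by
    rw [div_lt_iff₀ hη0] at hk₀
    rw [hk]; push_cast
    linarith [show ((k₀ : ℝ) + 1 + 1) * η = k₀ * η + 2 * η by ring]
  refine ⟨θ / κ, by positivity, ?_⟩
  have hpi := Real.pi_pos
  filter_upwards [eventually_ge_atTop (1 : ℝ), eventually_ge_atTop ((k + 1 : ℕ) : ℝ),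
    eventually_mul_exp_neg_le 1 (-(γ / 4)),
    eventually_mul_exp_neg_le ((N * A + 1) / C) (-γ),
    eventually_mul_rpow_le (driftConst N R A * C) (p := θ - γ) (q := -(γ / 4)) (by linarith),
    eventually_mul_rpow_le (4 * k * (1 + A) * C) (p := θ - γ) (q := -(γ / 4) * (3 : ℕ))
      (by push_cast; linarith),
    eventually_mul_rpow_le (4 * 2 ^ (2 * k + 2) * (2 * A + 1))
      (p := 1 + (θ - γ / 4) * (2 * k + 2 : ℕ)) (q := -β₂ * (2 * k + 2 + 2 : ℕ))
      (by
        push_cast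
        nlinarith),
    eventually_mul_rpow_le (2 * Real.exp 2) (p := θ - β₂) (q := -β₃) (by linarith),
    eventually_mul_exp_neg_le (8 * Real.pi * M + (2 * A + 1)) (-β₃),
    eventually_mul_rpow_le 2 (p := θ - β₃) (q := -β) (by linarith)]
    with L hL1 hLk e1 e2 e3 e4 e5 e6 e7 e8
  have hL0 : 0 < L := by linarith
  have hpos : ∀ x : ℝ, 0 < L ^ x := fun x => Real.rpow_pos_of_pos hL0 x
  have hEG : Real.exp (growthConst N R A * (θ / κ * Real.log L)) ≤ L ^ θ :=
    exp_mul_log_le hκ0 (by linarith) hθ0.le hL1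
  have hEΛ : Real.exp (Λ * (θ / κ * Real.log L)) ≤ L ^ θ :=
    exp_mul_log_le hκ0 (by linarith) hθ0.le hL1
  have hEΛm : ∀ m : ℕ, Real.exp (m * Λ * (θ / κ * Real.log L)) ≤ (L ^ θ) ^ m := by
    intro m
    rw [mul_assoc, Real.exp_nat_mul]
    gcongr
  have hγθ : L ^ (-γ) * L ^ θ = L ^ (θ - γ) := by rw [← Real.rpow_add hL0]; ring_nf
  have hδE : C * L ^ (-γ) * Real.exp (growthConst N R A * (θ / κ * Real.log L)) ≤
      C * L ^ (θ - γ) := by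
    rw [← hγθ, ← mul_assoc C _ (L ^ θ)]
    exact mul_le_mul_of_nonneg_left hEG (mul_nonneg hC.le (hpos _).le)
  have hε := Real.exp_pos (-L)
  -- With s' = ε³ the bulk term B s' is O(ε), and n = ⌈L⌉ makes the outer mass O(ε⁴), so that its
  -- quotient by s' is O(ε) as well.
  refine ⟨L ^ (-(γ / 4)), L ^ (-β₂), L ^ (-β₃), Real.exp (-L) ^ 3, k, ⌈L⌉₊, ?_, ?_⟩
  · refine
      { eps_pos := hε
        delta_pos := mul_pos hC (hpos _)
        l₁_pos := hpos _
        s'_pos := by positivity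
        l₁_le := Real.rpow_le_rpow_of_exponent_le hL1 (by linarith)
        l₂_le := Real.rpow_le_rpow_of_exponent_le hL1 (by linarith)
        eps_le := by linarith
        second := ?_
        k_pos := by omega
        k_lt := by
          have := hLk.trans (Nat.le_ceil L)
          exact_mod_cast this
        drift := ?_
        first := ?_
        intermediate := ?_
        outer := ?_ }
    · have h1 : (N * A + 1) * Real.exp (-L) ≤ C * L ^ (-γ) := by
        rw [div_mul_eq_mul_div, div_le_iff₀ hC] at e2
        linarith
      have hNA : 0 ≤ N * A := by positivity
      calc N * (A * Real.exp (-L) ^ 2) = (N * A) * Real.exp (-L) ^ 2 := by ring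
        _ ≤ (N * A + 1) ^ 2 * Real.exp (-L) ^ 2 := by gcongr; nlinarith
        _ = ((N * A + 1) * Real.exp (-L)) ^ 2 := by ring
        _ ≤ _ := by gcongr
    · calc _ ≤ driftConst N R A * (C * L ^ (θ - γ)) := by gcongr
        _ = driftConst N R A * C * L ^ (θ - γ) := by ring
        _ ≤ _ := e3
    · rw [← Real.rpow_mul_natCast hL0.le]
      calc _ ≤ 4 * k * ((1 + A) * (C * L ^ (θ - γ))) := by gcongr
        _ = 4 * k * (1 + A) * C * L ^ (θ - γ) := by ring
        _ ≤ _ := e4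
    · rw [← Real.rpow_mul_natCast hL0.le (-β₂)]
      refine le_trans ?_ e5
      have hn : ((2 * ⌈L⌉₊ : ℕ) : ℝ) ≤ 4 * L := by
        have := (Nat.ceil_lt_add_one hL0.le).le
        push_cast; linarith
      have hexp : L * ((L ^ (-(γ / 4))) ^ (2 * k + 2) * (L ^ θ) ^ (2 * k + 2)) =
          L ^ (1 + (θ - γ / 4) * (2 * k + 2 : ℕ)) := by
        rw [Real.rpow_add hL0, Real.rpow_one, Real.rpow_mul_natCast hL0.le, ← mul_pow,
          ← Real.rpow_add hL0]
        ring_nf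
      rw [← hexp]
      have hp := hpos (-(γ / 4))
      calc _ ≤ (4 * L) * 2 ^ (2 * k + 2) * ((2 * A + 1) * (L ^ (-(γ / 4))) ^ (2 * k + 2) *
            (L ^ θ) ^ (2 * k + 2)) := by
            gcongr
            exact hEΛm _
        _ = _ := by ring
    · set m := 2 * ⌈L⌉₊ + 2 with hm
      have hp₂ := hpos (-β₂)
      have hp₃ := hpos (-β₃)
      -- The ratio of scales is below e⁻², and its power 2⌈L⌉ + 2 is below e^(-4L) = ε⁴.
      have hratio : L ^ (-β₂) * L ^ θ / (L ^ (-β₃) / 2) ≤ Real.exp (-2) := by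
        rw [div_le_iff₀ (by positivity), ← Real.rpow_add hL0]
        have h6 : Real.exp (-2) * (2 * Real.exp 2 * L ^ (θ - β₂)) ≤
            Real.exp (-2) * L ^ (-β₃) := by gcongr
        have h7 : Real.exp (-2) * Real.exp 2 = 1 := by rw [← Real.exp_add]; simp
        have h8 : Real.exp (-2) * (2 * Real.exp 2 * L ^ (θ - β₂)) = 2 * L ^ (θ - β₂) := by
          linear_combination (2 * L ^ (θ - β₂)) * h7
        rw [show -β₂ + θ = θ - β₂ by ring]
        linarith
      have hmL : Real.exp (-2) ^ m ≤ Real.exp (-L) ^ 4 := by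
        rw [← Real.exp_nat_mul, ← Real.exp_nat_mul]
        apply Real.exp_le_exp.mpr
        have := Nat.le_ceil L
        rw [hm]; push_cast; linarith
      have hA1 : 0 ≤ 2 * A + 1 := by linarith
      have h1 : (2 * A + 1) * (L ^ (-β₂)) ^ m *
          Real.exp ((m : ℕ) * Λ * (θ / κ * Real.log L)) / (L ^ (-β₃) / 2) ^ m ≤
          (2 * A + 1) * Real.exp (-L) ^ 4 := by
        calc _ ≤ (2 * A + 1) * (L ^ (-β₂)) ^ m * (L ^ θ) ^ m / (L ^ (-β₃) / 2) ^ m := by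
              gcongr
              exact hEΛm m
          _ = (2 * A + 1) * (L ^ (-β₂) * L ^ θ / (L ^ (-β₃) / 2)) ^ m := by
              rw [div_pow (L ^ (-β₂) * L ^ θ), mul_pow]; ring
          _ ≤ (2 * A + 1) * Real.exp (-2) ^ m := by
              have := hpos θ
              gcongr
          _ ≤ _ := by gcongr
      calc _ ≤ 2 * Real.pi * (4 * (M / Real.exp (-L) ^ 2)) * Real.exp (-L) ^ 3 +
            (2 * A + 1) * Real.exp (-L) ^ 4 / Real.exp (-L) ^ 3 := by gcongr
        _ = (8 * Real.pi * M + (2 * A + 1)) * Real.exp (-L) := by field_simp; ring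
        _ ≤ _ := e7
  · have h1 : L ^ (-β₃) * L ^ θ = L ^ (θ - β₃) := by rw [← Real.rpow_add hL0]; ring_nf
    have h2 := hpos (θ - β₃)
    have h3 := hpos (-β₃)
    calc L ^ (-β₃) * Real.exp (Λ * (θ / κ * Real.log L)) ≤ L ^ (-β₃) * L ^ θ := by gcongr
      _ = L ^ (θ - β₃) := h1
      _ < 2 * L ^ (θ - β₃) := by linarith
      _ ≤ _ := e8

end VortexRings

end

/-! ### Assembly of the estimates for small ε. -/

theorem theorem2p1 (N : ℕ) (α : ℝ) (hα : 1 < α) (a : Fin N → ℝ)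
    (z₀ : Fin N → VortexRings.Plane) (z : Fin N → ℝ → VortexRings.Plane)
    (hz : VortexRings.IsPointVortexMotion a z₀ z)
    (hR : 0 < VortexRings.minSeparation z)
    (M : ℝ) (hM : 0 < M) (ε₁ : ℝ) (hε₁ : 0 < ε₁)
    (ω₀ : ℝ → Fin N → VortexRings.Plane → ℝ)
    (hω₀ : ∀ ε ∈ Set.Ioo 0 ε₁, VortexRings.IsConcentratedData M ε a z₀ (ω₀ ε))
    (β : ℝ) (hβ : β ∈ Set.Ioo 0 ((α - 1) / 4)) :
    ∃ ε₀ : ℝ, 0 < ε₀ ∧ ∃ ζ : ℝ, 0 < ζ ∧ ∀ ε ∈ Set.Ioo 0 ε₀,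
      ∀ φ ψ : ℝ → VortexRings.Plane → VortexRings.Plane,
        VortexRings.IsEulerFlow (|Real.log ε| ^ α) (fun x => ∑ i, ω₀ ε i x) φ ψ →
          ((ζ * Real.log |Real.log ε| : ℝ) : EReal) ≤
            VortexRings.exitTime (|Real.log ε| ^ α) ψ (ω₀ ε) z (|Real.log ε| ^ (-β)) := by
  open VortexRings Filter in
  obtain ⟨R, hR0, hsep⟩ := exists_separation hR
  set A : ℝ := ∑ i, |a i| with hAdef
  have hA : 0 ≤ A := Finset.sum_nonneg fun i _ => abs_nonneg _
  have haA : ∀ i, |a i| ≤ A := fun i =>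
    Finset.single_le_sum (f := fun i => |a i|) (fun j _ => abs_nonneg _) (Finset.mem_univ i)
  set Z : ℝ := ∑ i, ‖z₀ i‖ with hZdef
  have hZ0 : 0 ≤ Z := Finset.sum_nonneg fun i _ => norm_nonneg _
  have hZ : ∀ i, ‖z₀ i‖ ≤ Z := fun i =>
    Finset.single_le_sum (f := fun i => ‖z₀ i‖) (fun j _ => norm_nonneg _) (Finset.mem_univ i)
  have hα0 : 0 ≤ α := by linarith
  have hC := errorConst_pos (N := N) hA hM.le hα0
  obtain ⟨ζ, hζ, hev⟩ := eventually_isRegime N (R := R) (M := M) hA hβ hC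
  have hev2 : ∀ᶠ L : ℝ in atTop, L ^ (-β) ≤ min 1 (R / 8) :=
    (tendsto_rpow_neg_atTop hβ.1).eventually_le_const (by positivity)
  obtain ⟨L₀, hL₀⟩ := eventually_atTop.mp (hev.and (hev2.and
    ((eventually_mul_exp_neg_le 1 (-β)).and
      (eventually_mul_rpow_le (2 * (Z + N * (A / R) * ζ + 1)) hα))))
  -- The number 2 in the maximum ensures L ≥ 2, so that the claimed time ζ log L is positive.
  refine ⟨min ε₁ (Real.exp (-(max L₀ 2))), by positivity, ζ, hζ, fun ε hε φ ψ hflow => ?_⟩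
  have hε0 : 0 < ε := hε.1
  have hεL : ε < Real.exp (-(max L₀ 2)) := hε.2.trans_le (min_le_right _ _)
  have hlog : Real.log ε < -(max L₀ 2) := (Real.log_lt_iff_lt_exp hε0).mpr hεL
  have hL2 : 2 ≤ -Real.log ε := by linarith [le_max_right L₀ 2]
  have hLabs : |Real.log ε| = -Real.log ε := abs_of_neg (by linarith)
  have hexp : Real.exp (-|Real.log ε|) = ε := by rw [hLabs, neg_neg, Real.exp_log hε0]
  obtain ⟨⟨l₁, l₂, l₃, s', k, n, hreg, hl⟩, hρ, hερ, hfar⟩ :=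
    hL₀ |Real.log ε| (by rw [hLabs]; linarith [le_max_left L₀ 2])
  have herr := axisymmetricError_le (N := N) (A := A) (M := M) (α := α) hA hM.le hα0
    (show 1 ≤ |Real.log ε| by rw [hLabs]; linarith)
  rw [hexp] at hreg herr hερ
  set L := |Real.log ε|
  have hL : 2 ≤ L := by linarith
  have hlogL : 0 < Real.log L := Real.log_pos (by linarith)
  have hρ0 : 0 < L ^ (-β) := Real.rpow_pos_of_pos (by linarith) _
  have hV : 0 ≤ N * (A / R) := by positivity
  have H : IsVortexSetting (L ^ α) (L ^ (-β)) R A M ε a z₀ (ω₀ ε) φ ψ z (ζ * Real.log L) :=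
    { data := hω₀ ε ⟨hε0, hε.2.trans_le (min_le_left _ _)⟩
      flow := hflow
      motion := hz
      separated := hsep
      pos := hR0
      radius_pos := hρ0
      radius_le := hρ.trans (min_le_right _ _)
      mass_le := haA
      axis := Real.rpow_pos_of_pos (by linarith) _
      -- The point vortices have bounded speed, so up to time ζ log L they travel at most O(L),
      -- which is less than r₀ = L^α because α > 1.
      far := fun t ht i => by
        have h1 := hz.norm_le hR0 hsep haA i ht.1
        have h2 : N * (A / R) * t ≤ N * (A / R) * ζ * L := by
          have : Real.log L ≤ L := (Real.log_le_sub_one_of_pos (by linarith)).trans (by linarith)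
          calc N * (A / R) * t ≤ N * (A / R) * (ζ * L) := by
                gcongr
                exact ht.2.trans (by gcongr)
            _ = _ := by ring
        have h3 := hρ.trans (min_le_left _ _)
        have h4 := hZ i
        rw [Real.rpow_one] at hfar
        nlinarith
      eps_pos := hε0
      eps_le := by linarith }
  have hmain := H.norm_trajectory_sub_le hA hreg herr hl
  exact le_exitTime (by positivity) fun t ht i x hx =>
    H.norm_sub_le_of_mem_tsupport hmain ht i hx
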